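/- Let $q$ be a prime power, $p$ a prime (which may or may not divide $q$), and let $\mathbf F_{q^2}$ be the field with $q^2$ elements. For $n\ge 1$ equip $V_n=\mathbf F_{q^2}^n$ with the nondegenerate Hermitian form $\langle u,v\rangle = c_n\sum_{i=1}^n(-1)^{i+1}u_i v_{n+1-i}^{\,q}$, where $c_n\in\mathbf F_{q^2}$ is any constant with $c_n^{q-1}=(-1)^{n+1}$. Let $\mathrm{GL}^-(n,\mathbf F_q)$ be the general unitary group of all linear automorphisms of $V_n$ preserving this form, and let $\mathrm L_n^-(\mathbf F_q)^*$ be the poset, under inclusion, of totally isotropic subspaces $0\subsetneq U\subsetneq V_n$. For a finite poset $P$ let $\widetilde\chi(P)=\sum_{s}(-1)^{|s|-1}$ be its reduced Euler characteristic, the sum running over all chains $s$ of $P$ including the empty one (so $\widetilde\chi(\emptyset)=-1$). For $r\ge 1$ the $r$th $p$-primary equivariant reduced Euler characteristic is $$\widetilde\chi{}_r^{\,p}(\mathrm{GL}^-(n,\mathbf F_q))=\frac1{|\mathrm{GL}^-(n,\mathbf F_q)|}\sum_{(X_1,\dots,X_r)}\widetilde\chi\big(C_{\mathrm L_n^-(\mathbf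 F_q)^*}(X_1,\dots,X_r)\big),$$ where the sum is over all $r$-tuples of pairwise commuting elements of $\mathrm{GL}^-(n,\mathbf F_q)$ such that $X_2,\dots,X_r$ have $p$-power order, and $C_{\mathrm L_n^-(\mathbf F_q)^*}(X_1,\dots,X_r)$ is the subposet of those $U$ with $X_iU=U$ for all $i$. Put $$\mathrm{F}^p\mathrm{GL}^-_{r}(x)(q)=1-\sum_{n\ge1}\widetilde\chi{}_{r}^{\,p}(\mathrm{GL}^-(n,\mathbf F_q))\,x^n .$$ Then for every $r\ge 0$ the power series $\mathrm{F}^p\mathrm{GL}^-_{r+1}(x)(q)$ has integer coefficients, and $$\mathrm{F}^p\mathrm{GL}^-_{r+1}(x)(q)=\exp\Big(\sum_{n\ge1}(-1)^{n+1}\big((q^n-(-1)^n)_p\big)^r\,\frac{x^n}{n}\Big)$$ as formal power series over $\mathbf Q$, where $m_p$ denotes the $p$-part of the nonzero integer $m$, the highest power of $p$ dividing $m$. -/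

import Mathlib

noncomputable section

namespace UnitaryBuilding

/-- The sesquilinear form `⟨u, v⟩ = c ∑_{1 ≤ i ≤ n} (-1)^(i+1) u_i (v_{n+1-i})^q` on `Fⁿ`
(indices are shifted to start at `0`). It is Hermitian if `|F| = q ^ 2` and
`c ^ (q - 1) = (-1) ^ (n + 1)`. -/
def form {F : Type*} [Field F] (q : ℕ) {n : ℕ} (c : F) (u v : Fin n → F) : F :=
  c * ∑ i : Fin n, (-1) ^ (i : ℕ) * u i * v (Fin.rev i) ^ q

/-- The general unitary group: all linear automorphisms of `Fⁿ` that preserve the form. -/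
def GU {F : Type*} [Field F] (q n : ℕ) (c : F) :
    Subgroup ((Fin n → F) ≃ₗ[F] (Fin n → F)) where
  carrier := {g | ∀ u v, form q c (g u) (g v) = form q c u v}
  mul_mem' {a b} ha hb u v := by
    rw [LinearEquiv.mul_apply, LinearEquiv.mul_apply, ha, hb]
  one_mem' _ _ := rfl
  inv_mem' {a} ha u v := by
    have h := ha (a⁻¹ u) (a⁻¹ v)
    rw [← LinearEquiv.mul_apply, ← LinearEquiv.mul_apply, mul_inv_cancel] at h
    exact h.symm

/-- The poset, under inclusion, of the totally isotropic subspaces `0 ⊊ U ⊊ Fⁿ`. -/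
abbrev IsotropicPoset {F : Type*} [Field F] (q n : ℕ) (c : F) : Type _ :=
  {U : Submodule F (Fin n → F) // U ≠ ⊥ ∧ U ≠ ⊤ ∧ ∀ u ∈ U, ∀ v ∈ U, form q c u v = 0}

/-- The reduced Euler characteristic of (the order complex of) a finite poset: the sum of
`(-1) ^ dim s = (-1) ^ (|s| - 1)` over all chains `s`, the empty chain included with
contribution `-1`. -/
def reducedEulerChar (P : Type*) [PartialOrder P] [Finite P] : ℤ :=
  ∑ᶠ s : {s : Finset P // IsChain (· ≤ ·) (s : Set P)}, (-1) ^ (s.1.card + 1)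

/-- The subposet of the totally isotropic subspaces that are invariant under all entries of a
tuple `X` (equivalently, under the subgroup generated by `X`). -/
abbrev FixedPoset {F : Type*} [Field F] {q n : ℕ} {c : F} {r : ℕ}
    (X : Fin r → GU q n c) : Type _ :=
  {U : IsotropicPoset q n c // ∀ i,
    U.1.map ((X i : (Fin n → F) ≃ₗ[F] (Fin n → F)) : (Fin n → F) →ₗ[F] (Fin n → F)) = U.1}

/-- The `r`-tuples (`r ≥ 1`) of pairwise commuting elements of a group in which every entry but
the first has `p`-power order, that is, the homomorphisms from `ℤ × ℤ_p ^ (r - 1)` to the group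
if it is finite. -/
def primaryTuples (p r : ℕ) (G : Type*) [Group G] : Set (Fin r → G) :=
  {X | (∀ i j, Commute (X i) (X j)) ∧ ∀ i : Fin r, (i : ℕ) ≠ 0 → ∃ k : ℕ, orderOf (X i) = p ^ k}

/-- The `r`-th `p`-primary equivariant reduced Euler characteristic of the poset of nontrivial
totally isotropic subspaces with the action of the general unitary group. -/
def primaryEulerChar {F : Type*} [Field F] [Finite F] (p r q n : ℕ) (c : F) : ℚ :=
  (∑ᶠ X : primaryTuples p r (GU q n c), (reducedEulerChar (FixedPoset X.1) : ℚ)) /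
    Nat.card (GU q n c)

/-- The generating function `1 - ∑_{n ≥ 1} χ_n xⁿ` of the negatives of the `r`-th `p`-primary
equivariant reduced Euler characteristics; `c n` is the constant in the form on `Fⁿ`. -/
def primaryGenFun {F : Type*} [Field F] [Finite F] (p r q : ℕ) (c : ℕ → F) : PowerSeries ℚ :=
  PowerSeries.mk fun n => if n = 0 then 1 else -primaryEulerChar p r q n (c n)

/-- The `p`-part of a nonzero integer: the highest power of `p` dividing it. -/
def pPart (p : ℕ) (m : ℤ) : ℕ := p ^ padicValInt p m

/-- The power series `∑_{n ≥ 1} (-1)^(n+1) ((qⁿ - (-1)ⁿ)_p)^r xⁿ / n`. -/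
def exponentSeries (p r q : ℕ) : PowerSeries ℚ :=
  PowerSeries.mk fun n =>
    if n = 0 then 0
    else (-1) ^ (n + 1) * (pPart p ((q : ℤ) ^ n - (-1) ^ n) : ℚ) ^ r / n

/-- `exp g = ∑_k g ^ k / k!` for a rational power series `g` without constant term. -/
def expSeries (g : PowerSeries ℚ) : PowerSeries ℚ := (PowerSeries.exp ℚ).subst g

end UnitaryBuilding

end

/-! Suppose first that `p` does not divide `q`. Let `A = (ℤ/p^N)^r` with `N` large. A tuple of
length `r + 1` is a homomorphism `ρ : A → GU` together with an element of the centralizer of its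
image. Through `ρ` the space `Fⁿ` becomes a Hermitian module over the semisimple group algebra `R =
F[A]`, whose involution inverts group elements and applies the `q`-power map to scalars. The
centralizer is the group of `R`-linear isometries `X`, and the reduced Euler characteristic of the
fixed poset is minus the sum of the Möbius values `μ(0, U)` over the isotropic `X`-invariant
submodules `U`, where `μ` belongs to the lattice of all `X`-invariant submodules.

This sum is multiplicative over the components fixed by the involution, which are either self-dual
or a sum of two components exchanged by it. Averaging over the isometries kills every component of
multiplicity at least two (`sum_mobSum_self_eq_zero`, `sum_mobSum_pair_eq_zero`): by Witt-type
extension the isometries are transitive on simple submodules of the relevant kind, so the simple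
ones cancel the zero submodule, and larger ones vanish by induction (`sum_mob_stabilizer_eq_zero`).
For a multiplicity free module the sum is a product of signs: `1` for a self-dual simple module,
which has no nonzero isotropic submodule, and `-1` for a pair of dual simple modules.

Symmetric elements of `R` are norms, so the Hermitian form on a multiplicity free module is unique
up to isometry (`exists_isometry_of_cyclic`). Hence the `ρ` with a given support form one conjugacy
class, and orbit counting cancels the group order (`sum_card_centralizer`). What remains is a sum of
signs over the sets of components of total dimension `n`.

The components correspond to the cycles of `χ ↦ χ^(-q)` on the characters of `A`. The square of this
map is the Galois action over `F`, so a cycle of length `d` gives a component of dimension `d`,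
self-dual for odd `d` and a hyperbolic pair for even `d` (`isDecomposition_of_isIndicator`). The
generating function is therefore `∏ (1 - (-x)^d)` over the cycles, and its logarithmic derivative
counts the fixed points of the iterates, that is, the characters with `χ^((-q)^k - 1) = 1`. Their
number is the `r`th power of the `p`-part of `q^k - (-1)^k`. As `N` depends on `n`, the comparison
is made one coefficient at a time (`coeff_prod_eq_coeff_expSeries`).

If `p` divides `q`, a tuple with nontrivial `ρ` contributes nothing (`mobSum_eq_zero_of_isPGroup`):
every nonzero invariant subspace contains nonzero fixed vectors of the `p`-group `A`, so `μ` lives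
below the fixed space `L`, and joining with `L ∩ L^⊥` makes the sum cancel. Only the first entry
matters, all `p`-parts are `1`, and the case `r = 0` of a prime not dividing `q` applies. -/

namespace UnitaryBuilding

open Finset

/-! ### Chains and reduced Euler characteristics -/

open scoped Classical in
/-- The alternating count of chains in a finite set `D` of a poset. -/
noncomputable def chainSum {P : Type*} [PartialOrder P] (D : Finset P) : ℤ :=
  ∑ s ∈ D.powerset.filter (fun s : Finset P => IsChain (· ≤ ·) (s : Set P)), (-1) ^ s.card

open scoped Classical in
-- Removing `x` matches the chains through `x` with the chains of elements below `x`, since a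
-- maximal `x` can only be the top of a chain; the sign changes.
theorem chainSum_of_maximal {P : Type*} [PartialOrder P] (D : Finset P) (x : P) (hx : x ∈ D)
    (hmax : ∀ y ∈ D, ¬ x < y) :
    chainSum D = chainSum (D.erase x) - chainSum (D.filter (· < x)) := by
  unfold chainSum
  rw [← Finset.sum_filter_add_sum_filter_not (D.powerset.filter _) (fun s => x ∉ s)]
  rw [sub_eq_add_neg]
  congr 1
  · apply Finset.sum_congr _ (fun _ _ => rfl)
    ext s
    simp only [mem_filter, mem_powerset, subset_erase]
    tauto
  · rw [← Finset.sum_neg_distrib]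
    refine Finset.sum_bij' (fun s _ => s.erase x) (fun s _ => insert x s) ?_ ?_ ?_ ?_ ?_
    · intro s hs
      simp only [mem_filter, mem_powerset, not_not] at hs ⊢
      obtain ⟨⟨h1, h2⟩, h3⟩ := hs
      refine ⟨fun y hy => ?_, h2.mono (by simp)⟩
      have hy' := Finset.mem_erase.1 hy
      refine mem_filter.2 ⟨h1 hy'.2, ?_⟩
      rcases h2 hy'.2 h3 hy'.1 with h | h
      · exact lt_of_le_of_ne h hy'.1
      · exact absurd (lt_of_le_of_ne h (Ne.symm hy'.1)) (hmax y (h1 hy'.2))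
    · intro s hs
      simp only [mem_filter, mem_powerset, not_not] at hs ⊢
      obtain ⟨h1, h2⟩ := hs
      refine ⟨⟨?_, ?_⟩, mem_insert_self _ _⟩
      · intro y hy
        rcases mem_insert.1 hy with rfl | hy
        · exact hx
        · exact (mem_filter.1 (h1 hy)).1
      · rw [coe_insert]
        refine h2.insert fun y hy _ => Or.inr (mem_filter.1 (h1 hy)).2.le
    · intro s hs
      simp only [mem_filter, not_not] at hs
      exact insert_erase hs.2
    · intro s hs
      simp only [mem_filter, mem_powerset] at hs
      refine erase_insert fun h => ?_
      exact lt_irrefl _ (mem_filter.1 (hs.1 h)).2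
    · intro s hs
      simp only [mem_filter, not_not] at hs
      rw [← Finset.card_erase_add_one hs.2, pow_succ]
      ring

open scoped Classical in
-- The function `f` is the Möbius function `μ(0̂, x)` of `P` with a new bottom `0̂` adjoined.
-- Maximal elements are removed one at a time; since `D` is a lower set, the part of `D` below `x`
-- is everything below `x`, which is what the recursion of `f` involves.
theorem chainSum_eq {P : Type*} [PartialOrder P] [Fintype P] (f : P → ℤ)
    (hf : ∀ x, f x = -1 - ∑ y with y < x, f y) (D : Finset P) (hD : IsLowerSet (D : Set P)) :
    chainSum D = 1 + ∑ x ∈ D, f x := by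
  induction hk : D.card using Nat.strong_induction_on generalizing D with
  | _ k ih =>
  rcases D.eq_empty_or_nonempty with rfl | hne
  · simp [chainSum, Finset.filter_singleton]
  · obtain ⟨x, hx⟩ := D.exists_maximal hne
    have hxD : x ∈ D := hx.1
    have hmax : ∀ y ∈ D, ¬ x < y := fun y hy h => hx.not_gt hy h
    have h1 : (D.filter (· < x)) = univ.filter (· < x) := by
      ext y
      simp only [mem_filter, mem_univ, true_and, and_iff_right_iff_imp]
      exact fun h => hD h.le hxD
    have hlt : (D.filter (· < x)).card < k := by
      rw [← hk]
      exact card_lt_card ⟨filter_subset _ _, fun h => lt_irrefl _ (mem_filter.1 (h hxD)).2⟩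
    rw [chainSum_of_maximal D x hxD hmax, ih _ (by rw [← hk]; exact card_erase_lt_of_mem hxD)
      (D.erase x) ?_ rfl, ih _ hlt _ ?_ rfl, ← Finset.add_sum_erase D f hxD, hf x, h1]
    · ring
    · intro a b hab ha
      have ha' := mem_filter.1 (mem_coe.1 ha)
      exact mem_coe.2 (mem_filter.2 ⟨hD hab ha'.1, lt_of_le_of_lt hab ha'.2⟩)
    · intro a b hab ha
      have ha' := mem_erase.1 (mem_coe.1 ha)
      refine mem_coe.2 (mem_erase.2 ⟨?_, hD hab ha'.2⟩)
      rintro rfl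
      exact hmax a ha'.2 (lt_of_le_of_ne hab (Ne.symm ha'.1))

open scoped Classical in
theorem reducedEulerChar_eq {P : Type*} [PartialOrder P] [Fintype P] (f : P → ℤ)
    (hf : ∀ x, f x = -1 - ∑ y with y < x, f y) :
    reducedEulerChar P = -(1 + ∑ x, f x) := by
  rw [← chainSum_eq f hf univ (by simpa using isLowerSet_univ), chainSum, reducedEulerChar,
    ← Finset.sum_neg_distrib, finsum_eq_sum_of_fintype]
  rw [Finset.sum_subtype (univ.powerset.filter
    (fun s : Finset P => IsChain (· ≤ ·) (s : Set P))) (p := fun s : Finset P =>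
      IsChain (· ≤ ·) (s : Set P)) (by simp)]
  exact Finset.sum_congr rfl fun s _ => by ring

/-! ### Möbius functions of subposets -/

section Mob

variable {α : Type*} [PartialOrder α] [OrderBot α]

open scoped Classical in
/-- The Möbius function `μ(⊥, x)` of the subposet of a finite poset formed by a set `S` (which
is supposed to contain `⊥`), and `x`. -/
noncomputable def mob [Finite α] (S : Set α) (x : α) : ℤ :=
  (if x = ⊥ then 1 else 0) - ∑ᶠ y : {y : α // y < x ∧ y ∈ S}, mob S y.1
termination_by (wellFounded_lt : WellFounded fun a b : α => a < b).wrap x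
decreasing_by exact y.2.1

open scoped Classical in
theorem mob_eq [Fintype α] (S : Set α) (x : α) :
    mob S x = (if x = ⊥ then 1 else 0) - ∑ y with y < x ∧ y ∈ S, mob S y := by
  rw [mob, finsum_eq_sum_of_fintype]
  congr 1
  symm
  apply Finset.sum_subtype
  simp

open scoped Classical in
theorem sum_mob [Fintype α] (S : Set α) {x : α} (hx : x ∈ S) :
    ∑ y with y ≤ x ∧ y ∈ S, mob S y = if x = ⊥ then 1 else 0 := by
  have : (univ.filter fun y => y ≤ x ∧ y ∈ S) = insert x (univ.filter fun y => y < x ∧ y ∈ S) := by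
    ext y
    simp only [mem_filter, mem_univ, true_and, mem_insert, le_iff_lt_or_eq]
    constructor
    · rintro ⟨h | h, h'⟩
      · exact Or.inr ⟨h, h'⟩
      · exact Or.inl h
    · rintro (rfl | h)
      · exact ⟨Or.inr rfl, hx⟩
      · exact ⟨Or.inl h.1, h.2⟩
  rw [this, Finset.sum_insert (by simp), mob_eq]
  ring

open scoped Classical in
-- The summation identities are triangular, so they determine the values on `S`. Closed formulas for
-- `mob` are verified through this criterion.
theorem mob_unique [Fintype α] (S : Set α) (g : α → ℤ)
    (hg : ∀ x ∈ S, ∑ y with y ≤ x ∧ y ∈ S, g y = if x = ⊥ then 1 else 0) {x : α} (hx : x ∈ S) :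
    mob S x = g x := by
  induction x using WellFoundedLT.induction with
  | _ x ih =>
  have h1 := (sum_mob S hx).trans (hg x hx).symm
  have h2 : (univ.filter fun y => y ≤ x ∧ y ∈ S) =
      insert x (univ.filter fun y => y < x ∧ y ∈ S) := by
    ext y
    simp only [mem_filter, mem_univ, true_and, mem_insert, le_iff_lt_or_eq]
    constructor
    · rintro ⟨h | h, h'⟩
      · exact Or.inr ⟨h, h'⟩
      · exact Or.inl h
    · rintro (rfl | h)
      · exact ⟨Or.inr rfl, hx⟩
      · exact ⟨Or.inl h.1, h.2⟩
  rw [h2, Finset.sum_insert (by simp), Finset.sum_insert (by simp)] at h1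
  rw [Finset.sum_congr rfl fun y hy => ih y (mem_filter.1 hy).2.1 (mem_filter.1 hy).2.2] at h1
  linarith

/-- The recursion consults `S` only strictly below `x`, and `x` itself may lie outside `S`. This
permits replacing an automorphism by another one with the same restriction. -/
theorem mob_congr [Finite α] {S S' : Set α} {x : α} (h : ∀ y < x, (y ∈ S ↔ y ∈ S')) :
    mob S x = mob S' x := by
  classical
  have := Fintype.ofFinite α
  induction x using WellFoundedLT.induction with
  | _ x ih =>
  rw [mob_eq, mob_eq]
  congr 1
  refine Finset.sum_congr ?_ fun y hy => ih y (mem_filter.1 hy).2.1 fun z hz =>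
    h z (hz.trans (mem_filter.1 hy).2.1)
  ext y
  simp only [mem_filter, mem_univ, true_and]
  constructor
  · exact fun hy => ⟨hy.1, (h y hy.1).1 hy.2⟩
  · exact fun hy => ⟨hy.1, (h y hy.1).2 hy.2⟩

@[simp]
theorem mob_bot [Finite α] (S : Set α) : mob S ⊥ = 1 := by
  have := Fintype.ofFinite α
  rw [mob_eq]
  simp

theorem mob_of_minimal [Finite α] {S : Set α} (h0 : ⊥ ∈ S) {x : α} (hx : x ≠ ⊥)
    (h : ∀ y ∈ S, y < x → y = ⊥) : mob S x = -1 := by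
  classical
  have := Fintype.ofFinite α
  rw [mob_eq, if_neg hx]
  have : (univ.filter fun y => y < x ∧ y ∈ S) = {⊥} := by
    ext y
    simp only [mem_filter, mem_univ, true_and, mem_singleton]
    constructor
    · exact fun hy => h y hy.2 hy.1
    · rintro rfl
      exact ⟨bot_lt_iff_ne_bot.2 hx, h0⟩
  rw [this]
  simp

open scoped Classical in
/-- The reduced Euler characteristic of the nonbottom part of a lower subset `T` of `S`. -/
theorem reducedEulerChar_eq_neg_sum_mob [Fintype α] {P : Type*} [PartialOrder P] [Finite P]
    (S T : Set α) (hTS : T ⊆ S) (h0 : ⊥ ∈ T) (hT : ∀ x ∈ T, ∀ y ∈ S, y ≤ x → y ∈ T)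
    (e : P ≃o {x : α // x ∈ T ∧ x ≠ ⊥}) :
    reducedEulerChar P = -∑ x with x ∈ T, mob S x := by
  have := Fintype.ofFinite P
  -- The bottom is split off because `P` represents only the nonbottom elements; it contributes `mob
  -- S ⊥ = 1`.
  have key : ∀ (Q : α → Prop) [DecidablePred Q], (∀ x, Q x → x ∈ T) → Q ⊥ →
      ∑ x with Q x, mob S x = 1 + ∑ p : P with Q (e p).1, mob S (e p).1 := by
    intro Q _ hQ hQ0
    have h1 : (univ.filter Q) = insert ⊥ (univ.filter fun x => Q x ∧ x ≠ ⊥) := by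
      ext y
      simp only [mem_filter, mem_univ, true_and, mem_insert]
      by_cases hy : y = ⊥
      · simp [hy, hQ0]
      · simp [hy]
    rw [h1, Finset.sum_insert (by simp), mob_bot]
    congr 1
    symm
    refine Finset.sum_bij (fun p _ => (e p).1) ?_ ?_ ?_ ?_
    · intro p hp
      simp only [mem_filter, mem_univ, true_and] at hp ⊢
      exact ⟨hp, (e p).2.2⟩
    · intro p _ p' _ h
      exact e.injective (Subtype.ext h)
    · intro x hx
      simp only [mem_filter, mem_univ, true_and] at hx
      refine ⟨e.symm ⟨x, hQ x hx.1, hx.2⟩, ?_, by simp⟩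
      simp [hx.1]
    · intro _ _
      rfl
  rw [reducedEulerChar_eq (fun p => mob S (e p).1), key (fun x => x ∈ T) (fun _ h => h) h0]
  · congr 3
    ext p
    simp [(e p).2.1]
  · intro p
    have hp := (e p).2
    rw [mob_eq, if_neg hp.2]
    -- As `T` is closed downwards in `S`, all elements of `S` below an element of `T` are seen by
    -- `P`, so the Möbius function of the larger set `S` obeys the recursion for `P`.
    have h2 := key (fun y => y < (e p).1 ∧ y ∈ S) (fun x hx => hT _ hp.1 x hx.2 hx.1.le)
      ⟨bot_lt_iff_ne_bot.2 hp.2, hTS h0⟩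
    rw [h2]
    have h3 : (univ.filter fun p' : P => (e p').1 < (e p).1 ∧ (e p').1 ∈ S) =
        univ.filter (fun p' => p' < p) := by
      ext p'
      simp only [mem_filter, mem_univ, true_and]
      rw [and_iff_left (hTS (e p').2.1), Subtype.coe_lt_coe, e.lt_iff_lt]
    rw [h3]
    ring

end Mob

/-! ### Multiplicativity for a lattice split by two complementary elements -/

section Split

variable {α : Type*} [Lattice α] [IsModularLattice α] [BoundedOrder α] [Fintype α]

open scoped Classical in
/-- The sum of the Möbius values over the elements of `S` below `M` with property `I`. -/
noncomputable def mobSum (S : Set α) (I : α → Prop) (M : α) : ℤ :=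
  ∑ x with x ≤ M ∧ x ∈ S ∧ I x, mob S x

open scoped Classical in
-- By the modular law `x ↦ (x ⊓ A, x ⊓ B)` and `(x, y) ↦ x ⊔ y` are inverse to each other; the
-- hypothesis that every `x` is the join of its two parts excludes diagonal elements.
theorem sum_split {S : Set α} (hinf : ∀ x ∈ S, ∀ y ∈ S, x ⊓ y ∈ S)
    (hsup : ∀ x ∈ S, ∀ y ∈ S, x ⊔ y ∈ S) {A B : α} (hA : A ∈ S) (hB : B ∈ S)
    (hAB : ∀ x, (x ⊓ A) ⊔ (x ⊓ B) = x) (hd : A ⊓ B = ⊥) (I : α → Prop)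
    (M : α) (g : α → α → ℤ) :
    ∑ x with x ≤ M ∧ x ∈ S ∧ I x, g (x ⊓ A) (x ⊓ B) =
      ∑ x with x ≤ M ⊓ A ∧ x ∈ S, ∑ y with y ≤ M ⊓ B ∧ y ∈ S ∧ I (x ⊔ y), g x y := by
  have hd' : ∀ x y, x ≤ A → y ≤ B → (x ⊔ y) ⊓ A = x ∧ (x ⊔ y) ⊓ B = y := by
    intro x y hx hy
    constructor
    · rw [sup_inf_assoc_of_le y hx]
      have : y ⊓ A = ⊥ := by
        rw [eq_bot_iff, ← hd, inf_comm A B]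
        exact inf_le_inf_right _ hy
      rw [this, sup_bot_eq]
    · rw [sup_comm, sup_inf_assoc_of_le x hy]
      have : x ⊓ B = ⊥ := by
        rw [eq_bot_iff, ← hd]
        exact inf_le_inf_right _ hx
      rw [this, sup_bot_eq]
  rw [Finset.sum_sigma']
  refine Finset.sum_bij' (fun x _ => ⟨x ⊓ A, x ⊓ B⟩) (fun p _ => p.1 ⊔ p.2) ?_ ?_ ?_ ?_ ?_
  · intro x hx
    simp only [mem_filter, mem_univ, true_and, mem_sigma] at hx ⊢
    refine ⟨⟨inf_le_inf_right _ hx.1, hinf _ hx.2.1 _ hA⟩, inf_le_inf_right _ hx.1,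
      hinf _ hx.2.1 _ hB, ?_⟩
    rw [hAB]
    exact hx.2.2
  · rintro ⟨x, y⟩ hx
    simp only [mem_filter, mem_univ, true_and, mem_sigma] at hx ⊢
    exact ⟨sup_le (hx.1.1.trans inf_le_left) (hx.2.1.trans inf_le_left),
      hsup _ hx.1.2 _ hx.2.2.1, hx.2.2.2⟩
  · intro x _
    exact hAB x
  · rintro ⟨x, y⟩ hx
    simp only [mem_filter, mem_univ, true_and, mem_sigma] at hx ⊢
    have := hd' x y (hx.1.1.trans inf_le_right) (hx.2.1.trans inf_le_right)
    rw [this.1, this.2]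
  · intro x _
    rfl

/-- Intervals from the bottom are products, and the Möbius function of a product is the product of
the Möbius functions. -/
theorem mob_split {S : Set α} (hinf : ∀ x ∈ S, ∀ y ∈ S, x ⊓ y ∈ S)
    (hsup : ∀ x ∈ S, ∀ y ∈ S, x ⊔ y ∈ S) {A B : α} (hA : A ∈ S) (hB : B ∈ S)
    (hAB : ∀ x, (x ⊓ A) ⊔ (x ⊓ B) = x) (hd : A ⊓ B = ⊥) {x : α} (hx : x ∈ S) :
    mob S x = mob S (x ⊓ A) * mob S (x ⊓ B) := by
  classical
  refine mob_unique S (fun x => mob S (x ⊓ A) * mob S (x ⊓ B)) ?_ hx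
  intro x hx
  have h := sum_split hinf hsup hA hB hAB hd (fun _ => True) x (fun a b => mob S a * mob S b)
  simp only [and_true] at h
  rw [h]
  simp_rw [← Finset.mul_sum]
  rw [← Finset.sum_mul, sum_mob S (hinf _ hx _ hA), sum_mob S (hinf _ hx _ hB)]
  have h2 : x = ⊥ ↔ x ⊓ A = ⊥ ∧ x ⊓ B = ⊥ := by
    constructor
    · rintro rfl
      simp
    · rintro ⟨h1, h2⟩
      rw [← hAB x, h1, h2, sup_bot_eq]
  by_cases h3 : x ⊓ A = ⊥ <;> by_cases h4 : x ⊓ B = ⊥ <;> simp [h2, h3, h4]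

theorem mobSum_split {S : Set α} (hinf : ∀ x ∈ S, ∀ y ∈ S, x ⊓ y ∈ S)
    (hsup : ∀ x ∈ S, ∀ y ∈ S, x ⊔ y ∈ S) {A B : α} (hA : A ∈ S) (hB : B ∈ S)
    (hAB : ∀ x, (x ⊓ A) ⊔ (x ⊓ B) = x) (hd : A ⊓ B = ⊥) (I : α → Prop)
    (hI : ∀ x y, x ≤ A → y ≤ B → (I (x ⊔ y) ↔ I x ∧ I y)) (M : α) :
    mobSum S I M = mobSum S I (M ⊓ A) * mobSum S I (M ⊓ B) := by
  classical
  unfold mobSum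
  have h1 : ∑ x with x ≤ M ∧ x ∈ S ∧ I x, mob S x =
      ∑ x with x ≤ M ∧ x ∈ S ∧ I x, mob S (x ⊓ A) * mob S (x ⊓ B) :=
    Finset.sum_congr rfl fun x hx => mob_split hinf hsup hA hB hAB hd (mem_filter.1 hx).2.2.1
  rw [h1, sum_split hinf hsup hA hB hAB hd I M (fun a b => mob S a * mob S b), Finset.sum_mul]
  simp_rw [Finset.mul_sum]
  have h2 : ∀ x, x ≤ M ⊓ A → ∀ y, (y ≤ M ⊓ B ∧ y ∈ S ∧ I (x ⊔ y)) ↔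
      (I x ∧ y ≤ M ⊓ B ∧ y ∈ S ∧ I y) := by
    intro x hx y
    constructor
    · rintro ⟨a, b, c⟩
      have := (hI x y (hx.trans inf_le_right) (a.trans inf_le_right)).1 c
      exact ⟨this.1, a, b, this.2⟩
    · rintro ⟨a, b, c, d⟩
      exact ⟨b, c, (hI x y (hx.trans inf_le_right) (b.trans inf_le_right)).2 ⟨a, d⟩⟩
  symm
  -- An `x` without property `I` has no partner `y` with `I (x ⊔ y)`, so its inner sum is empty.
  refine Finset.sum_subset_zero_on_sdiff ?_ ?_ ?_
  · intro x hx
    simp only [mem_filter, mem_univ, true_and] at hx ⊢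
    exact ⟨hx.1, hx.2.1⟩
  · intro x hx
    simp only [mem_sdiff, mem_filter, mem_univ, true_and, not_and] at hx
    refine Finset.sum_eq_zero fun y hy => ?_
    have := (h2 x hx.1.1 y).1 (mem_filter.1 hy).2
    exact absurd this.1 (hx.2 hx.1.1 hx.1.2)
  · intro x hx
    simp only [mem_filter, mem_univ, true_and] at hx
    refine Finset.sum_congr ?_ fun _ _ => rfl
    ext y
    simp only [mem_filter, mem_univ, true_and]
    rw [h2 x hx.1 y]
    simp [hx.2.2]

end Split

/-! ### Hermitian modules and extension of isometries -/

/-- An involution `σ` of an `F`-algebra `R` that is semilinear over an involution `τ` of `F` for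
which some element has trace one. -/
structure IsInvolution {F R : Type*} [Field F] [CommRing R] [Algebra F R] (τ : F →+* F)
    (σ : R →+* R) : Prop where
  base_invol : ∀ a, τ (τ a) = a
  invol : ∀ r, σ (σ r) = r
  algebraMap : ∀ a, σ (algebraMap F R a) = algebraMap F R (τ a)
  trace_one : ∃ l, l + τ l = 1

/-- An `F`-valued nondegenerate Hermitian form on an `R`-module, with adjoints given by `σ`. -/
structure IsHermitian {F R V : Type*} [Field F] [CommRing R] [Algebra F R] [AddCommGroup V]
    [Module F V] [Module R V] (τ : F →+* F) (σ : R →+* R) (h : V → V → F) : Prop where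
  add_left : ∀ x y z, h (x + y) z = h x z + h y z
  smul_left : ∀ (a : F) x y, h (a • x) y = a * h x y
  symm : ∀ x y, h y x = τ (h x y)
  adj : ∀ (r : R) x y, h (r • x) y = h x (σ r • y)
  nondeg : ∀ x, (∀ y, h x y = 0) → x = 0

section Hermitian

variable {F R V : Type*} [Field F] [CommRing R] [Algebra F R] [AddCommGroup V]
    [Module F V] [Module R V] {τ : F →+* F} {σ : R →+* R} {h : V → V → F}

namespace IsHermitian

theorem add_right (hh : IsHermitian τ σ h) (x y z : V) : h x (y + z) = h x y + h x z := by
  rw [hh.symm, hh.add_left, map_add, ← hh.symm, ← hh.symm]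

theorem zero_left (hh : IsHermitian τ σ h) (y : V) : h 0 y = 0 := by
  have := hh.add_left 0 0 y
  simpa using this

theorem zero_right (hh : IsHermitian τ σ h) (y : V) : h y 0 = 0 := by
  rw [hh.symm, hh.zero_left, map_zero]

theorem neg_left (hh : IsHermitian τ σ h) (x y : V) : h (-x) y = -h x y := by
  have := hh.add_left x (-x) y
  rw [add_neg_cancel, hh.zero_left] at this
  linear_combination -this

theorem neg_right (hh : IsHermitian τ σ h) (x y : V) : h x (-y) = -h x y := by
  rw [hh.symm, hh.neg_left, map_neg, ← hh.symm]

theorem sub_left (hh : IsHermitian τ σ h) (x y z : V) : h (x - y) z = h x z - h y z := by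
  rw [sub_eq_add_neg, hh.add_left, hh.neg_left, sub_eq_add_neg]

theorem sub_right (hh : IsHermitian τ σ h) (x y z : V) : h x (y - z) = h x y - h x z := by
  rw [sub_eq_add_neg, hh.add_right, hh.neg_right, sub_eq_add_neg]

theorem smul_right (hh : IsHermitian τ σ h) (a : F) (x y : V) : h x (a • y) = τ a * h x y := by
  rw [hh.symm, hh.smul_left, map_mul, ← hh.symm]

theorem adj' (hσ : IsInvolution τ σ) (hh : IsHermitian τ σ h) (r : R) (x y : V) :
    h x (r • y) = h (σ r • x) y := by
  rw [hh.adj, hσ.invol]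

theorem eq_zero_symm (hh : IsHermitian τ σ h) {x y : V} (hxy : h x y = 0) : h y x = 0 := by
  rw [hh.symm, hxy, map_zero]

theorem nondeg_right (hh : IsHermitian τ σ h) (x : V) (hx : ∀ y, h y x = 0) : x = 0 :=
  hh.nondeg x fun y => hh.eq_zero_symm (hx y)

/-- The orthogonal complement of a submodule. -/
def perp (hσ : IsInvolution τ σ) (hh : IsHermitian τ σ h) (U : Submodule R V) :
    Submodule R V where
  carrier := {y | ∀ u ∈ U, h u y = 0}
  add_mem' := fun {a b} ha hb u hu => by rw [hh.add_right, ha u hu, hb u hu, add_zero]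
  zero_mem' := fun u _ => hh.zero_right u
  smul_mem' := fun r y hy u hu => by
    rw [hh.adj' hσ]
    exact hy _ (U.smul_mem _ hu)

end IsHermitian

/-- A form vanishes on `U × U`. -/
def Isotropic (h : V → V → F) (U : Submodule R V) : Prop := ∀ u ∈ U, ∀ v ∈ U, h u v = 0

/-- A form restricts to a perfect pairing of two submodules. -/
def Perfect (h : V → V → F) (U D : Submodule R V) : Prop :=
  (∀ u ∈ U, (∀ d ∈ D, h u d = 0) → u = 0) ∧ ∀ d ∈ D, (∀ u ∈ U, h u d = 0) → d = 0

theorem Perfect.swap (hh : IsHermitian τ σ h) {U D : Submodule R V} (hp : Perfect h U D) :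
    Perfect h D U :=
  ⟨fun d hd h1 => hp.2 d hd fun u hu => hh.eq_zero_symm (h1 u hu),
    fun u hu h1 => hp.1 u hu fun d hd => hh.eq_zero_symm (h1 d hd)⟩

theorem perfect_top (hh : IsHermitian τ σ h) : Perfect h (⊤ : Submodule R V) ⊤ :=
  ⟨fun u _ h1 => hh.nondeg u fun d => h1 d trivial,
    fun u _ h1 => hh.nondeg_right u fun d => h1 d trivial⟩

variable [IsScalarTower F R V]

theorem natCard_dual {M : Type*} [AddCommGroup M] [Module F M] [Finite F] [Finite M] :
    Nat.card (M →ₗ[F] F) = Nat.card M := by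
  have : Finite (M →ₗ[F] F) := Finite.of_injective _ DFunLike.coe_injective
  rw [Module.natCard_eq_pow_finrank (K := F) (V := M),
    Module.natCard_eq_pow_finrank (K := F) (V := M →ₗ[F] F)]
  congr 1
  exact Subspace.dual_finrank_eq

/-- Both `U → D*` and `D → U*` are injective by perfectness, and a finite space has as many elements
as its dual, so both are bijective. Elements are counted because these maps are only semilinear over
`τ`. -/
theorem Perfect.exists_repr [Finite F] [Finite V] (hh : IsHermitian τ σ h) {U D : Submodule R V}
    (hp : Perfect h U D) (l : D →ₗ[F] F) : ∃ u ∈ U, ∀ d : D, l d = h d u := by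
  have hτ : ∀ a, τ a = 0 → a = 0 := fun a ha => (map_eq_zero τ).1 ha
  have main : ∀ A B : Submodule R V, Perfect h A B →
      ∃ f : A → (B →ₗ[F] F), Function.Injective f ∧ ∀ a b, f a b = h b a := by
    intro A B hAB
    refine ⟨fun a =>
      { toFun := fun b => h b a
        map_add' := fun x y => hh.add_left _ _ _
        map_smul' := fun c x => by
          simpa using hh.smul_left c (x : V) (a : V) }, ?_, fun _ _ => rfl⟩
    intro a a' haa
    have h1 : ∀ b ∈ B, h ((a : V) - a') b = 0 := fun b hb => by
      have := LinearMap.congr_fun haa ⟨b, hb⟩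
      simp only [LinearMap.coe_mk, AddHom.coe_mk] at this
      apply hh.eq_zero_symm
      rw [hh.sub_right, this, sub_self]
    exact Subtype.ext (sub_eq_zero.1 (hAB.1 _ (A.sub_mem a.2 a'.2) h1))
  have hfin : ∀ A : Submodule R V, Finite (A →ₗ[F] F) := fun A =>
    Finite.of_injective _ DFunLike.coe_injective
  obtain ⟨f, hf, hf'⟩ := main U D hp
  obtain ⟨g, hg, -⟩ := main D U (hp.swap hh)
  have := hfin U
  have := hfin D
  have h2 : Nat.card (D →ₗ[F] F) ≤ Nat.card U := by
    rw [natCard_dual, ← natCard_dual (F := F) (M := U)]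
    exact Nat.card_le_card_of_injective g hg
  obtain ⟨u, hu⟩ := (hf.bijective_of_nat_card_le h2).2 l
  exact ⟨u, u.2, fun d => by rw [← hu, hf']⟩

/-- A sesquilinear pairing is represented by a linear map into the first member of a perfect
pair. -/
theorem Perfect.exists_linearMap [Finite F] [Finite V] (hσ : IsInvolution τ σ)
    (hh : IsHermitian τ σ h) {U D : Submodule R V}
    (hp : Perfect h U D) (k : D → V → F) (hk1 : ∀ d d' x, k (d + d') x = k d x + k d' x)
    (hk2 : ∀ (a : F) d x, k (a • d) x = a * k d x)
    (hk3 : ∀ d x y, k d (x + y) = k d x + k d y)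
    (hk4 : ∀ (r : R) d x, k d (r • x) = k (σ r • d) x) :
    ∃ P : V →ₗ[R] U, ∀ (d : D) x, h d (P x) = k d x := by
  have h1 : ∀ x, ∃ u : U, ∀ d : D, h d u = k d x := fun x => by
    obtain ⟨u, hu, h2⟩ := hp.exists_repr hh
      { toFun := fun d => k d x, map_add' := fun d d' => hk1 d d' x
        map_smul' := fun a d => hk2 a d x }
    exact ⟨⟨u, hu⟩, fun d => (h2 d).symm⟩
  choose P hP using h1
  -- The representing vector is unique, which forces the map `P` to be linear.
  have huniq : ∀ u u' : U, (∀ d : D, h d u = h d u') → u = u' := by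
    intro u u' h2
    refine Subtype.ext (sub_eq_zero.1 (hp.1 _ (U.sub_mem u.2 u'.2) fun d hd => ?_))
    apply hh.eq_zero_symm
    rw [hh.sub_right, h2 ⟨d, hd⟩, sub_self]
  refine ⟨{ toFun := P, map_add' := fun x y => ?_, map_smul' := fun r x => ?_ }, fun d x => hP x d⟩
  · refine huniq _ _ fun d => ?_
    rw [hP, hk3, Submodule.coe_add, hh.add_right, hP, hP]
  · refine huniq _ _ fun d => ?_
    rw [hP, hk4, RingHom.id_apply, Submodule.coe_smul, hh.adj' hσ, ← hP x (σ r • d)]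
    rfl

/-- A linear equivalence between the first members of two hyperbolic pairs with the same span
extends to an isometry. -/
theorem exists_isometry_of_perfect [Finite F] [Finite V] (hσ : IsInvolution τ σ)
    (hh : IsHermitian τ σ h) {U D U' D' : Submodule R V}
    (hp : Perfect h U D) (hp' : Perfect h U' D') (hU : Isotropic h U) (hD : Isotropic h D)
    (hU' : Isotropic h U') (hD' : Isotropic h D') (hU'le : U' ≤ U ⊔ D) (hD'le : D' ≤ U ⊔ D)
    (g : U ≃ₗ[R] U') :
    ∃ X : V ≃ₗ[R] V, (∀ x y, h (X x) (X y) = h x y) ∧ ∀ u : U, X u = g u := by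
  -- The maps `a` and `b` are the projections of `V` to `U` and `D` along the orthogonal
  -- decomposition of `V` into `U ⊔ D` and its complement.
  obtain ⟨a, ha⟩ := hp.exists_linearMap hσ hh (fun d x => h d x)
    (fun d d' x => hh.add_left _ _ _) (fun c d x => hh.smul_left _ _ _)
    (fun d x y => hh.add_right _ _ _) (fun r d x => hh.adj' hσ _ _ _)
  obtain ⟨b, hb⟩ := (hp.swap hh).exists_linearMap hσ hh (fun d x => h d x)
    (fun d d' x => hh.add_left _ _ _) (fun c d x => hh.smul_left _ _ _)
    (fun d x y => hh.add_right _ _ _) (fun r d x => hh.adj' hσ _ _ _)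
  -- On `D` the map `G` is the contragredient of `g`, with values in `D'`; it vanishes on `U`
  -- because `U` is isotropic.
  obtain ⟨G, hG⟩ := (hp'.swap hh).exists_linearMap hσ hh (fun d x => h (g.symm d) x)
    (fun d d' x => by rw [map_add]; exact hh.add_left _ _ _)
    (fun c d x => by
      have : g.symm (c • d) = c • g.symm d := by
        rw [← algebraMap_smul R c d, map_smul, algebraMap_smul]
      rw [this]
      exact hh.smul_left _ _ _)
    (fun d x y => hh.add_right _ _ _) (fun r d x => by rw [map_smul]; exact hh.adj' hσ _ _ _)
  -- The component of a vector orthogonal to `U ⊔ D`. The isometry will fix it, which is compatible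
  -- with the form because `U'` and `D'` lie in `U ⊔ D` as well.
  set w : V →ₗ[R] V := LinearMap.id - U.subtype ∘ₗ a - D.subtype ∘ₗ b with hw
  have hwx : ∀ x, w x = x - a x - b x := fun x => rfl
  have hwperp : ∀ x, ∀ y ∈ U ⊔ D, h y (w x) = 0 := by
    intro x y hy
    obtain ⟨u, hu, d, hd, rfl⟩ := Submodule.mem_sup.1 hy
    rw [hwx, hh.add_left, hh.sub_right, hh.sub_right, hh.sub_right, hh.sub_right,
      hU u hu _ (a x).2, hb ⟨u, hu⟩, ha ⟨d, hd⟩, hD d hd _ (b x).2]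
    simp
  set X : V →ₗ[R] V := w + U'.subtype ∘ₗ g.toLinearMap ∘ₗ a + D'.subtype ∘ₗ G with hX
  have hXx : ∀ x, X x = w x + g (a x) + G x := fun x => rfl
  have hiso : ∀ x y, h (X x) (X y) = h x y := by
    intro x y
    have e1 : h x y = h (w x + a x + b x) (w y + a y + b y) := by
      rw [hwx, hwx]
      congr 1 <;> abel
    have z1 : h (w x) (g (a y)) = 0 := hh.eq_zero_symm (hwperp x _ (hU'le (g (a y)).2))
    have z2 : h (w x) (G y) = 0 := hh.eq_zero_symm (hwperp x _ (hD'le (G y).2))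
    have z3 : h (g (a x)) (w y) = 0 := hwperp y _ (hU'le (g (a x)).2)
    have z4 : h (G x) (w y) = 0 := hwperp y _ (hD'le (G x).2)
    have z5 : h (g (a x)) (g (a y)) = 0 := hU' _ (g (a x)).2 _ (g (a y)).2
    have z6 : h (G x) (G y) = 0 := hD' _ (G x).2 _ (G y).2
    have y1 : h (w x) (a y) = 0 :=
      hh.eq_zero_symm (hwperp x _ (Submodule.mem_sup_left (a y).2))
    have y2 : h (w x) (b y) = 0 :=
      hh.eq_zero_symm (hwperp x _ (Submodule.mem_sup_right (b y).2))
    have y3 : h (a x) (w y) = 0 := hwperp y _ (Submodule.mem_sup_left (a x).2)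
    have y4 : h (b x) (w y) = 0 := hwperp y _ (Submodule.mem_sup_right (b x).2)
    have y5 : h (a x) (a y) = 0 := hU _ (a x).2 _ (a y).2
    have y6 : h (b x) (b y) = 0 := hD _ (b x).2 _ (b y).2
    have t : ∀ x y, h (g (a x)) (G y) = h (a x) (b y) := by
      intro x y
      rw [hG (g (a x)) y, LinearEquiv.symm_apply_apply, hb]
    have t1 := t x y
    have t2 : h (G x) (g (a y)) = h (b x) (a y) := by
      rw [hh.symm, t y x, ← hh.symm]
    rw [e1, hXx, hXx]
    simp only [hh.add_left, hh.add_right, z1, z2, z3, z4, z5, z6, y1, y2, y3, y4, y5, y6, t1, t2]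
  have hinj : Function.Injective X := by
    rw [← LinearMap.ker_eq_bot, LinearMap.ker_eq_bot']
    intro x hx
    refine hh.nondeg x fun y => ?_
    rw [← hiso, hx, hh.zero_left]
  refine ⟨LinearEquiv.ofBijective X ⟨hinj, Finite.surjective_of_injective hinj⟩, hiso, ?_⟩
  intro u
  have e1 : a u = u := by
    refine Subtype.ext (sub_eq_zero.1 (hp.1 _ (U.sub_mem (a u).2 u.2) fun d hd => ?_))
    apply hh.eq_zero_symm
    rw [hh.sub_right, ha ⟨d, hd⟩, sub_self]
  have e2 : b u = 0 := by
    refine Subtype.ext (hp.2 _ (b u).2 fun v hv => ?_)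
    rw [hb ⟨v, hv⟩]
    exact hU v hv u u.2
  have e3 : G u = 0 := by
    refine Subtype.ext (hp'.2 _ (G u).2 fun v hv => ?_)
    rw [hG ⟨v, hv⟩]
    exact hU _ (g.symm ⟨v, hv⟩).2 u u.2
  change X u = _
  rw [hXx, hwx, e1, e2, e3]
  simp

/-- The automorphisms of an isotropic submodule extend to isometries. -/
theorem Isotropic.exists_isometry [Finite F] [Finite V] [IsSemisimpleRing R]
    (hσ : IsInvolution τ σ) (hh : IsHermitian τ σ h) {U : Submodule R V} (hU : Isotropic h U)
    (g : U ≃ₗ[R] U) :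
    ∃ X : V ≃ₗ[R] V, (∀ x y, h (X x) (X y) = h x y) ∧ ∀ u : U, X u = g u := by
  -- A complement of the orthogonal space of `U` pairs perfectly with `U`, but need not be
  -- isotropic. It is replaced below by the graph of a correction `D → U`.
  obtain ⟨D, hD⟩ := exists_isCompl (hh.perp hσ U)
  have hp : Perfect h U D := by
    constructor
    · intro u hu h1
      refine hh.nondeg u fun y => ?_
      have hy : y ∈ hh.perp hσ U ⊔ D := by
        rw [hD.sup_eq_top]
        trivial
      obtain ⟨s, hs, d, hd, rfl⟩ := Submodule.mem_sup.1 hy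
      rw [hh.add_right, hs u hu, h1 d hd, add_zero]
    · intro d hd h1
      have : d ∈ hh.perp hσ U ⊓ D := ⟨h1, hd⟩
      rwa [hD.inf_eq_bot, Submodule.mem_bot] at this
  obtain ⟨l, hl⟩ := hσ.trace_one
  -- For `j = 1 + f` the two cross terms contribute `-(τ l) h(d, d')` and `-l h(d, d')`, and `l + τ
  -- l = 1` makes `j(D)` isotropic. Using `l` in place of `1/2` covers characteristic two.
  obtain ⟨f, hf⟩ := hp.exists_linearMap hσ hh (fun d x => -(τ l) * h d x)
    (fun d d' x => by rw [Submodule.coe_add, hh.add_left]; ring)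
    (fun c d x => by
      have : ((c • d : D) : V) = c • (d : V) := rfl
      rw [this, hh.smul_left]; ring)
    (fun d x y => by rw [hh.add_right]; ring)
    (fun r d x => by rw [hh.adj' hσ]; rfl)
  set j : V →ₗ[R] V := LinearMap.id + U.subtype ∘ₗ f with hj
  have hjx : ∀ x, j x = x + f x := fun x => rfl
  set D' : Submodule R V := D.map j
  have hp' : Perfect h U D' := by
    constructor
    · intro u hu h1
      refine hp.1 u hu fun d hd => ?_
      have := h1 (j d) (Submodule.mem_map_of_mem hd)
      rwa [hjx, hh.add_right, hU u hu _ (f d).2, add_zero] at this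
    · rintro _ ⟨d, hd, rfl⟩ h1
      have : d = 0 := hp.2 d hd fun u hu => by
        have := h1 u hu
        rwa [hjx, hh.add_right, hU u hu _ (f d).2, add_zero] at this
      rw [this, map_zero]
  have hD' : Isotropic h D' := by
    rintro _ ⟨d, hd, rfl⟩ _ ⟨d', hd', rfl⟩
    rw [hjx, hjx, hh.add_left, hh.add_right, hh.add_right, hU _ (f d).2 _ (f d').2,
      hf ⟨d, hd⟩ d', hh.symm d' (f d), hf ⟨d', hd'⟩ d, map_mul, map_neg, hσ.base_invol, ← hh.symm]
    linear_combination (-h d d') * hl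
  exact exists_isometry_of_perfect hσ hh hp' hp' hU hD' hU hD' le_sup_left le_sup_right g

/-- The group of `R`-linear isometries. -/
def isomGroup (R : Type*) {V F : Type*} [CommRing R] [AddCommGroup V] [Module R V]
    (h : V → V → F) : Subgroup (V ≃ₗ[R] V) where
  carrier := {X | ∀ x y, h (X x) (X y) = h x y}
  mul_mem' {a b} ha hb x y := by
    rw [LinearEquiv.mul_apply, LinearEquiv.mul_apply, ha, hb]
  one_mem' _ _ := rfl
  inv_mem' {a} ha x y := by
    have h := ha (a⁻¹ x) (a⁻¹ y)
    rw [← LinearEquiv.mul_apply, ← LinearEquiv.mul_apply, mul_inv_cancel] at h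
    exact h.symm

end Hermitian

/-! ### Automorphisms of semisimple modules -/

section Modules

variable {R V V' : Type*} [CommRing R] [AddCommGroup V] [Module R V] [AddCommGroup V'] [Module R V']

/-- Cyclic modules whose generators have the same annihilator are isomorphic. -/
theorem nonempty_linearEquiv_of_cyclic {v : V} {v' : V'} (hv : ∀ x, ∃ r : R, r • v = x)
    (hv' : ∀ x, ∃ r : R, r • v' = x) (hann : ∀ r : R, r • v = 0 ↔ r • v' = 0) :
    Nonempty (V ≃ₗ[R] V') := by
  have h1 : Function.Surjective (LinearMap.toSpanSingleton R V v) := hv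
  have h2 : Function.Surjective (LinearMap.toSpanSingleton R V' v') := hv'
  have h3 : LinearMap.ker (LinearMap.toSpanSingleton R V v) =
      LinearMap.ker (LinearMap.toSpanSingleton R V' v') := by
    ext r
    exact hann r
  exact ⟨(LinearMap.quotKerEquivOfSurjective _ h1).symm ≪≫ₗ Submodule.quotEquivOfEq _ _ h3 ≪≫ₗ
    LinearMap.quotKerEquivOfSurjective _ h2⟩

/-- An injective endomorphism that maps a submodule of a finite module to itself restricts to an
automorphism of the submodule. -/
theorem exists_restrict [Finite V] (G : V →ₗ[R] V) (hG : Function.Injective G)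
    (U : Submodule R V) (hU : ∀ x ∈ U, G x ∈ U) : ∃ g : U ≃ₗ[R] U, ∀ x : U, (g x : V) = G x := by
  have hinj : Function.Injective (G.restrict hU) := fun x y hxy => by
    apply Subtype.ext
    apply hG
    simpa using congrArg Subtype.val hxy
  exact ⟨LinearEquiv.ofBijective (G.restrict hU)
    ⟨hinj, Finite.surjective_of_injective hinj⟩, fun x => rfl⟩

/-- A projection onto a direct summand. -/
theorem exists_proj {L C : Submodule R V} (h : IsCompl L C) :
    ∃ a : V →ₗ[R] L, (∀ x : L, a x = x) ∧ (∀ x ∈ C, a x = 0) := by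
  refine ⟨L.projectionOnto C h, fun x => by simp, fun x hx => ?_⟩
  exact (Submodule.projectionOnto_apply_eq_zero_iff h).2 hx

theorem exists_extend_aut [Finite V] [IsSemisimpleModule R V] {U' U : Submodule R V} (hle : U' ≤ U)
    (g' : U' ≃ₗ[R] U') : ∃ g : U ≃ₗ[R] U, ∀ (x : V) (hx : x ∈ U'), (g ⟨x, hle hx⟩ : V) =
      g' ⟨x, hx⟩ := by
  obtain ⟨C, hC⟩ := exists_isCompl U'
  obtain ⟨a, ha, -⟩ := exists_proj hC
  -- The automorphism `g'` on `U'` and the identity on a complement. The difference from the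
  -- identity has values in `U'`, so every `U` containing `U'` is preserved.
  set G : V →ₗ[R] V := LinearMap.id - U'.subtype ∘ₗ a + U'.subtype ∘ₗ g'.toLinearMap ∘ₗ a
  have hGx : ∀ x, G x = x - a x + g' (a x) := fun x => rfl
  have hinj : Function.Injective G := by
    rw [← LinearMap.ker_eq_bot, LinearMap.ker_eq_bot']
    intro x hx
    have h1 : a (G x) = g' (a x) := by
      rw [hGx, map_add, map_sub, ha, ha, sub_self, zero_add]
    rw [hx, map_zero] at h1
    have h2 : a x = 0 := by
      rw [← g'.map_eq_zero_iff, ← h1]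
    rw [hGx, h2] at hx
    simpa using hx
  obtain ⟨g, hg⟩ := exists_restrict G hinj U fun x hx => by
    rw [hGx]
    exact U.add_mem (U.sub_mem hx (hle (a x).2)) (hle (g' (a x)).2)
  refine ⟨g, fun x hx => ?_⟩
  rw [hg, hGx]
  have := ha ⟨x, hx⟩
  simp only at this
  rw [this]
  simp

/-- Isomorphic simple submodules are exchanged by an automorphism. -/
theorem exists_swap [Finite V] [IsSemisimpleModule R V] {L L' U : Submodule R V} (hL : L ≤ U)
    (hL' : L' ≤ U) (hs : IsSimpleModule R L) (hs' : IsSimpleModule R L') (φ : L ≃ₗ[R] L') :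
    ∃ g : U ≃ₗ[R] U, ∀ x : U, (x : V) ∈ L → (g x : V) ∈ L' := by
  by_cases hLL : L = L'
  · subst hLL
    exact ⟨LinearEquiv.refl R U, fun x hx => hx⟩
  have hd : Disjoint L L' := by
    have h1 : IsAtom L := isSimpleModule_iff_isAtom.1 hs
    have h2 : IsAtom L' := isSimpleModule_iff_isAtom.1 hs'
    exact h1.disjoint_of_ne h2 hLL
  obtain ⟨E, hE⟩ := exists_isCompl (L ⊔ L')
  have hc1 : IsCompl L (L' ⊔ E) := hd.isCompl_sup_right_of_isCompl_sup_left hE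
  have hc2 : IsCompl L' (L ⊔ E) :=
    hd.symm.isCompl_sup_right_of_isCompl_sup_left (by rwa [sup_comm])
  obtain ⟨a, ha, ha'⟩ := exists_proj hc1
  obtain ⟨b, hb, hb'⟩ := exists_proj hc2
  -- With `V = L ⊕ L' ⊕ E`, this exchanges `L` and `L'` through `φ` and is the identity on `E`.
  set G : V →ₗ[R] V := LinearMap.id - L.subtype ∘ₗ a - L'.subtype ∘ₗ b +
    L'.subtype ∘ₗ φ.toLinearMap ∘ₗ a + L.subtype ∘ₗ φ.symm.toLinearMap ∘ₗ b
  have hGx : ∀ x, G x = x - a x - b x + φ (a x) + φ.symm (b x) := fun x => rfl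
  have hab : ∀ x : L', a x = 0 := fun x => ha' x (Submodule.mem_sup_left x.2)
  have hba : ∀ x : L, b x = 0 := fun x => hb' x (Submodule.mem_sup_left x.2)
  have hinj : Function.Injective G := by
    rw [← LinearMap.ker_eq_bot, LinearMap.ker_eq_bot']
    intro x hx
    have h1 : a (G x) = φ.symm (b x) := by
      rw [hGx]
      simp only [map_add, map_sub, ha, hab]
      simp
    have h2 : b (G x) = φ (a x) := by
      rw [hGx]
      simp only [map_add, map_sub, hb, hba]
      simp
    rw [hx, map_zero] at h1 h2
    have h3 : b x = 0 := by
      rw [← φ.symm.map_eq_zero_iff, ← h1]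
    have h4 : a x = 0 := by
      rw [← φ.map_eq_zero_iff, ← h2]
    rw [hGx, h3, h4] at hx
    simpa using hx
  obtain ⟨g, hg⟩ := exists_restrict G hinj U fun x hx => by
    rw [hGx]
    exact U.add_mem (U.add_mem (U.sub_mem (U.sub_mem hx (hL (a x).2)) (hL' (b x).2))
      (hL' (φ (a x)).2)) (hL (φ.symm (b x)).2)
  refine ⟨g, fun x hx => ?_⟩
  have h1 : a x = ⟨x, hx⟩ := ha ⟨x, hx⟩
  have h2 : b x = 0 := hba ⟨x, hx⟩
  rw [hg, hGx, h1, h2]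
  simp

end Modules

/-! ### Uniqueness of Hermitian forms on cyclic modules -/

section Unique

variable {F R V V' : Type*} [Field F] [CommRing R] [Algebra F R] [AddCommGroup V]
    [Module F V] [Module R V] [IsScalarTower F R V] [AddCommGroup V']
    [Module F V'] [Module R V'] [IsScalarTower F R V'] {τ : F →+* F} {σ : R →+* R} {h : V → V → F}
    {h' : V' → V' → F}

/-- Hermitian forms on cyclic modules are unique up to isometry if all symmetric elements of `R`
are norms. -/
theorem exists_isometry_of_cyclic [Finite F] [Finite V] (hσ : IsInvolution τ σ)
    (hN : ∀ u, σ u = u → ∃ v, v * σ v = u)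
    (hh : IsHermitian τ σ h) (hh' : IsHermitian τ σ h') {v : V} {v' : V'}
    (hv : ∀ x, ∃ r : R, r • v = x) (hv' : ∀ x, ∃ r : R, r • v' = x)
    (hann : ∀ r : R, r • v = 0 ↔ r • v' = 0) :
    ∃ φ : V ≃ₗ[R] V', ∀ x y, h' (φ x) (φ y) = h x y := by
  obtain ⟨f⟩ := nonempty_linearEquiv_of_cyclic hv hv' hann
  have hfF : ∀ (a : F) x, f (a • x) = a • f x := fun a x => by
    rw [← algebraMap_smul R a x, map_smul, algebraMap_smul]
  -- The pullback of `h'` along `f` is `h(x, P y)` for an `R`-linear `P`, and an endomorphism of a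
  -- cyclic module over a commutative ring is multiplication by a ring element `ρ`.
  obtain ⟨P, hP⟩ := (perfect_top hh (R := R)).exists_linearMap hσ hh (fun d x => h' (f d) (f x))
    (fun d d' x => by rw [Submodule.coe_add, map_add, hh'.add_left])
    (fun c d x => by
      have : ((c • d : (⊤ : Submodule R V)) : V) = c • (d : V) := rfl
      rw [this, hfF, hh'.smul_left])
    (fun d x y => by rw [map_add, hh'.add_right])
    (fun r d x => by rw [map_smul, hh'.adj' hσ, ← map_smul]; rfl)
  obtain ⟨ρ, hρ⟩ := hv (P v)
  have hPρ : ∀ x, (P x : V) = ρ • x := by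
    intro x
    obtain ⟨r, rfl⟩ := hv x
    rw [map_smul, Submodule.coe_smul, ← hρ, smul_comm]
  have e1 : ∀ x y, h x (ρ • y) = h' (f x) (f y) := fun x y => by
    rw [← hPρ]
    exact hP ⟨x, trivial⟩ y
  have e2 : ∀ x y, h (ρ • x) y = h' (f x) (f y) := fun x y => by
    rw [hh.symm, e1, ← hh'.symm]
  obtain ⟨l, hl⟩ := hσ.trace_one
  -- The element `ρ` acts as a self-adjoint operator but need not itself be symmetric. Averaging it
  -- with `σ ρ` by means of a trace-one element gives a symmetric element with the same action.
  set u : R := algebraMap F R l * ρ + algebraMap F R (τ l) * σ ρ with hu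
  have hσu : σ u = u := by
    rw [hu, map_add, map_mul, map_mul, hσ.algebraMap, hσ.algebraMap, hσ.invol, hσ.base_invol]
    ring
  have e3 : ∀ x y, h (u • x) y = h' (f x) (f y) := fun x y => by
    rw [hu, add_smul, mul_smul, mul_smul, algebraMap_smul, algebraMap_smul, hh.add_left,
      hh.smul_left, hh.smul_left, ← hh.adj' hσ, e1, e2]
    linear_combination (h' (f x) (f y)) * hl
  obtain ⟨w, hw⟩ := hN u hσu
  have e4 : ∀ x y, h (w • x) (w • y) = h' (f x) (f y) := fun x y => by
    rw [hh.adj' hσ, ← mul_smul, mul_comm, hw, e3]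
  have hinj : Function.Injective (LinearMap.lsmul R V w) := by
    rw [← LinearMap.ker_eq_bot, LinearMap.ker_eq_bot']
    intro x hx
    rw [LinearMap.lsmul_apply] at hx
    rw [← f.map_eq_zero_iff]
    refine hh'.nondeg _ fun y => ?_
    rw [← f.apply_symm_apply y, ← e4, hx, hh.zero_left]
  set m : V ≃ₗ[R] V := LinearEquiv.ofBijective (LinearMap.lsmul R V w)
    ⟨hinj, Finite.surjective_of_injective hinj⟩
  have hm : ∀ x, m x = w • x := fun x => rfl
  -- As `w * σ w = u`, multiplication by `w` carries the pullback of `h'` to `h`; undoing it before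
  -- applying `f` gives an isometry.
  refine ⟨m.symm ≪≫ₗ f, fun x y => ?_⟩
  rw [LinearEquiv.trans_apply, LinearEquiv.trans_apply, ← e4, ← hm, ← hm,
    LinearEquiv.apply_symm_apply, LinearEquiv.apply_symm_apply]

end Unique

/-! ### Möbius functions averaged over stabilizers -/

section Stabilizers

variable {R V : Type*} [CommRing R] [AddCommGroup V] [Module R V]

/-- The submodules that are mapped onto themselves by an automorphism. -/
def invSet (X : V ≃ₗ[R] V) : Set (Submodule R V) := {U | U.map (X : V →ₗ[R] V) = U}

theorem mem_invSet {X : V ≃ₗ[R] V} {U : Submodule R V} :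
    U ∈ invSet X ↔ U.map (X : V →ₗ[R] V) = U := Iff.rfl

theorem map_eq_of_le [Finite V] {X : V ≃ₗ[R] V} {U U' : Submodule R V}
    (hcard : Nat.card U' ≤ Nat.card U) (h : ∀ x ∈ U, X x ∈ U') :
    U.map (X : V →ₗ[R] V) = U' := by
  refine SetLike.coe_injective (Set.eq_of_subset_of_ncard_le ?_ ?_ (Set.toFinite _))
  · rintro _ ⟨x, hx, rfl⟩
    exact h x hx
  · change Nat.card U' ≤ Nat.card (U.map (X : V →ₗ[R] V))
    rwa [← Nat.card_congr (X.submoduleMap U).toEquiv]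

theorem mem_invSet_of_le [Finite V] {X : V ≃ₗ[R] V} {U : Submodule R V}
    (h : ∀ x ∈ U, X x ∈ U) : U ∈ invSet X :=
  map_eq_of_le le_rfl h

theorem apply_mem_of_mem_invSet {X : V ≃ₗ[R] V} {U : Submodule R V} (h : U ∈ invSet X) {x : V}
    (hx : x ∈ U) : X x ∈ U := by
  rw [← mem_invSet.1 h]
  exact Submodule.mem_map_of_mem hx

theorem bot_mem_invSet (X : V ≃ₗ[R] V) : ⊥ ∈ invSet X := Submodule.map_bot _

theorem inf_mem_invSet [Finite V] {X : V ≃ₗ[R] V} {U U' : Submodule R V} (h : U ∈ invSet X)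
    (h' : U' ∈ invSet X) : U ⊓ U' ∈ invSet X :=
  mem_invSet_of_le fun _ hx => ⟨apply_mem_of_mem_invSet h hx.1, apply_mem_of_mem_invSet h' hx.2⟩

theorem sup_mem_invSet {X : V ≃ₗ[R] V} {U U' : Submodule R V} (h : U ∈ invSet X)
    (h' : U' ∈ invSet X) : U ⊔ U' ∈ invSet X := by
  rw [mem_invSet, Submodule.map_sup, mem_invSet.1 h, mem_invSet.1 h']

theorem mem_invSet_congr [Finite V] {X Y : V ≃ₗ[R] V} {U : Submodule R V}
    (h : ∀ x ∈ U, X x = Y x) : U ∈ invSet X ↔ U ∈ invSet Y := by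
  constructor
  · intro h1
    exact mem_invSet_of_le fun x hx => h x hx ▸ apply_mem_of_mem_invSet h1 hx
  · intro h1
    exact mem_invSet_of_le fun x hx => (h x hx).symm ▸ apply_mem_of_mem_invSet h1 hx

theorem mob_invSet_congr [Finite V] {X Y : V ≃ₗ[R] V} {U : Submodule R V}
    (h : ∀ x ∈ U, X x = Y x) : mob (invSet X) U = mob (invSet Y) U :=
  mob_congr fun _ hy => mem_invSet_congr fun x hx => h x (hy.le hx)

theorem mob_of_simple [Finite V] (X : V ≃ₗ[R] V) {L : Submodule R V} (hL : IsSimpleModule R L) :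
    mob (invSet X) L = -1 := by
  have h1 : IsAtom L := isSimpleModule_iff_isAtom.1 hL
  exact mob_of_minimal (bot_mem_invSet X) h1.1 fun y _ hy => h1.2 y hy

/-- The stabilizer of a submodule in a group of automorphisms. -/
def stab (H : Subgroup (V ≃ₗ[R] V)) (U : Submodule R V) : Subgroup (V ≃ₗ[R] V) where
  carrier := {X | X ∈ H ∧ ∀ x, X x ∈ U ↔ x ∈ U}
  mul_mem' := fun {a b} ha hb => ⟨H.mul_mem ha.1 hb.1, fun x => by
    rw [LinearEquiv.mul_apply, ha.2, hb.2]⟩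
  one_mem' := ⟨H.one_mem, fun _ => Iff.rfl⟩
  inv_mem' := fun {a} ha => ⟨H.inv_mem ha.1, fun x => by
    rw [← ha.2, ← LinearEquiv.mul_apply, mul_inv_cancel]
    rfl⟩

theorem mem_stab [Finite V] {H : Subgroup (V ≃ₗ[R] V)} {U : Submodule R V} {X : V ≃ₗ[R] V} :
    X ∈ stab H U ↔ X ∈ H ∧ U ∈ invSet X := by
  constructor
  · exact fun h => ⟨h.1, mem_invSet_of_le fun x hx => (h.2 x).2 hx⟩
  · refine fun h => ⟨h.1, fun x => ⟨fun hx => ?_, fun hx => apply_mem_of_mem_invSet h.2 hx⟩⟩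
    rw [← mem_invSet.1 h.2] at hx
    obtain ⟨y, hy, hyx⟩ := hx
    rwa [← X.injective hyx]

open scoped Classical in
/-- A transitive action has as many pairs of a group element and a fixed point as elements. -/
theorem sum_card_stabilizer [Fintype (V ≃ₗ[R] V)] (H : Subgroup (V ≃ₗ[R] V))
    (𝓛 : Finset (Submodule R V))
    (hne : 𝓛.Nonempty) (hst : ∀ L ∈ 𝓛, ∀ X ∈ H, L.map (X : V →ₗ[R] V) ∈ 𝓛)
    (htr : ∀ L ∈ 𝓛, ∀ L' ∈ 𝓛, ∃ X ∈ H, L.map (X : V →ₗ[R] V) = L') :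
    ∑ L ∈ 𝓛, #{X | X ∈ H ∧ L ∈ invSet X} = #{X | X ∈ H} := by
  obtain ⟨L₀, hL₀⟩ := hne
  rw [Finset.card_eq_sum_card_fiberwise (f := fun X : V ≃ₗ[R] V => L₀.map (X : V →ₗ[R] V))
    (t := 𝓛) (fun X hX => hst L₀ hL₀ X (by simpa using hX))]
  refine Finset.sum_congr rfl fun L hL => ?_
  -- The elements taking `L₀` to `L` form a coset of the stabilizer of `L`: right multiplication by
  -- `T` takes the stabilizer to this coset.
  obtain ⟨T, hT, hTL⟩ := htr L₀ hL₀ L hL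
  refine Finset.card_bij' (fun X _ => X * T) (fun X _ => X * T⁻¹) ?_ ?_ ?_ ?_
  · intro X hX
    simp only [mem_filter, mem_univ, true_and] at hX ⊢
    refine ⟨H.mul_mem hX.1 hT, ?_⟩
    have := hX.2
    rw [mem_invSet, ← hTL, ← Submodule.map_comp] at this
    rw [← hTL]
    exact this
  · intro X hX
    simp only [mem_filter, mem_univ, true_and] at hX ⊢
    refine ⟨H.mul_mem hX.1 (H.inv_mem hT), ?_⟩
    rw [mem_invSet]
    have h2 : L.map ((T⁻¹ : V ≃ₗ[R] V) : V →ₗ[R] V) = L₀ := by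
      rw [← hTL, ← Submodule.map_comp]
      convert Submodule.map_id L₀
      ext x
      exact T.symm_apply_apply x
    have h3 : (((X * T⁻¹ : V ≃ₗ[R] V)) : V →ₗ[R] V) =
      (X : V →ₗ[R] V) ∘ₗ ((T⁻¹ : V ≃ₗ[R] V) : V →ₗ[R] V) := rfl
    rw [h3, Submodule.map_comp, h2, hX.2]
  · intro X _
    simp
  · intro X _
    simp

open scoped Classical in
/-- If all automorphisms of a submodule extend to `H`, which is transitive on its simple
submodules, the average of the Möbius function vanishes, unless the submodule is zero or
simple. -/
theorem sum_mob_stabilizer_eq_zero [Finite V] [Fintype (Submodule R V)]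
    [Fintype (V ≃ₗ[R] V)] [IsSemisimpleModule R V] (U : Submodule R V)
    (H : Subgroup (V ≃ₗ[R] V)) (hext : ∀ g : U ≃ₗ[R] U, ∃ X ∈ H, ∀ u : U, X u = g u)
    (hiso : ∀ L ≤ U, ∀ L' ≤ U, IsSimpleModule R L → IsSimpleModule R L' → Nonempty (L ≃ₗ[R] L'))
    (h0 : U ≠ ⊥) (hns : ¬ IsSimpleModule R U) :
    ∑ X with X ∈ H ∧ U ∈ invSet X, mob (invSet X) U = 0 := by
  induction U using WellFoundedLT.induction generalizing H with
  | _ U ih =>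
  -- An automorphism of `U'` extends first to `U` and then to `H`, and this extension stabilizes
  -- `U`. So the hypotheses pass to `U'` with `H` replaced by the stabilizer of `U`, as the
  -- induction requires.
  have hext' : ∀ U' ≤ U, ∀ g : U' ≃ₗ[R] U', ∃ X ∈ stab H U, ∀ u : U', X u = g u := by
    intro U' hU' g'
    obtain ⟨g, hg⟩ := exists_extend_aut hU' g'
    obtain ⟨X, hX, hXg⟩ := hext g
    refine ⟨X, mem_stab.2 ⟨hX, mem_invSet_of_le fun x hx => ?_⟩, fun u => ?_⟩
    · rw [hXg ⟨x, hx⟩]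
      exact (g ⟨x, hx⟩).2
    · rw [← hg u u.2, ← hXg ⟨u, hU' u.2⟩]
  -- For each `X` the Möbius values below `U` add up to zero. The double sum is then rearranged by
  -- submodules `U'`.
  have htot : ∑ X with X ∈ stab H U, ∑ U' with U' ≤ U ∧ U' ∈ invSet X, mob (invSet X) U' = 0 := by
    refine Finset.sum_eq_zero fun X hX => ?_
    rw [sum_mob _ (mem_stab.1 (mem_filter.1 hX).2).2, if_neg h0]
  have hswap : ∑ X with X ∈ stab H U, ∑ U' with U' ≤ U ∧ U' ∈ invSet X, mob (invSet X) U' =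
      ∑ U' with U' ≤ U, ∑ X with X ∈ stab H U ∧ U' ∈ invSet X, mob (invSet X) U' := by
    refine Finset.sum_comm' fun X U' => ?_
    simp only [mem_filter, mem_univ, true_and]
    tauto
  set 𝓛 : Finset (Submodule R V) := univ.filter fun L => L ≤ U ∧ IsSimpleModule R L with h𝓛
  have hsplit : (univ.filter fun U' : Submodule R V => U' ≤ U) =
      insert U (insert ⊥ (𝓛 ∪ univ.filter fun U' => U' < U ∧ U' ≠ ⊥ ∧ ¬ IsSimpleModule R U')) := by
    ext U'
    simp only [h𝓛, mem_filter, mem_univ, true_and, mem_insert, mem_union]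
    constructor
    · intro h1
      by_cases h2 : U' = U
      · exact Or.inl h2
      · have := lt_of_le_of_ne h1 h2
        tauto
    · rintro (rfl | rfl | h1 | h1)
      · exact le_rfl
      · exact bot_le
      · exact h1.1
      · exact h1.1.le
  have hbot : ∀ U' : Submodule R V, IsSimpleModule R U' → U' ≠ ⊥ := fun U' hU' =>
    (isSimpleModule_iff_isAtom.1 hU').1
  rw [hswap, hsplit, Finset.sum_insert, Finset.sum_insert, Finset.sum_union] at htot
  rotate_left
  · rw [Finset.disjoint_left]
    intro U' h1 h2
    exact (mem_filter.1 h2).2.2.2 (mem_filter.1 h1).2.2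
  · simp only [h𝓛, mem_union, mem_filter, mem_univ, true_and, not_or]
    exact ⟨fun h1 => hbot _ h1.2 rfl, fun h1 => h1.2.1 rfl⟩
  · simp only [h𝓛, mem_union, mem_insert, mem_filter, mem_univ, true_and, not_or]
    exact ⟨h0, fun h1 => hns h1.2, fun h1 => lt_irrefl _ h1.1⟩
  have t1 : ∑ X with X ∈ stab H U ∧ U ∈ invSet X, mob (invSet X) U =
      ∑ X with X ∈ H ∧ U ∈ invSet X, mob (invSet X) U := by
    refine Finset.sum_congr ?_ fun _ _ => rfl
    ext X
    simp only [mem_filter, mem_univ, true_and, mem_stab]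
    tauto
  have t2 : ∑ X with X ∈ stab H U ∧ ⊥ ∈ invSet X, mob (invSet X) (⊥ : Submodule R V) =
      #{X | X ∈ stab H U} := by
    rw [Finset.sum_congr rfl fun X _ => mob_bot _]
    simp [bot_mem_invSet]
  -- Each simple submodule contributes minus the order of its stabilizer; by transitivity these
  -- cancel the contribution of the zero submodule.
  have t3 : ∑ L ∈ 𝓛, ∑ X with X ∈ stab H U ∧ L ∈ invSet X, mob (invSet X) L =
      -#{X | X ∈ stab H U} := by
    rw [← sum_card_stabilizer (stab H U) 𝓛, Nat.cast_sum, ← Finset.sum_neg_distrib]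
    · refine Finset.sum_congr rfl fun L hL => ?_
      rw [Finset.sum_congr rfl fun X _ => mob_of_simple X (mem_filter.1 hL).2.2]
      simp
    · obtain ⟨L, hL, hLU⟩ := (eq_bot_or_exists_atom_le U).resolve_left h0
      exact ⟨L, mem_filter.2 ⟨mem_univ _, hLU, isSimpleModule_iff_isAtom.2 hL⟩⟩
    · intro L hL X hX
      simp only [h𝓛, mem_filter, mem_univ, true_and] at hL ⊢
      refine ⟨?_, ?_⟩
      · rw [← mem_invSet.1 (mem_stab.1 hX).2]
        exact Submodule.map_mono hL.1
      · have := hL.2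
        exact IsSimpleModule.congr (X.submoduleMap L).symm
    · intro L hL L' hL'
      simp only [h𝓛, mem_filter, mem_univ, true_and] at hL hL'
      obtain ⟨φ⟩ := hiso L hL.1 L' hL'.1 hL.2 hL'.2
      obtain ⟨g, hg⟩ := exists_swap hL.1 hL'.1 hL.2 hL'.2 φ
      obtain ⟨X, hX, hXg⟩ := hext' U le_rfl g
      refine ⟨X, hX, map_eq_of_le (Nat.card_congr φ.toEquiv).ge fun x hx => ?_⟩
      rw [hXg ⟨x, hL.1 hx⟩]
      exact hg ⟨x, hL.1 hx⟩ hx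
  -- All proper submodules that are neither zero nor simple vanish by induction, which leaves the
  -- term of `U` alone.
  have t4 : ∑ U' with U' < U ∧ U' ≠ ⊥ ∧ ¬ IsSimpleModule R U',
      ∑ X with X ∈ stab H U ∧ U' ∈ invSet X, mob (invSet X) U' = 0 := by
    refine Finset.sum_eq_zero fun U' hU' => ?_
    simp only [mem_filter, mem_univ, true_and] at hU'
    exact ih U' hU'.1 (stab H U) (hext' U' hU'.1.le)
      (fun L hL L' hL' => hiso L (hL.trans hU'.1.le) L' (hL'.trans hU'.1.le)) hU'.2.1 hU'.2.2
  rw [t1, t2, t3, t4] at htot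
  linarith

end Stabilizers

/-! ### Summands cut out by idempotents -/

section Parts

variable {R : Type*} [CommRing R]

/-- The direct summand `eV` of a module defined by an idempotent `e`. -/
def part (V : Type*) [AddCommGroup V] [Module R V] (e : R) : Submodule R V where
  carrier := {x | e • x = x}
  add_mem' := fun {a b} ha hb => by
    rw [Set.mem_ofPred_eq] at *
    rw [smul_add, ha, hb]
  zero_mem' := smul_zero e
  smul_mem' := fun r x hx => by
    rw [Set.mem_ofPred_eq] at *
    rw [smul_comm, hx]

/-- An idempotent `e` for which `eR` is a field. -/
structure IsPrimitive (e : R) : Prop where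
  idem : e * e = e
  inv : ∀ r, e * r ≠ 0 → ∃ s, e * r * s = e

variable {V : Type*} [AddCommGroup V] [Module R V]

theorem mem_part {e : R} {x : V} : x ∈ part V e ↔ e • x = x := Iff.rfl

theorem smul_mem_part {e : R} (he : e * e = e) (x : V) : e • x ∈ part V e := by
  rw [mem_part, ← mul_smul, he]

theorem part_mem_invSet [Finite V] (e : R) (X : V ≃ₗ[R] V) : part V e ∈ invSet X :=
  mem_invSet_of_le fun x hx => by
    rw [mem_part] at *
    rw [← map_smul, hx]

theorem one_sub_idem {e : R} (he : e * e = e) : (1 - e) * (1 - e) = 1 - e := by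
  linear_combination he

theorem part_inf_part_one_sub (e : R) : part V e ⊓ part V (1 - e) = ⊥ := by
  rw [eq_bot_iff]
  rintro x ⟨h1, h2⟩
  rw [SetLike.mem_coe, mem_part] at h1 h2
  rw [sub_smul, one_smul, h1, sub_self] at h2
  exact h2.symm

theorem inf_part_sup {e : R} (he : e * e = e) (U : Submodule R V) :
    (U ⊓ part V e) ⊔ (U ⊓ part V (1 - e)) = U := by
  apply le_antisymm (sup_le inf_le_left inf_le_left)
  intro x hx
  refine Submodule.mem_sup.2 ⟨e • x, ⟨U.smul_mem _ hx, smul_mem_part he x⟩, (1 - e) • x,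
    ⟨U.smul_mem _ hx, smul_mem_part (one_sub_idem he) x⟩, ?_⟩
  rw [← add_smul]
  simp

/-- Since `eR` is a field, `eV` is a vector space over it, where a nonzero vector is killed only by
scalars whose `e`-part is zero. -/
theorem IsPrimitive.smul_eq_zero_iff {e : R} (he : IsPrimitive e) {x : V} (hx : x ∈ part V e)
    (h0 : x ≠ 0) (r : R) : r • x = 0 ↔ e * r = 0 := by
  constructor
  · intro h1
    by_contra h2
    obtain ⟨s, hs⟩ := he.inv r h2
    apply h0
    rw [mem_part] at hx
    rw [← hx, ← hs, mul_comm, ← mul_assoc, mul_smul, h1, smul_zero]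
  · intro h1
    rw [← mem_part.1 hx, ← mul_smul, mul_comm, h1, zero_smul]

theorem exists_smul_eq_of_simple {L : Submodule R V} (hL : IsSimpleModule R L) {x : L}
    (hx : x ≠ 0) (y : L) : ∃ r : R, r • x = y :=
  IsSimpleModule.toSpanSingleton_surjective R hx y

theorem exists_ne_zero_of_simple {L : Submodule R V} (hL : IsSimpleModule R L) :
    ∃ x : L, x ≠ 0 := by
  have := hL.nontrivial
  exact exists_ne 0

/-- Any nonzero vector generates a simple submodule, and inside `eV` all nonzero vectors have the
same annihilator: `eV` is isotypic. -/
theorem IsPrimitive.nonempty_linearEquiv {e : R} (he : IsPrimitive e) {L L' : Submodule R V}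
    (hL : L ≤ part V e) (hL' : L' ≤ part V e) (hs : IsSimpleModule R L)
    (hs' : IsSimpleModule R L') : Nonempty (L ≃ₗ[R] L') := by
  obtain ⟨x, hx⟩ := exists_ne_zero_of_simple hs
  obtain ⟨x', hx'⟩ := exists_ne_zero_of_simple hs'
  refine nonempty_linearEquiv_of_cyclic (exists_smul_eq_of_simple hs hx)
    (exists_smul_eq_of_simple hs' hx') fun r => ?_
  have h1 := he.smul_eq_zero_iff (hL x.2) (by simpa using hx) r
  have h2 := he.smul_eq_zero_iff (hL' x'.2) (by simpa using hx') r
  rw [← Submodule.coe_eq_zero, ← Submodule.coe_eq_zero, Submodule.coe_smul, Submodule.coe_smul,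
    h1, h2]

/-- A submodule of `eV` generated by any of its nonzero elements is simple. -/
theorem isSimpleModule_part {e : R} (he : IsPrimitive e) {v : V}
    (hv : ∀ x : V, ∃ r : R, r • v = x) (h0 : e • v ≠ 0) : IsSimpleModule R (part V e) := by
  rw [isSimpleModule_iff_isAtom]
  refine ⟨fun h1 => h0 ?_, fun U hU => ?_⟩
  · have := smul_mem_part he.idem v
    rwa [h1, Submodule.mem_bot] at this
  · by_contra h1
    obtain ⟨x, hx, hx0⟩ := Submodule.exists_mem_ne_zero_of_ne_bot h1
    refine hU.not_ge fun y hy => ?_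
    obtain ⟨r, hr⟩ := hv x
    obtain ⟨t, ht⟩ := hv y
    have hxe := mem_part.1 (hU.le hx)
    have h2 : e * r ≠ 0 := fun h3 => hx0 <| by
      rw [← hxe, ← hr, ← mul_smul, h3, zero_smul]
    obtain ⟨s, hs⟩ := he.inv r h2
    have h3 : e • v = s • x := by
      rw [← hs, ← hr, mul_comm (e * r) s, mul_smul, mul_smul, smul_comm e r, hr, smul_comm r e, hr,
        hxe]
    rw [← mem_part.1 hy, ← ht, smul_comm, h3]
    exact U.smul_mem _ (U.smul_mem _ hx)

theorem part_congr_mobSum [Finite V] [Fintype (Submodule R V)] {X Y : V ≃ₗ[R] V}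
    {M : Submodule R V} (h : ∀ x ∈ M, X x = Y x) (I : Submodule R V → Prop) :
    mobSum (invSet X) I M = mobSum (invSet Y) I M := by
  classical
  unfold mobSum
  refine Finset.sum_congr ?_ fun U hU => ?_
  · ext U
    simp only [mem_filter, mem_univ, true_and]
    constructor
    · rintro ⟨h1, h2, h3⟩
      exact ⟨h1, (mem_invSet_congr fun x hx => h x (h1 hx)).1 h2, h3⟩
    · rintro ⟨h1, h2, h3⟩
      exact ⟨h1, (mem_invSet_congr fun x hx => h x (h1 hx)).2 h2, h3⟩
  · exact mob_invSet_congr fun x hx => h x ((mem_filter.1 hU).2.1 hx)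

end Parts

/-! ### Averages over isometry groups, one summand at a time -/

section Averages

variable {F R V : Type*} [Field F] [CommRing R] [Algebra F R] [AddCommGroup V]
    [Module F V] [Module R V] {τ : F →+* F} {σ : R →+* R} {h : V → V → F}

theorem IsHermitian.restrict (hh : IsHermitian τ σ h) (L : Submodule R V) [Module F L]
    (hL : ∀ (a : F) (x : L), ((a • x : L) : V) = a • (x : V))
    (hnd : ∀ x ∈ L, (∀ y ∈ L, h x y = 0) → x = 0) :
    IsHermitian τ σ (fun x y : L => h x y) where
  add_left x y z := hh.add_left _ _ _
  smul_left a x y := by rw [hL, hh.smul_left]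
  symm x y := hh.symm _ _
  adj r x y := hh.adj _ _ _
  nondeg x hx := Subtype.ext (hnd x x.2 fun y hy => hx ⟨y, hy⟩)

theorem IsHermitian.neg (hh : IsHermitian τ σ h) : IsHermitian τ σ (fun x y : V => -h x y) where
  add_left x y z := by rw [hh.add_left]; ring
  smul_left a x y := by rw [hh.smul_left]; ring
  symm x y := by rw [hh.symm, map_neg]
  adj r x y := by rw [hh.adj]
  nondeg x hx := hh.nondeg x fun y => neg_eq_zero.1 (hx y)

theorem part_orthogonal (hh : IsHermitian τ σ h) {e f : R} (hef : σ e * f = 0) {x y : V}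
    (hx : x ∈ part V e) (hy : y ∈ part V f) : h x y = 0 := by
  rw [← mem_part.1 hx, ← mem_part.1 hy, hh.adj, ← mul_smul, hef, zero_smul, hh.zero_right]

theorem isotropic_sup_iff (hh : IsHermitian τ σ h) {x y : Submodule R V}
    (hxy : ∀ a ∈ x, ∀ b ∈ y, h a b = 0) :
    Isotropic h (x ⊔ y) ↔ Isotropic h x ∧ Isotropic h y := by
  constructor
  · exact fun h1 => ⟨fun a ha b hb => h1 a (Submodule.mem_sup_left ha) b (Submodule.mem_sup_left hb),
      fun a ha b hb => h1 a (Submodule.mem_sup_right ha) b (Submodule.mem_sup_right hb)⟩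
  · rintro ⟨h1, h2⟩ u hu v hv
    obtain ⟨a, ha, b, hb, rfl⟩ := Submodule.mem_sup.1 hu
    obtain ⟨a', ha', b', hb', rfl⟩ := Submodule.mem_sup.1 hv
    rw [hh.add_left, hh.add_right, hh.add_right, h1 a ha a' ha', h2 b hb b' hb', hxy a ha b' hb',
      hh.eq_zero_symm (hxy a' ha' b hb)]
    simp

/-- The vectors of `L` orthogonal to `L'` form a submodule of `L`, different from `L`, hence zero
because `L` is simple. -/
theorem nondeg_of_simple (hσ : IsInvolution τ σ) (hh : IsHermitian τ σ h) {L : Submodule R V}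
    (hL : IsSimpleModule R L) {L' : Submodule R V} (hiso : ¬ ∀ u ∈ L, ∀ v ∈ L', h u v = 0) :
    ∀ x ∈ L, (∀ y ∈ L', h x y = 0) → x = 0 := by
  have h1 := isSimpleModule_iff_isAtom.1 hL
  have h2 : L ⊓ hh.perp hσ L' ≠ L := fun h2 => hiso fun u hu v hv => by
    rw [← h2] at hu
    exact hh.eq_zero_symm (hu.2 v hv)
  have h3 := h1.2 _ (lt_of_le_of_ne inf_le_left h2)
  intro x hx hxy
  have : x ∈ L ⊓ hh.perp hσ L' := ⟨hx, fun u hu => hh.eq_zero_symm (hxy u hu)⟩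
  rwa [h3, Submodule.mem_bot] at this

/-- The isometries that are trivial on `(1 - f)V`. -/
def isomGroupOn (h : V → V → F) (f : R) : Subgroup (V ≃ₗ[R] V) where
  carrier := {X | X ∈ isomGroup R h ∧ ∀ x ∈ part V (1 - f), X x = x}
  mul_mem' := fun {a b} ha hb => ⟨(isomGroup R h).mul_mem ha.1 hb.1, fun x hx => by
    rw [LinearEquiv.mul_apply, hb.2 x hx, ha.2 x hx]⟩
  one_mem' := ⟨(isomGroup R h).one_mem, fun _ _ => rfl⟩
  inv_mem' := fun {a} ha => ⟨(isomGroup R h).inv_mem ha.1, fun x hx => by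
    rw [← ha.2 x hx, ← LinearEquiv.mul_apply, inv_mul_cancel]
    rw [ha.2 x hx]
    rfl⟩

theorem exists_mem_isomGroupOn [Finite V] (hh : IsHermitian τ σ h) {f : R} (hf : f * f = f)
    (hσf : σ f = f) {X : V ≃ₗ[R] V} (hX : X ∈ isomGroup R h) :
    ∃ Y ∈ isomGroupOn h f, ∀ x ∈ part V f, Y x = X x := by
  -- This acts as `X` on `fV` and as the identity on `(1 - f)V`; the two summands are orthogonal
  -- because `f` is symmetric.
  set G : V →ₗ[R] V := (X : V →ₗ[R] V) ∘ₗ LinearMap.lsmul R V f + LinearMap.lsmul R V (1 - f)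
  have hG : ∀ x, G x = X (f • x) + (1 - f) • x := fun x => rfl
  have hiso : ∀ x y, h (G x) (G y) = h x y := by
    intro x y
    have z : ∀ x y, h (X (f • x)) ((1 - f) • y) = 0 := fun x y => by
      rw [map_smul, hh.adj, ← mul_smul, hσf, mul_sub, hf, mul_one, sub_self, zero_smul,
        hh.zero_right]
    have z' : ∀ x y, h (f • x) ((1 - f) • y) = 0 := fun x y => by
      rw [hh.adj, ← mul_smul, hσf, mul_sub, hf, mul_one, sub_self, zero_smul, hh.zero_right]
    have e : ∀ x : V, x = f • x + (1 - f) • x := fun x => by rw [← add_smul]; simp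
    rw [hG, hG]
    conv_rhs => rw [e x, e y]
    rw [hh.add_left, hh.add_left, hh.add_right, hh.add_right, hh.add_right, hh.add_right, z, z',
      hX, hh.eq_zero_symm (z _ _), hh.eq_zero_symm (z' _ _)]
  have hinj : Function.Injective G := by
    rw [← LinearMap.ker_eq_bot, LinearMap.ker_eq_bot']
    intro x hx
    refine hh.nondeg x fun y => ?_
    rw [← hiso, hx, hh.zero_left]
  refine ⟨LinearEquiv.ofBijective G ⟨hinj, Finite.surjective_of_injective hinj⟩,
    ⟨hiso, fun x hx => ?_⟩, fun x hx => ?_⟩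
  · change G x = x
    have h1 := mem_part.1 hx
    have h2 : f • x = 0 := by
      rw [sub_smul, one_smul] at h1
      simpa using h1
    rw [hG, h1, h2, map_zero, zero_add]
  · change G x = X x
    have h1 := mem_part.1 hx
    rw [hG, sub_smul, one_smul, h1, sub_self, add_zero]

theorem map_mem_isotropic {F R V : Type*} [Field F] [CommRing R] [AddCommGroup V] [Module R V]
    {h : V → V → F} {X : V ≃ₗ[R] V} (hX : X ∈ isomGroup R h) {L : Submodule R V}
    (hL : Isotropic h L) : Isotropic h (L.map (X : V →ₗ[R] V)) := by
  rintro _ ⟨x, hx, rfl⟩ _ ⟨y, hy, rfl⟩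
  exact (hX x y).trans (hL x hx y hy)

theorem perp_mem_invSet [Finite V] (hσ : IsInvolution τ σ) (hh : IsHermitian τ σ h) {X : V ≃ₗ[R] V}
    (hX : X ∈ isomGroup R h) {U : Submodule R V} (hU : U ∈ invSet X) :
    hh.perp hσ U ∈ invSet X :=
  mem_invSet_of_le fun x hx u hu => by
    rw [← mem_invSet.1 hU] at hu
    obtain ⟨v, hv, rfl⟩ := hu
    exact (hX v x).trans (hx v hv)

variable [Finite V] [Fintype (Submodule R V)]

/-- The summands `fV` and `(1 - f)V` are orthogonal, so a sum of submodules of the two is isotropic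
exactly when both are. -/
theorem mobSum_part_split (hh : IsHermitian τ σ h) {f : R} (hf : f * f = f)
    (hσf : σ f = f) (X : V ≃ₗ[R] V) (M : Submodule R V) :
    mobSum (invSet X) (Isotropic h) M = mobSum (invSet X) (Isotropic h) (M ⊓ part V f) *
      mobSum (invSet X) (Isotropic h) (M ⊓ part V (1 - f)) := by
  refine mobSum_split (fun x hx y hy => inf_mem_invSet hx hy) (fun x hx y hy => sup_mem_invSet hx hy)
    (part_mem_invSet f X) (part_mem_invSet (1 - f) X) (inf_part_sup hf) (part_inf_part_one_sub f)
    (Isotropic h) (fun x y hx hy => isotropic_sup_iff hh fun a ha b hb => ?_) M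
  exact part_orthogonal hh (by rw [hσf, mul_sub, hf, mul_one, sub_self]) (hx ha) (hy hb)

variable [Fintype (V ≃ₗ[R] V)]

open scoped Classical in
-- The sum for `X` is the product of a factor `a` from `fV` and a factor `b` from `(1 - f)V`.
-- Multiplying `X` by isometries trivial on `(1 - f)V` leaves `b` unchanged, while on `fV` the
-- products run through the restrictions of that whole subgroup, over which `a` sums to zero. So the
-- sum multiplied by the order of the subgroup vanishes.
theorem sum_mobSum_eq_zero_of_part (hh : IsHermitian τ σ h) {f : R} (hf : f * f = f)
    (hσf : σ f = f)
    (hsum : ∑ X with X ∈ isomGroupOn h f, mobSum (invSet X) (Isotropic h) (part V f) = 0) :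
    ∑ X with X ∈ isomGroup R h, mobSum (invSet X) (Isotropic h) ⊤ = 0 := by
  set a : (V ≃ₗ[R] V) → ℤ := fun X => mobSum (invSet X) (Isotropic h) (part V f)
  set b : (V ≃ₗ[R] V) → ℤ := fun X => mobSum (invSet X) (Isotropic h) (part V (1 - f))
  have hab : ∀ X : V ≃ₗ[R] V, mobSum (invSet X) (Isotropic h) ⊤ = a X * b X := fun X => by
    rw [mobSum_part_split hh hf hσf X ⊤, top_inf_eq, top_inf_eq]
  simp_rw [hab]
  have hinner : ∀ X ∈ isomGroup R h, ∑ Z with Z ∈ isomGroupOn h f, a (Z * X) = 0 := by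
    intro X hX
    obtain ⟨Y, hY, hYX⟩ := exists_mem_isomGroupOn hh hf hσf hX
    rw [← hsum]
    refine Finset.sum_bij' (fun Z _ => Z * Y) (fun Z _ => Z * Y⁻¹) ?_ ?_ ?_ ?_ ?_
    · intro Z hZ
      simp only [mem_filter, mem_univ, true_and] at hZ ⊢
      exact Subgroup.mul_mem _ hZ hY
    · intro Z hZ
      simp only [mem_filter, mem_univ, true_and] at hZ ⊢
      exact Subgroup.mul_mem _ hZ (Subgroup.inv_mem _ hY)
    · intro Z _
      simp
    · intro Z _
      simp
    · intro Z _
      refine part_congr_mobSum (fun x hx => ?_) _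
      rw [LinearEquiv.mul_apply, LinearEquiv.mul_apply, hYX x hx]
  have hshift : ∀ Z ∈ isomGroupOn h f, ∑ X with X ∈ isomGroup R h, a X * b X =
      ∑ X with X ∈ isomGroup R h, a (Z * X) * b X := by
    intro Z hZ
    symm
    refine Finset.sum_bij' (fun X _ => Z * X) (fun X _ => Z⁻¹ * X) ?_ ?_ ?_ ?_ ?_
    · intro X hX
      simp only [mem_filter, mem_univ, true_and] at hX ⊢
      exact Subgroup.mul_mem _ hZ.1 hX
    · intro X hX
      simp only [mem_filter, mem_univ, true_and] at hX ⊢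
      exact Subgroup.mul_mem _ (Subgroup.inv_mem _ hZ.1) hX
    · intro X _
      simp
    · intro X _
      simp
    · intro X _
      congr 1
      refine part_congr_mobSum (fun x hx => ?_) _
      rw [LinearEquiv.mul_apply]
      exact (hZ.2 _ (apply_mem_of_mem_invSet (part_mem_invSet _ _) hx)).symm
  have hmul : (#{Z | Z ∈ isomGroupOn h f} : ℤ) * ∑ X with X ∈ isomGroup R h, a X * b X = 0 := by
    rw [← nsmul_eq_mul, ← Finset.sum_const, Finset.sum_congr rfl fun Z hZ => hshift Z
      (by simpa using hZ), Finset.sum_comm]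
    refine Finset.sum_eq_zero fun X hX => ?_
    rw [← Finset.sum_mul, hinner X (by simpa using hX), zero_mul]
  exact (mul_eq_zero.1 hmul).resolve_left (Nat.cast_ne_zero.2 (Finset.card_ne_zero.2
    ⟨1, by simp⟩))

end Averages

/-! ### Components of multiplicity at least two -/

section Components

variable {F R V : Type*} [Field F] [Finite F] [CommRing R] [Algebra F R] [AddCommGroup V]
    [Module F V] [Module R V] [IsScalarTower F R V] [Finite V] {τ : F →+* F} {σ : R →+* R}
    {h : V → V → F}

/-- A component of multiplicity at least two contains an isotropic simple submodule. -/
theorem exists_isotropic_simple [IsSemisimpleRing R] (hσ : IsInvolution τ σ)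
    (hN : ∀ u, σ u = u → ∃ v, v * σ v = u) (hh : IsHermitian τ σ h) {e : R}
    (he : IsPrimitive e) (h0 : part V e ≠ ⊥) (hns : ¬ IsSimpleModule R (part V e)) :
    ∃ L ≤ part V e, IsSimpleModule R L ∧ Isotropic h L := by
  obtain ⟨L, hLa, hLe⟩ := (eq_bot_or_exists_atom_le (part V e)).resolve_left h0
  have hL := isSimpleModule_iff_isAtom.2 hLa
  by_cases hiso : Isotropic h L
  · exact ⟨L, hLe, hL, hiso⟩
  have hnd := nondeg_of_simple hσ hh hL hiso
  have hp : Perfect h L L := ⟨hnd, fun d hd h1 => hnd d hd fun u hu => hh.eq_zero_symm (h1 u hu)⟩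
  -- If nothing in the component were orthogonal to the nondegenerate `L`, orthogonal projection
  -- would show that the component is `L`, hence simple.
  have hne : part V e ⊓ hh.perp hσ L ≠ ⊥ := by
    intro h1
    refine hns (le_antisymm hLe (fun x hx => ?_) ▸ hL)
    obtain ⟨a, ha⟩ := hp.exists_linearMap hσ hh (fun d x => h d x)
      (fun d d' x => hh.add_left _ _ _) (fun c d x => hh.smul_left _ _ _)
      (fun d x y => hh.add_right _ _ _) (fun r d x => hh.adj' hσ _ _ _)
    have h2 : x - a x ∈ part V e ⊓ hh.perp hσ L := by
      refine ⟨(part V e).sub_mem hx (hLe (a x).2), fun u hu => ?_⟩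
      rw [hh.sub_right, ha ⟨u, hu⟩, sub_self]
    rw [h1, Submodule.mem_bot, sub_eq_zero] at h2
    rw [h2]
    exact (a x).2
  obtain ⟨L', hLa', hLe'⟩ := (eq_bot_or_exists_atom_le _).resolve_left hne
  have hL' := isSimpleModule_iff_isAtom.2 hLa'
  have hLp : L' ≤ part V e := hLe'.trans inf_le_left
  by_cases hiso' : Isotropic h L'
  · exact ⟨L', hLp, hL', hiso'⟩
  have hnd' := nondeg_of_simple hσ hh hL' hiso'
  obtain ⟨x, hx⟩ := exists_ne_zero_of_simple hL
  obtain ⟨x', hx'⟩ := exists_ne_zero_of_simple hL'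
  -- By uniqueness of Hermitian forms `L` is isometric to `L'` with the negated form, so that the
  -- graph `{y + φ y}` is isotropic.
  obtain ⟨φ, hφ⟩ := exists_isometry_of_cyclic hσ hN
    (hh.restrict L (fun _ _ => rfl) hnd) (hh.restrict L' (fun _ _ => rfl) hnd').neg
    (exists_smul_eq_of_simple hL hx) (exists_smul_eq_of_simple hL' hx') fun r => by
      have h1 := he.smul_eq_zero_iff (hLe x.2) (by simpa using hx) r
      have h2 := he.smul_eq_zero_iff (hLp x'.2) (by simpa using hx') r
      rw [← Submodule.coe_eq_zero, ← Submodule.coe_eq_zero, Submodule.coe_smul,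
        Submodule.coe_smul, h1, h2]
  set j : L →ₗ[R] V := L.subtype + L'.subtype ∘ₗ φ.toLinearMap
  have hj : ∀ y : L, j y = y + φ y := fun y => rfl
  have horth : ∀ y z : L, h y (φ z) = 0 := fun y z => (hLe' (φ z).2).2 y y.2
  have hinj : Function.Injective j := by
    rw [← LinearMap.ker_eq_bot, LinearMap.ker_eq_bot']
    intro y hy
    refine Subtype.ext (hnd y y.2 fun z hz => ?_)
    have h1 : h (j y) z = 0 := by rw [hy, hh.zero_left]
    rwa [hj, hh.add_left, hh.eq_zero_symm (horth ⟨z, hz⟩ y), add_zero] at h1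
  refine ⟨LinearMap.range j, ?_, IsSimpleModule.congr (LinearEquiv.ofInjective j hinj).symm, ?_⟩
  · rintro _ ⟨y, rfl⟩
    exact (part V e).add_mem (hLe y.2) (hLp (φ y).2)
  · rintro _ ⟨y, rfl⟩ _ ⟨z, rfl⟩
    have h1 := hφ y z
    rw [hj, hj, hh.add_left, hh.add_right, hh.add_right, horth, hh.eq_zero_symm (horth z y), ← h1]
    ring

/-- The isometry group is transitive on the isotropic simple submodules of a component. -/
theorem exists_isometry_map_eq [IsSemisimpleRing R] (hσ : IsInvolution τ σ)
    (hh : IsHermitian τ σ h) {e : R} (he : IsPrimitive e) {L L' : Submodule R V}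
    (hL : L ≤ part V e) (hL' : L' ≤ part V e) (hs : IsSimpleModule R L)
    (hs' : IsSimpleModule R L') (hi : Isotropic h L) (hi' : Isotropic h L') :
    ∃ X ∈ isomGroup R h, L.map (X : V →ₗ[R] V) = L' := by
  obtain ⟨φ⟩ := he.nonempty_linearEquiv hL hL' hs hs'
  have hcard : Nat.card L' ≤ Nat.card L := (Nat.card_congr φ.toEquiv).ge
  -- If `L` and `L'` are orthogonal, `L ⊔ L'` is isotropic and an automorphism moving `L` to `L'`
  -- extends. Otherwise they form a hyperbolic pair, and the pairs `(L, L')` and `(L', L)` have the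
  -- same span.
  by_cases horth : ∀ u ∈ L, ∀ v ∈ L', h u v = 0
  · have hU : Isotropic h (L ⊔ L') := (isotropic_sup_iff hh horth).2 ⟨hi, hi'⟩
    obtain ⟨g, hg⟩ := exists_swap (U := L ⊔ L') le_sup_left le_sup_right hs hs' φ
    obtain ⟨X, hX, hXg⟩ := hU.exists_isometry hσ hh g
    refine ⟨X, hX, map_eq_of_le hcard fun x hx => ?_⟩
    rw [hXg ⟨x, Submodule.mem_sup_left hx⟩]
    exact hg _ hx
  · have horth' : ¬ ∀ u ∈ L', ∀ v ∈ L, h u v = 0 := fun h1 => horth fun u hu v hv =>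
      hh.eq_zero_symm (h1 v hv u hu)
    have hp : Perfect h L L' := ⟨nondeg_of_simple hσ hh hs horth, fun d hd h1 =>
      nondeg_of_simple hσ hh hs' horth' d hd fun u hu => hh.eq_zero_symm (h1 u hu)⟩
    obtain ⟨X, hX, hXg⟩ := exists_isometry_of_perfect hσ hh hp (hp.swap hh) hi hi' hi' hi
      le_sup_right le_sup_left φ
    refine ⟨X, hX, map_eq_of_le hcard fun x hx => ?_⟩
    rw [hXg ⟨x, hx⟩]
    exact (φ ⟨x, hx⟩).2

variable [Fintype (Submodule R V)]

/-- The sum over the isotropic submodules of a hyperbolic component. -/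
theorem mobSum_pair (hσ : IsInvolution τ σ) (hh : IsHermitian τ σ h) {e : R} (he : e * e = e)
    (hee : e * σ e = 0) {X : V ≃ₗ[R] V} (hX : X ∈ isomGroup R h) :
    mobSum (invSet X) (Isotropic h) (part V (e + σ e)) = mob (invSet X) (part V e) := by
  classical
  have hσe : σ e * σ e = σ e := by rw [← map_mul, he]
  have hle1 : part V e ≤ part V (e + σ e) := fun x hx => by
    rw [mem_part] at *
    rw [add_smul, hx, ← hx, ← mul_smul, mul_comm, hee, zero_smul, add_zero]
  have e1 : part V (e + σ e) ⊓ part V e = part V e := inf_eq_right.2 hle1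
  have e2 : part V (e + σ e) ⊓ part V (1 - e) = part V (σ e) := by
    ext x
    simp only [Submodule.mem_inf, mem_part, add_smul, sub_smul, one_smul]
    constructor
    · rintro ⟨h1, h2⟩
      have h3 : e • x = 0 := by simpa using h2
      rwa [h3, zero_add] at h1
    · intro h1
      have h3 : e • x = 0 := by rw [← h1, ← mul_smul, hee, zero_smul]
      rw [h3, h1]
      simp
  have hi1 : Isotropic h (part V e) := fun x hx y hy =>
    part_orthogonal hh (by rw [mul_comm, hee]) hx hy
  have hi2 : Isotropic h (part V (σ e)) := fun x hx y hy =>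
    part_orthogonal hh (by rw [hσ.invol, hee]) hx hy
  have hS1 := part_mem_invSet e X
  have hS2 := part_mem_invSet (1 - e) X
  have hperf : Perfect h (part V (σ e)) (part V e) := by
    constructor
    · intro u hu h1
      refine hh.nondeg u fun y => ?_
      rw [← mem_part.1 hu, hh.adj, hσ.invol]
      exact h1 _ (smul_mem_part he y)
    · intro d hd h1
      refine hh.nondeg_right d fun y => ?_
      rw [← mem_part.1 hd, hh.adj' hσ]
      exact h1 _ (smul_mem_part hσe y)
  -- The two halves `eV` and `σ(e)V` are dual to each other. For proper `x`, a nonzero functional on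
  -- `eV` vanishing on `x` is represented by a nonzero vector of `σ(e)V` orthogonal to `x`.
  have hkey : ∀ x ≤ part V e, part V (σ e) ⊓ hh.perp hσ x = ⊥ ↔ x = part V e := by
    intro x hx
    constructor
    · intro h1
      by_contra hne
      have hlt : (x.comap (part V e).subtype).restrictScalars F < ⊤ := by
        rw [lt_top_iff_ne_top]
        intro h2
        apply hne
        refine le_antisymm hx fun y hy => ?_
        have : (⟨y, hy⟩ : part V e) ∈ (x.comap (part V e).subtype).restrictScalars F := by
          rw [h2]
          trivial
        exact this
      obtain ⟨l, hl0, hl⟩ := Submodule.exists_le_ker_of_lt_top _ hlt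
      obtain ⟨u, hu, hlu⟩ := hperf.exists_repr hh l
      have hu2 : u ∈ part V (σ e) ⊓ hh.perp hσ x := by
        refine ⟨hu, fun y hy => ?_⟩
        rw [← hlu ⟨y, hx hy⟩]
        exact hl hy
      rw [h1, Submodule.mem_bot] at hu2
      apply hl0
      ext d
      rw [hlu, hu2, hh.zero_right]
      rfl
    · rintro rfl
      rw [eq_bot_iff]
      rintro y ⟨hy, hy'⟩
      exact hperf.1 y hy fun d hd => hh.eq_zero_symm (hy' d hd)
  have hsplit : mobSum (invSet X) (Isotropic h) (part V (e + σ e)) =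
      ∑ U with U ≤ part V (e + σ e) ∧ U ∈ invSet X ∧ Isotropic h U,
        mob (invSet X) (U ⊓ part V e) * mob (invSet X) (U ⊓ part V (1 - e)) := by
    refine Finset.sum_congr (by congr) fun U hU => ?_
    exact mob_split (fun x hx y hy => inf_mem_invSet hx hy) (fun x hx y hy => sup_mem_invSet hx hy)
      hS1 hS2 (inf_part_sup he) (part_inf_part_one_sub e) (mem_filter.1 hU).2.2.1
  rw [hsplit, sum_split (fun x hx y hy => inf_mem_invSet hx hy)
    (fun x hx y hy => sup_mem_invSet hx hy) hS1 hS2 (inf_part_sup he) (part_inf_part_one_sub e)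
    (Isotropic h) _ (fun a b => mob (invSet X) a * mob (invSet X) b), e1, e2]
  -- Both halves are isotropic, so `x ⊔ y` is isotropic exactly when `y` lies in the orthogonal
  -- space of `x`. Summing Möbius values over these `y` gives zero unless that space meets `σ(e)V`
  -- trivially, which leaves only `x = eV`.
  have hinner : ∀ x, x ≤ part V e → x ∈ invSet X →
      ∑ y with y ≤ part V (σ e) ∧ y ∈ invSet X ∧ Isotropic h (x ⊔ y),
        mob (invSet X) x * mob (invSet X) y =
      if x = part V e then mob (invSet X) x else 0 := by
    intro x hx hxS
    have hset : (univ.filter fun y => y ≤ part V (σ e) ∧ y ∈ invSet X ∧ Isotropic h (x ⊔ y)) =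
        univ.filter fun y => y ≤ part V (σ e) ⊓ hh.perp hσ x ∧ y ∈ invSet X := by
      ext y
      simp only [mem_filter, mem_univ, true_and, le_inf_iff]
      constructor
      · rintro ⟨h1, h2, h3⟩
        exact ⟨⟨h1, fun b hb a ha => h3 a (Submodule.mem_sup_left ha) b
          (Submodule.mem_sup_right hb)⟩, h2⟩
      · rintro ⟨⟨h1, h3⟩, h2⟩
        exact ⟨h1, h2, (isotropic_sup_iff hh fun a ha b hb => h3 hb a ha).2
          ⟨fun a ha b hb => hi1 a (hx ha) b (hx hb), fun a ha b hb => hi2 a (h1 ha) b (h1 hb)⟩⟩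
    rw [hset, ← Finset.mul_sum, sum_mob _ (inf_mem_invSet (part_mem_invSet _ _)
      (perp_mem_invSet hσ hh hX hxS)), mul_ite, mul_one, mul_zero]
    exact if_congr (hkey x hx) rfl rfl
  rw [Finset.sum_congr rfl fun x hx => hinner x (mem_filter.1 hx).2.1 (mem_filter.1 hx).2.2]
  rw [Finset.sum_ite_eq_of_mem']
  exact mem_filter.2 ⟨mem_univ _, le_rfl, hS1⟩

variable [Fintype (V ≃ₗ[R] V)]

open scoped Classical in
-- The zero submodule contributes the order of the group. The isotropic simple submodules exist and
-- form one orbit, so they contribute its negative. Automorphisms of larger isotropic submodules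
-- extend to isometries, so these vanish by `sum_mob_stabilizer_eq_zero`.
theorem sum_mobSum_self_eq_zero [IsSemisimpleRing R] (hσ : IsInvolution τ σ)
    (hN : ∀ u, σ u = u → ∃ v, v * σ v = u) (hh : IsHermitian τ σ h) {e : R}
    (he : IsPrimitive e) (hσe : σ e = e) (h0 : part V e ≠ ⊥)
    (hns : ¬ IsSimpleModule R (part V e)) :
    ∑ X with X ∈ isomGroupOn h e, mobSum (invSet X) (Isotropic h) (part V e) = 0 := by
  unfold mobSum
  set H := isomGroupOn h e (V := V)
  have hswap : ∑ X with X ∈ H, ∑ U with U ≤ part V e ∧ U ∈ invSet X ∧ Isotropic h U,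
      mob (invSet X) U = ∑ U with U ≤ part V e ∧ Isotropic h U,
        ∑ X with X ∈ H ∧ U ∈ invSet X, mob (invSet X) U := by
    refine Finset.sum_comm' fun X U => ?_
    simp only [mem_filter, mem_univ, true_and]
    tauto
  rw [hswap]
  set 𝓛 : Finset (Submodule R V) :=
    univ.filter fun L => L ≤ part V e ∧ Isotropic h L ∧ IsSimpleModule R L with h𝓛
  have hbot : ∀ U' : Submodule R V, IsSimpleModule R U' → U' ≠ ⊥ := fun U' hU' =>
    (isSimpleModule_iff_isAtom.1 hU').1
  have hsplit : (univ.filter fun U : Submodule R V => U ≤ part V e ∧ Isotropic h U) =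
      insert ⊥ (𝓛 ∪ univ.filter fun U => (U ≤ part V e ∧ Isotropic h U) ∧ U ≠ ⊥ ∧
        ¬ IsSimpleModule R U) := by
    ext U
    simp only [h𝓛, mem_filter, mem_univ, true_and, mem_insert, mem_union]
    constructor
    · tauto
    · rintro (rfl | h1 | h1)
      · refine ⟨bot_le, fun u hu v _ => ?_⟩
        rw [(Submodule.mem_bot R).1 hu, hh.zero_left]
      · exact ⟨h1.1, h1.2.1⟩
      · exact h1.1
  rw [hsplit, Finset.sum_insert, Finset.sum_union]
  rotate_left
  · rw [Finset.disjoint_left]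
    intro U' h1 h2
    exact (mem_filter.1 h2).2.2.2 (mem_filter.1 h1).2.2.2
  · simp only [h𝓛, mem_union, mem_filter, mem_univ, true_and, not_or]
    exact ⟨fun h1 => hbot _ h1.2.2 rfl, fun h1 => h1.2.1 rfl⟩
  -- Restricted to `eV`, the isometries trivial outside `eV` realize all isometries of `V`, so
  -- transitivity and extension hold for the smaller group too.
  have hcov : ∀ X ∈ isomGroup R h, ∃ Y ∈ H, ∀ x ∈ part V e, Y x = X x := fun X hX =>
    exists_mem_isomGroupOn hh he.idem hσe hX
  have t2 : ∑ X with X ∈ H ∧ ⊥ ∈ invSet X, mob (invSet X) (⊥ : Submodule R V) =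
      #{X | X ∈ H} := by
    rw [Finset.sum_congr rfl fun X _ => mob_bot _]
    simp [bot_mem_invSet]
  have t3 : ∑ L ∈ 𝓛, ∑ X with X ∈ H ∧ L ∈ invSet X, mob (invSet X) L = -#{X | X ∈ H} := by
    rw [← sum_card_stabilizer H 𝓛, Nat.cast_sum, ← Finset.sum_neg_distrib]
    · refine Finset.sum_congr rfl fun L hL => ?_
      rw [Finset.sum_congr rfl fun X _ => mob_of_simple X (mem_filter.1 hL).2.2.2]
      simp
    · obtain ⟨L, h1, h2, h3⟩ := exists_isotropic_simple hσ hN hh he h0 hns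
      exact ⟨L, mem_filter.2 ⟨mem_univ _, h1, h3, h2⟩⟩
    · intro L hL X hX
      simp only [h𝓛, mem_filter, mem_univ, true_and] at hL ⊢
      refine ⟨?_, map_mem_isotropic hX.1 hL.2.1, ?_⟩
      · rw [← mem_invSet.1 (part_mem_invSet e X)]
        exact Submodule.map_mono hL.1
      · have := hL.2.2
        exact IsSimpleModule.congr (X.submoduleMap L).symm
    · intro L hL L' hL'
      simp only [h𝓛, mem_filter, mem_univ, true_and] at hL hL'
      obtain ⟨X, hX, hXL⟩ := exists_isometry_map_eq hσ hh he hL.1 hL'.1 hL.2.2 hL'.2.2 hL.2.1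
        hL'.2.1
      obtain ⟨Y, hY, hYX⟩ := hcov X hX
      refine ⟨Y, hY, ?_⟩
      rw [← hXL]
      ext x
      simp only [Submodule.mem_map]
      exact exists_congr fun y => and_congr_right fun hy => by
        change Y y = x ↔ X y = x
        rw [hYX y (hL.1 hy)]
  have t4 : ∑ U with (U ≤ part V e ∧ Isotropic h U) ∧ U ≠ ⊥ ∧ ¬ IsSimpleModule R U,
      ∑ X with X ∈ H ∧ U ∈ invSet X, mob (invSet X) U = 0 := by
    refine Finset.sum_eq_zero fun U hU => ?_
    simp only [mem_filter, mem_univ, true_and] at hU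
    refine sum_mob_stabilizer_eq_zero U H (fun g => ?_) (fun L hL L' hL' hs hs' =>
      he.nonempty_linearEquiv (hL.trans hU.1.1) (hL'.trans hU.1.1) hs hs') hU.2.1 hU.2.2
    obtain ⟨X, hX, hXg⟩ := hU.1.2.exists_isometry hσ hh g
    obtain ⟨Y, hY, hYX⟩ := hcov X hX
    exact ⟨Y, hY, fun u => by rw [hYX u (hU.1.1 u.2), hXg]⟩
  rw [t2, t3, t4]
  ring

open scoped Classical in
-- For a hyperbolic pair the sum over isotropic submodules is the Möbius value of the half `eV`.
-- This half is isotropic, so all its automorphisms extend to isometries and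
-- `sum_mob_stabilizer_eq_zero` applies to it directly.
theorem sum_mobSum_pair_eq_zero [IsSemisimpleRing R] (hσ : IsInvolution τ σ)
    (hh : IsHermitian τ σ h) {e : R}
    (he : IsPrimitive e) (hee : e * σ e = 0) (h0 : part V e ≠ ⊥)
    (hns : ¬ IsSimpleModule R (part V e)) :
    ∑ X with X ∈ isomGroupOn h (e + σ e),
      mobSum (invSet X) (Isotropic h) (part V (e + σ e)) = 0 := by
  have hf : (e + σ e) * (e + σ e) = e + σ e := by
    have hσe : σ e * σ e = σ e := by rw [← map_mul, he.idem]
    linear_combination he.idem + hσe + 2 * hee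
  have hσf : σ (e + σ e) = e + σ e := by rw [map_add, hσ.invol, add_comm]
  rw [Finset.sum_congr rfl fun X hX => mobSum_pair hσ hh he.idem hee (mem_filter.1 hX).2.1]
  have hi1 : Isotropic h (part V e) := fun x hx y hy =>
    part_orthogonal hh (by rw [mul_comm, hee]) hx hy
  rw [← sum_mob_stabilizer_eq_zero (part V e) (isomGroupOn h (e + σ e)) (fun g => ?_)
    (fun L hL L' hL' hs hs' => he.nonempty_linearEquiv hL hL' hs hs') h0 hns]
  · refine Finset.sum_congr ?_ fun _ _ => rfl
    ext X
    simp only [mem_filter, mem_univ, true_and]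
    exact ⟨fun h1 => ⟨h1, part_mem_invSet _ _⟩, fun h1 => h1.1⟩
  · obtain ⟨X, hX, hXg⟩ := hi1.exists_isometry hσ hh g
    obtain ⟨Y, hY, hYX⟩ := exists_mem_isomGroupOn hh hf hσf hX
    refine ⟨Y, hY, fun u => ?_⟩
    rw [hYX u ?_, hXg]
    have hx := mem_part.1 u.2
    rw [mem_part, add_smul, hx, ← hx, ← mul_smul, mul_comm, hee, zero_smul, add_zero]

end Components

/-! ### Decompositions of the ring and multiplicity free modules -/

theorem IsPrimitive.map {R : Type*} [CommRing R] {σ : R →+* R} (hσ : ∀ r, σ (σ r) = r) {e : R}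
    (he : IsPrimitive e) : IsPrimitive (σ e) where
  idem := by rw [← map_mul, he.idem]
  inv r hr := by
    obtain ⟨s, hs⟩ := he.inv (σ r) fun h1 => hr <| by
      rw [← hσ r, ← map_mul, h1, map_zero]
    have h2 := congrArg σ hs
    rw [map_mul, map_mul, hσ] at h2
    exact ⟨σ s, h2⟩

/-- A complete system of orthogonal idempotents fixed by an involution, each of which is either
primitive (sign `1`) or the sum of two primitive idempotents exchanged by the involution
(sign `-1`). -/
structure IsDecomposition {R O : Type*} [CommRing R] [Fintype O] (σ : R →+* R) (e : O → R)
    (s : O → ℤ) : Prop where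
  orth : ∀ o o', o ≠ o' → e o * e o' = 0
  sum : ∑ o, e o = 1
  fixed : ∀ o, σ (e o) = e o
  kind : ∀ o, (s o = 1 ∧ IsPrimitive (e o)) ∨
    (s o = -1 ∧ ∃ f, IsPrimitive f ∧ f * σ f = 0 ∧ f + σ f = e o)

section

variable {R O : Type*} [CommRing R] [Fintype O] {σ : R →+* R} {e : O → R} {s : O → ℤ}

theorem IsDecomposition.mul_sum [DecidableEq O] (hd : IsDecomposition σ e s) (S : Finset O)
    (o : O) : e o * ∑ o' ∈ S, e o' = if o ∈ S then e o * e o else 0 := by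
  rw [Finset.mul_sum, ← Finset.sum_ite_eq S o (fun _ => e o * e o)]
  refine Finset.sum_congr rfl fun o' _ => ?_
  by_cases h : o = o'
  · rw [if_pos h, h]
  · rw [if_neg h, hd.orth o o' h]

theorem IsDecomposition.idem (hd : IsDecomposition σ e s) (o : O) : e o * e o = e o := by
  classical
  have := hd.mul_sum univ o
  rw [hd.sum, mul_one, if_pos (mem_univ o)] at this
  exact this.symm

theorem IsDecomposition.sum_idem (hd : IsDecomposition σ e s) (S : Finset O) :
    (∑ o ∈ S, e o) * ∑ o ∈ S, e o = ∑ o ∈ S, e o := by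
  classical
  rw [Finset.sum_mul]
  refine Finset.sum_congr rfl fun o ho => ?_
  rw [hd.mul_sum, if_pos ho, hd.idem]

/-- The vector `v` generates the module, with annihilator the elements that vanish on the
components in `S`. -/
structure IsCyclicOn {V : Type*} [AddCommGroup V] [Module R V] (e : O → R) (S : Finset O)
    (v : V) : Prop where
  gen : ∀ x, ∃ r : R, r • v = x
  ann : ∀ r : R, r • v = 0 ↔ r * ∑ o ∈ S, e o = 0

theorem IsCyclicOn.smul_eq_zero_iff {V : Type*} [AddCommGroup V] [Module R V]
    (hd : IsDecomposition σ e s) (h0 : ∀ o, e o ≠ 0)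
    {S : Finset O} {v : V} (hv : IsCyclicOn e S v) (o : O) : e o • v = 0 ↔ o ∉ S := by
  classical
  rw [hv.ann, hd.mul_sum, hd.idem]
  by_cases h : o ∈ S <;> simp [h, h0]

end

section

variable {F R V O : Type*} [Field F] [CommRing R] [Algebra F R] [AddCommGroup V]
    [Module F V] [Module R V] {τ : F →+* F} {σ : R →+* R}
    {h : V → V → F} [Fintype O] {e : O → R} {s : O → ℤ} [Fintype (Submodule R V)]

theorem mobSum_part_of_eq_bot (hh : IsHermitian τ σ h) {M : Submodule R V} (hM : M = ⊥)
    (X : V ≃ₗ[R] V) : mobSum (invSet X) (Isotropic h) M = 1 := by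
  classical
  subst hM
  unfold mobSum
  have h2 : (univ.filter fun x : Submodule R V => x ≤ ⊥ ∧ x ∈ invSet X ∧ Isotropic h x) =
      {⊥} := by
    ext x
    simp only [mem_filter, mem_univ, true_and, mem_singleton, le_bot_iff]
    refine ⟨fun h => h.1, ?_⟩
    rintro rfl
    refine ⟨rfl, bot_mem_invSet X, fun u hu v _ => ?_⟩
    rw [(Submodule.mem_bot R).1 hu, hh.zero_left]
  rw [h2, Finset.sum_singleton, mob_bot]

theorem mobSum_eq_prod [Finite V] (hh : IsHermitian τ σ h) (hd : IsDecomposition σ e s)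
    (X : V ≃ₗ[R] V) :
    mobSum (invSet X) (Isotropic h) ⊤ =
      ∏ o, mobSum (invSet X) (Isotropic h) (part V (e o)) := by
  classical
  have key : ∀ S : Finset O, mobSum (invSet X) (Isotropic h) (part V (∑ o ∈ S, e o)) =
      ∏ o ∈ S, mobSum (invSet X) (Isotropic h) (part V (e o)) := by
    intro S
    induction S using Finset.induction_on with
    | empty =>
      have h1 : part V (0 : R) = ⊥ := by
        rw [eq_bot_iff]
        intro x hx
        rw [mem_part, zero_smul] at hx
        exact hx.symm
      rw [Finset.sum_empty, Finset.prod_empty, h1]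
      exact mobSum_part_of_eq_bot hh rfl X
    | insert o S ho ih =>
      rw [Finset.prod_insert ho, ← ih, Finset.sum_insert ho,
        mobSum_part_split hh (hd.idem o) (hd.fixed o) X (part V (e o + ∑ o ∈ S, e o))]
      have hz : e o * ∑ o ∈ S, e o = 0 := by rw [hd.mul_sum, if_neg ho]
      have hz' : (∑ o ∈ S, e o) * e o = 0 := by rw [mul_comm, hz]
      congr 2
      · refine inf_eq_right.2 fun x hx => ?_
        rw [mem_part] at *
        rw [add_smul, hx, ← hx, ← mul_smul, hz', zero_smul, add_zero]
      · ext x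
        simp only [Submodule.mem_inf, mem_part, add_smul, sub_smul, one_smul]
        constructor
        · rintro ⟨h1, h2⟩
          have h3 : e o • x = 0 := by simpa using h2
          rwa [h3, zero_add] at h1
        · intro h1
          have h3 : e o • x = 0 := by rw [← h1, ← mul_smul, hz, zero_smul]
          rw [h3, h1]
          simp
  rw [← key, hd.sum]
  congr 1
  rw [eq_comm, eq_top_iff]
  intro x _
  rw [mem_part, one_smul]

/-- A simple self-dual component is nondegenerate, so its only isotropic submodule is zero. -/
theorem mobSum_part_of_simple (hh : IsHermitian τ σ h) {e : R} (he : e * e = e) (hσe : σ e = e)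
    (hs : IsSimpleModule R (part V e)) (X : V ≃ₗ[R] V) :
    mobSum (invSet X) (Isotropic h) (part V e) = 1 := by
  classical
  unfold mobSum
  have hat := isSimpleModule_iff_isAtom.1 hs
  have h2 : (univ.filter fun x : Submodule R V => x ≤ part V e ∧ x ∈ invSet X ∧ Isotropic h x) =
      {⊥} := by
    ext x
    simp only [mem_filter, mem_univ, true_and, mem_singleton]
    constructor
    · rintro ⟨h1, -, h3⟩
      by_contra h4
      have h5 : x = part V e := by
        by_contra h6
        exact h4 (hat.2 x (lt_of_le_of_ne h1 h6))
      apply hat.1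
      rw [eq_bot_iff, ← h5]
      intro y hy
      refine hh.nondeg y fun z => ?_
      have hy' := mem_part.1 (h1 hy)
      rw [← hy', hh.adj, hσe]
      refine h3 y hy _ ?_
      rw [h5]
      exact smul_mem_part he z
    · rintro rfl
      refine ⟨bot_le, bot_mem_invSet X, fun u hu v _ => ?_⟩
      rw [(Submodule.mem_bot R).1 hu, hh.zero_left]
  rw [h2, Finset.sum_singleton, mob_bot]

variable [Finite F] [IsScalarTower F R V] [Finite V]

/-- The sum over the isotropic submodules of a cyclic module. -/
theorem IsCyclicOn.mobSum_eq (hσ : IsInvolution τ σ) (hh : IsHermitian τ σ h)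
    (hd : IsDecomposition σ e s) (h0 : ∀ o, e o ≠ 0) {S : Finset O} {v : V}
    (hv : IsCyclicOn e S v) {X : V ≃ₗ[R] V} (hX : X ∈ isomGroup R h) :
    mobSum (invSet X) (Isotropic h) ⊤ = ∏ o ∈ S, s o := by
  classical
  rw [mobSum_eq_prod hh hd X, ← Finset.prod_subset (Finset.subset_univ S)]
  · refine Finset.prod_congr rfl fun o ho => ?_
    have hne : e o • v ≠ 0 := fun h1 => (hv.smul_eq_zero_iff hd h0 o).1 h1 ho
    -- A self-dual simple component contributes `1`. A hyperbolic pair contributes the Möbius value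
    -- of one of its simple halves, which is `-1`.
    rcases hd.kind o with ⟨hs, hp⟩ | ⟨hs, f, hf, hff, hfe⟩
    · rw [hs]
      exact mobSum_part_of_simple hh hp.idem (hd.fixed o) (isSimpleModule_part hp hv.gen hne) X
    · rw [hs, ← hfe, mobSum_pair hσ hh hf.idem hff hX]
      refine mob_of_simple X (isSimpleModule_part hf hv.gen fun h1 => hne ?_)
      rw [hv.ann] at h1 ⊢
      have h2 : f * e o = f := by rw [← hfe, mul_add, hff, hf.idem, add_zero]
      have h3 : f = 0 := by
        rw [← h2, ← hd.idem o, ← if_pos (c := o ∈ S) (t := e o * e o) (e := 0) ho, ← hd.mul_sum,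
          ← mul_assoc, h2, h1]
      rw [← hfe, h3, map_zero, add_zero, zero_mul]
  · intro o _ ho
    refine mobSum_part_of_eq_bot hh ?_ X
    rw [eq_bot_iff]
    intro x hx
    obtain ⟨r, rfl⟩ := hv.gen x
    rw [mem_part, smul_comm, (hv.smul_eq_zero_iff hd h0 o).2 ho, smul_zero] at hx
    exact hx.symm

variable [Fintype (V ≃ₗ[R] V)]

open scoped Classical in
/-- The average over the isometry group vanishes unless the module is cyclic. -/
theorem exists_isCyclicOn [IsSemisimpleRing R] (hσ : IsInvolution τ σ)
    (hN : ∀ u, σ u = u → ∃ v, v * σ v = u) (hh : IsHermitian τ σ h)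
    (hd : IsDecomposition σ e s)
    (hW : ∑ X with X ∈ isomGroup R h, mobSum (invSet X) (Isotropic h) ⊤ ≠ 0) :
    ∃ (S : Finset O) (v : V), IsCyclicOn e S v := by
  have hsimple : ∀ f : R, IsPrimitive f → IsSimpleModule R (part V f) → ∃ v ∈ part V f,
      (∀ x ∈ part V f, ∃ r : R, r • v = x) ∧ ∀ r : R, r • v = 0 ↔ f * r = 0 := by
    intro f hf hs
    obtain ⟨v, hv⟩ := exists_ne_zero_of_simple hs
    refine ⟨v, v.2, fun x hx => ?_, hf.smul_eq_zero_iff v.2 (by simpa using hv)⟩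
    obtain ⟨r, hr⟩ := exists_smul_eq_of_simple hs hv ⟨x, hx⟩
    exact ⟨r, congrArg Subtype.val hr⟩
  have hcomp : ∀ o, part V (e o) ≠ ⊥ → ∃ v ∈ part V (e o),
      (∀ x ∈ part V (e o), ∃ r : R, r • v = x) ∧ ∀ r : R, r • v = 0 ↔ e o * r = 0 := by
    intro o ho
    rcases hd.kind o with ⟨hs, hp⟩ | ⟨hs, f, hf, hff, hfe⟩
    · refine hsimple (e o) hp ?_
      by_contra hns
      exact hW (sum_mobSum_eq_zero_of_part hh hp.idem (hd.fixed o)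
        (sum_mobSum_self_eq_zero hσ hN hh hp (hd.fixed o) ho hns))
    -- A half that is not simple would make the average vanish.
    · have hpair : ∀ f : R, IsPrimitive f → f * σ f = 0 → part V f ≠ ⊥ →
          IsSimpleModule R (part V f) := by
        intro f hf hff h1
        by_contra hns
        refine hW (sum_mobSum_eq_zero_of_part hh (f := f + σ f) ?_ ?_
          (sum_mobSum_pair_eq_zero hσ hh hf hff h1 hns))
        · have hσe : σ f * σ f = σ f := by rw [← map_mul, hf.idem]
          linear_combination hf.idem + hσe + 2 * hff
        · rw [map_add, hσ.invol, add_comm]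
      -- The pairing between `fV` and `σ(f)V` is perfect, so the two halves vanish together.
      have hdual : ∀ f : R, f * f = f → part V f ≠ ⊥ → part V (σ f) ≠ ⊥ := by
        intro f hf h1 h2
        apply h1
        rw [eq_bot_iff]
        intro x hx
        refine hh.nondeg x fun y => ?_
        have h3 : σ f • y ∈ part V (σ f) := smul_mem_part (by rw [← map_mul, hf]) y
        rw [h2, Submodule.mem_bot] at h3
        rw [← mem_part.1 hx, hh.adj, h3, hh.zero_right]
      have hσf := hf.map hσ.invol
      have hff' : σ f * σ (σ f) = 0 := by rw [hσ.invol, mul_comm, hff]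
      have hf0 : part V f ≠ ⊥ := by
        intro h1
        have h2 : part V (σ f) = ⊥ := by
          by_contra h2
          have := hdual _ hσf.idem h2
          rw [hσ.invol] at this
          exact this h1
        apply ho
        rw [eq_bot_iff]
        intro x hx
        have h3 := smul_mem_part hf.idem x
        have h4 := smul_mem_part hσf.idem x
        rw [h1, Submodule.mem_bot] at h3
        rw [h2, Submodule.mem_bot] at h4
        rw [mem_part, ← hfe, add_smul, h3, h4, add_zero] at hx
        exact hx.symm
      obtain ⟨v, hv, hv1, hv2⟩ := hsimple f hf (hpair f hf hff hf0)
      obtain ⟨w, hw, hw1, hw2⟩ := hsimple (σ f) hσf (hpair _ hσf hff' (hdual f hf.idem hf0))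
      have hfv := mem_part.1 hv
      have hfw := mem_part.1 hw
      have hfv' : σ f • v = 0 := by rw [← hfv, ← mul_smul, mul_comm, hff, zero_smul]
      have hfw' : f • w = 0 := by rw [← hfw, ← mul_smul, hff, zero_smul]
      -- The halves are not isomorphic, since orthogonal idempotents separate them, so the sum of
      -- two generators generates both.
      refine ⟨v + w, ?_, fun x hx => ?_, fun r => ?_⟩
      · rw [mem_part, ← hfe, add_smul, smul_add, smul_add, hfv, hfw, hfv', hfw']
        simp
      · obtain ⟨a, ha⟩ := hv1 (f • x) (smul_mem_part hf.idem x)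
        obtain ⟨b, hb⟩ := hw1 (σ f • x) (smul_mem_part hσf.idem x)
        refine ⟨a * f + b * σ f, ?_⟩
        rw [add_smul, mul_smul, mul_smul, smul_add f, smul_add (σ f), hfv, hfw', hfv', hfw, add_zero,
          zero_add, ha, hb, ← add_smul, hfe]
        exact hx
      · rw [← hfe, add_mul]
        constructor
        · intro h1
          have h2 : r • v = 0 := by
            have := congrArg (f • ·) h1
            simp only [smul_comm f r, smul_add, hfv, hfw', smul_zero, add_zero] at this
            exact this
          have h3 : r • w = 0 := by
            rw [smul_add, h2, zero_add] at h1
            exact h1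
          rw [(hv2 r).1 h2, (hw2 r).1 h3, add_zero]
        · intro h1
          have h2 : f * r = 0 := by
            have := congrArg (f * ·) h1
            simp only [mul_add, ← mul_assoc, hff, hf.idem, zero_mul, add_zero, mul_zero] at this
            exact this
          rw [h2, zero_add] at h1
          rw [smul_add, (hv2 r).2 h2, (hw2 r).2 h1, add_zero]
  -- The support: with every occurring component cyclic, the sum of their generators generates the
  -- module.
  set S : Finset O := univ.filter fun o => part V (e o) ≠ ⊥ with hS
  choose! v hv1 hv2 hv3 using hcomp
  have hvS : ∀ o ∈ S, part V (e o) ≠ ⊥ := fun o ho => (mem_filter.1 ho).2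
  have hev : ∀ o ∈ S, e o • ∑ o' ∈ S, v o' = v o := by
    intro o ho
    rw [Finset.smul_sum, Finset.sum_eq_single_of_mem o ho]
    · exact mem_part.1 (hv1 o (hvS o ho))
    · intro o' ho' hne
      rw [← mem_part.1 (hv1 o' (hvS o' ho')), ← mul_smul, hd.orth o o' hne.symm, zero_smul]
  refine ⟨S, ∑ o ∈ S, v o, ?_, ?_⟩
  · intro x
    have h1 : ∀ o, ∃ r : R, o ∈ S → r • v o = e o • x := by
      intro o
      by_cases ho : o ∈ S
      · obtain ⟨r, hr⟩ := hv2 o (hvS o ho) (e o • x) (smul_mem_part (hd.idem o) x)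
        exact ⟨r, fun _ => hr⟩
      · exact ⟨0, fun h => absurd h ho⟩
    choose r hr using h1
    refine ⟨∑ o ∈ S, r o * e o, ?_⟩
    rw [Finset.sum_smul]
    have h2 : x = ∑ o ∈ S, e o • x := by
      conv_lhs => rw [← one_smul R x, ← hd.sum, Finset.sum_smul]
      symm
      refine Finset.sum_subset (Finset.subset_univ S) fun o _ ho => ?_
      have h3 : part V (e o) = ⊥ := by
        by_contra h4
        exact ho (mem_filter.2 ⟨mem_univ o, h4⟩)
      have h4 := smul_mem_part (hd.idem o) x
      rwa [h3, Submodule.mem_bot] at h4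
    conv_rhs => rw [h2]
    refine Finset.sum_congr rfl fun o ho => ?_
    rw [mul_smul, hev o ho, hr o ho]
  · intro r
    constructor
    · intro h1
      rw [Finset.mul_sum]
      refine Finset.sum_eq_zero fun o ho => ?_
      rw [mul_comm, ← hv3 o (hvS o ho), ← hev o ho, smul_comm, h1, smul_zero]
    · intro h1
      rw [Finset.smul_sum]
      refine Finset.sum_eq_zero fun o ho => ?_
      rw [hv3 o (hvS o ho)]
      rw [← hd.idem o, ← if_pos (c := o ∈ S) (t := e o * e o) (e := 0) ho, ← hd.mul_sum, mul_assoc,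
        mul_comm _ r, h1, mul_zero]

end

/-! ### Traces and norms of finite fields -/

section Frobenius

variable {F : Type*} [Field F] [Finite F] {q : ℕ}

theorem exists_char (hq : IsPrimePow q) (hF : Nat.card F = q ^ 2) :
    ∃ l k, l.Prime ∧ q = l ^ k ∧ CharP F l := by
  obtain ⟨l, k, hl, hk, rfl⟩ := hq
  refine ⟨l, k, hl.nat_prime, rfl, ?_⟩
  have hl' := hl.nat_prime
  have : Fact l.Prime := ⟨hl'⟩
  rw [CharP.charP_iff_prime_eq_zero hl']
  have := Fintype.ofFinite F
  have h1 : ((Fintype.card F : ℕ) : F) = 0 := Nat.cast_card_eq_zero F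
  rw [← Nat.card_eq_fintype_card, hF, ← pow_mul, Nat.cast_pow] at h1
  exact (pow_eq_zero_iff (by positivity)).1 h1

/-- The `q`-power map of a field extension of a field of order `q ^ 2`. -/
theorem exists_frobenius (hq : IsPrimePow q) (hF : Nat.card F = q ^ 2) (E : Type*) [Field E]
    [Algebra F E] : ∃ τ : E →+* E, ∀ a, τ a = a ^ q := by
  obtain ⟨l, k, hl, rfl, hchar⟩ := exists_char hq hF
  have : Fact l.Prime := ⟨hl⟩
  have : CharP E l := charP_of_injective_algebraMap (algebraMap F E).injective l
  exact ⟨iterateFrobenius E l k, fun a => iterateFrobenius_def l k a⟩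

theorem pow_sq_eq (hF : Nat.card F = q ^ 2) (a : F) : a ^ (q ^ 2) = a := by
  have := Fintype.ofFinite F
  rw [← hF, Nat.card_eq_fintype_card, FiniteField.pow_card]

/-- The polynomial `x^q + x` has at most `q` roots among `q^2` elements, so some trace is nonzero.
It is fixed by the `q`-power map, so dividing by it normalizes the trace to one. -/
theorem exists_trace_one (hq : IsPrimePow q) (hF : Nat.card F = q ^ 2) :
    ∃ l : F, l + l ^ q = 1 := by
  obtain ⟨τ, hτ⟩ := exists_frobenius hq hF F
  have hq1 : 1 < q := hq.one_lt
  have h1 : ∃ c : F, c + c ^ q ≠ 0 := by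
    by_contra! h
    have := Fintype.ofFinite F
    classical
    have hp0 : (Polynomial.X ^ q + Polynomial.X : Polynomial F).natDegree = q := by
      rw [Polynomial.natDegree_add_eq_left_of_natDegree_lt] <;> simp [hq1]
    have hne : (Polynomial.X ^ q + Polynomial.X : Polynomial F) ≠ 0 := by
      intro h0
      rw [h0] at hp0
      simp at hp0
      omega
    have h2 : (Finset.univ : Finset F).card ≤ q := by
      rw [← hp0]
      refine (Finset.card_le_card ?_).trans (Polynomial.card_roots' _ |>.trans'
        (Multiset.toFinset_card_le _))
      intro c _
      rw [Multiset.mem_toFinset, Polynomial.mem_roots hne]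
      simp [add_comm, h c]
    rw [Finset.card_univ, ← Nat.card_eq_fintype_card, hF] at h2
    nlinarith
  obtain ⟨c, hc⟩ := h1
  refine ⟨c / (c + c ^ q), ?_⟩
  have h3 : (c + c ^ q) ^ q = c + c ^ q := by
    rw [← hτ, map_add, hτ, hτ, ← pow_mul, ← sq, pow_sq_eq hF, add_comm]
  rw [div_pow, h3]
  field_simp

/-- A symmetric element is a norm. -/
theorem exists_norm_eq {E : Type*} [Field E] [IsAlgClosed E] {Q : ℕ} (hQ : 0 < Q) {w : E}
    (hw : w ^ Q = w) : ∃ t : E, t * t ^ Q = w ∧ t ^ (Q * Q) = t := by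
  -- Any root of `t^(Q + 1) = w` serves: raising the equation to the power `Q` and using `w^Q = w`
  -- gives `t^(Q * Q) = t`.
  obtain ⟨t, ht⟩ := IsAlgClosed.exists_pow_nat_eq w (Nat.succ_pos Q)
  have ht' : t * t ^ Q = w := by rw [← ht, Nat.succ_eq_add_one, pow_succ']
  refine ⟨t, ht', ?_⟩
  rcases eq_or_ne t 0 with rfl | h0
  · exact zero_pow (by positivity)
  have h1 : (t * t ^ Q) ^ Q = t * t ^ Q := by rw [ht', hw]
  rw [mul_pow, ← pow_mul] at h1
  have h2 : t ^ Q ≠ 0 := pow_ne_zero _ h0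
  apply mul_left_cancel₀ h2
  rw [h1, mul_comm]

theorem card_pow_eq_self_le {E : Type*} [Field E] {Q : ℕ} (hQ : 1 < Q) (s : Finset E)
    (hs : ∀ x ∈ s, x ^ Q = x) : s.card ≤ Q := by
  classical
  have hp0 := FiniteField.X_pow_card_sub_X_natDegree_eq E hQ
  have hne := FiniteField.X_pow_card_sub_X_ne_zero E hQ
  rw [← hp0]
  refine (Finset.card_le_card ?_).trans (Polynomial.card_roots' _ |>.trans'
    (Multiset.toFinset_card_le _))
  intro c hc
  rw [Multiset.mem_toFinset, Polynomial.mem_roots hne]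
  simp [hs c hc]

/-- A finite set of `Q` solutions of `x ^ Q = x` contains all solutions. -/
theorem mem_of_pow_eq_self {E : Type*} [Field E] {Q : ℕ} (hQ : 1 < Q) {s : Set E}
    (hs : ∀ x ∈ s, x ^ Q = x) (hcard : Q ≤ s.ncard) {t : E} (ht : t ^ Q = t) : t ∈ s := by
  classical
  by_contra h
  have hfin : s.Finite := Set.finite_of_ncard_ne_zero (by omega)
  have h1 := card_pow_eq_self_le hQ (insert t hfin.toFinset) (by
    intro x hx
    rcases Finset.mem_insert.1 hx with rfl | hx
    · exact ht
    · exact hs x (hfin.mem_toFinset.1 hx))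
  rw [Finset.card_insert_of_notMem (by simpa using h), ← Set.ncard_eq_toFinset_card s hfin] at h1
  omega

/-- The image of `F` already supplies all `q^2` possible roots of `t^(q^2) = t`. -/
theorem mem_range_algebraMap (hq : IsPrimePow q) (hF : Nat.card F = q ^ 2) {E : Type*} [Field E]
    [Algebra F E] {t : E} (ht : t ^ (q ^ 2) = t) : ∃ c : F, algebraMap F E c = t := by
  have h1 : t ∈ Set.range (algebraMap F E) := by
    refine mem_of_pow_eq_self (one_lt_pow₀ hq.one_lt two_ne_zero) ?_ ?_ ht
    · rintro _ ⟨c, rfl⟩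
      rw [← map_pow, pow_sq_eq hF]
    · rw [← hF, ← Set.image_univ, Set.ncard_image_of_injective _ (algebraMap F E).injective,
        Set.ncard_univ]
  exact h1

theorem exists_norm_eq_of_card (hq : IsPrimePow q) (hF : Nat.card F = q ^ 2) {w : F}
    (hw : w ^ q = w) : ∃ t : F, t * t ^ q = w := by
  obtain ⟨t, ht1, ht2⟩ := exists_norm_eq (E := AlgebraicClosure F) hq.pos
    (w := algebraMap F _ w) (by rw [← map_pow, hw])
  rw [← sq] at ht2
  obtain ⟨c, rfl⟩ := mem_range_algebraMap hq hF ht2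
  refine ⟨c, (algebraMap F (AlgebraicClosure F)).injective ?_⟩
  rw [map_mul, map_pow, ht1]

end Frobenius

/-! ### The involution of a group algebra and the twist of characters -/

section GroupAlgebra

variable {F E A : Type*} [Field F] [Field E] [Algebra F E] [CommGroup A] {q : ℕ}

/-- The involution of a group algebra that inverts the group elements and acts by `τ` on the
coefficients. -/
noncomputable def conj (τ : F →+* F) : MonoidAlgebra F A →+* MonoidAlgebra F A :=
  MonoidAlgebra.liftNCRingHom ((algebraMap F (MonoidAlgebra F A)).comp τ)
    ((MonoidAlgebra.of F A).comp invMonoidHom) (fun _ _ => Commute.all _ _)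

theorem conj_single (τ : F →+* F) (a : A) (c : F) :
    conj τ (MonoidAlgebra.single a c) = MonoidAlgebra.single a⁻¹ (τ c) := by
  simp [conj, MonoidAlgebra.single_mul_single]

theorem isInvolution_conj [Finite F] (hq : IsPrimePow q) (hF : Nat.card F = q ^ 2) {τ : F →+* F}
    (hτ : ∀ a, τ a = a ^ q) : IsInvolution τ (conj τ : MonoidAlgebra F A →+* _) where
  base_invol a := by rw [hτ, hτ, ← pow_mul, ← sq, pow_sq_eq hF]
  invol r := by
    have hb : ∀ a, τ (τ a) = a := fun a => by rw [hτ, hτ, ← pow_mul, ← sq, pow_sq_eq hF]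
    induction r using MonoidAlgebra.induction_linear with
    | zero => simp
    | add f g hf hg => rw [map_add, map_add, hf, hg]
    | single a c => rw [conj_single, conj_single, inv_inv, hb]
  algebraMap a := by
    simp [conj_single]
  trace_one := by
    obtain ⟨l, hl⟩ := exists_trace_one hq hF
    exact ⟨l, by rw [hτ, hl]⟩

/-- The evaluation of the group algebra at a character. -/
noncomputable def ev (F : Type*) {E A : Type*} [Field F] [Field E] [Algebra F E] [CommGroup A]
    (χ : A →* Eˣ) : MonoidAlgebra F A →ₐ[F] E :=
  MonoidAlgebra.lift F E A ((Units.coeHom E).comp χ)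

theorem ev_single (χ : A →* Eˣ) (a : A) (c : F) :
    ev F χ (MonoidAlgebra.single a c) = algebraMap F E c * χ a := by
  simp [ev, Algebra.smul_def]

theorem ev_injective : Function.Injective (ev F : (A →* Eˣ) → MonoidAlgebra F A →ₐ[F] E) := by
  intro χ χ' h
  ext a
  have := DFunLike.congr_fun h (MonoidAlgebra.single a 1)
  simpa [ev_single] using this

/-- The map `χ ↦ χ ^ (-q)` on characters. -/
def twist (q : ℕ) (χ : A →* Eˣ) : A →* Eˣ := (χ ^ q)⁻¹

theorem twist_apply (χ : A →* Eˣ) (a : A) : ((twist q χ a : Eˣ) : E) = ((χ a : E) ^ q)⁻¹ := by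
  simp [twist]

/-- This is why the involution permutes the components of the group algebra as `χ ↦ χ^(-q)` permutes
the characters. -/
theorem ev_twist_conj [Finite F] (hq : IsPrimePow q) (hF : Nat.card F = q ^ 2) {τ : F →+* F}
    (hτ : ∀ a, τ a = a ^ q) (χ : A →* Eˣ) (x : MonoidAlgebra F A) :
    ev F (twist q χ) (conj τ x) = ev F χ x ^ q := by
  obtain ⟨τE, hτE⟩ := exists_frobenius hq hF E
  induction x using MonoidAlgebra.induction_linear with
  | zero => simp [hq.ne_zero]
  | add f g hf hg => rw [map_add, map_add, hf, hg, map_add, ← hτE, ← hτE, ← hτE, map_add]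
  | single a c =>
    rw [conj_single, ev_single, ev_single, hτ, map_inv, Units.val_inv_eq_inv_val, twist_apply,
      inv_inv, mul_pow, map_pow]

theorem ev_iterate_twist_conj [Finite F] (hq : IsPrimePow q) (hF : Nat.card F = q ^ 2)
    {τ : F →+* F} (hτ : ∀ a, τ a = a ^ q) (k : ℕ) (χ : A →* Eˣ) (x : MonoidAlgebra F A) :
    ev F ((twist q)^[k] χ) ((conj τ)^[k] x) = ev F χ x ^ (q ^ k) := by
  induction k with
  | zero => simp
  | succ k ih =>
    rw [Function.iterate_succ_apply', Function.iterate_succ_apply', ev_twist_conj hq hF hτ, ih,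
      ← pow_mul, pow_succ]

/-- Two twists are the Galois action `χ ↦ χ^(q^2)`, and evaluations of an element with coefficients
in `F` at Galois conjugate characters are conjugate. -/
theorem ev_iterate_twist_even [Finite F] (hq : IsPrimePow q) (hF : Nat.card F = q ^ 2)
    {τ : F →+* F} (hτ : ∀ a, τ a = a ^ q) (k : ℕ) (χ : A →* Eˣ) (x : MonoidAlgebra F A) :
    ev F ((twist q)^[2 * k] χ) x = ev F χ x ^ (q ^ (2 * k)) := by
  rw [← ev_iterate_twist_conj hq hF hτ]
  congr 1
  have h2 : (conj τ : MonoidAlgebra F A →+* _)^[2] = id :=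
    funext fun y => (isInvolution_conj hq hF hτ).invol y
  rw [Function.iterate_mul, h2, Function.iterate_id, id]

theorem twist_injective [Finite F] (hq : IsPrimePow q) (hF : Nat.card F = q ^ 2) :
    Function.Injective (twist q : (A →* Eˣ) → A →* Eˣ) := by
  obtain ⟨τE, hτE⟩ := exists_frobenius hq hF E
  intro χ χ' h
  ext a
  have h1 := congrArg (Units.val) (DFunLike.congr_fun h a)
  rw [twist_apply, twist_apply, inv_inj, ← hτE, ← hτE] at h1
  exact τE.injective h1

end GroupAlgebra

/-! ### Fourier inversion and idempotents of the group algebra -/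

section Fourier

variable {F E A : Type*} [Field F] [Field E] [Algebra F E] [CommGroup A] [Finite A] {q : ℕ}
  [IsAlgClosed E]

theorem finite_monoidAlgebra {F A : Type*} [Field F] [Finite F] [Finite A] :
    Finite (MonoidAlgebra F A) := by
  have : Finite (A →₀ F) := Finite.of_injective _ DFunLike.coe_injective
  exact Finite.of_equiv (A →₀ F) MonoidAlgebra.coeffEquiv.symm

theorem hasEnoughRootsOfUnity_exponent {E A : Type*} [Field E] [IsAlgClosed E] [CommGroup A]
    (hA : (Nat.card A : E) ≠ 0) :
    HasEnoughRootsOfUnity E (Monoid.exponent A) := by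
  have : NeZero ((Monoid.exponent A : ℕ) : E) := ⟨fun h => by
    obtain ⟨m, hm⟩ := Group.exponent_dvd_nat_card (G := A)
    apply hA
    rw [hm, Nat.cast_mul, h, zero_mul]⟩
  infer_instance

theorem natCard_dual_group (hA : (Nat.card A : E) ≠ 0) : Nat.card (A →* Eˣ) = Nat.card A := by
  have := hasEnoughRootsOfUnity_exponent hA
  exact CommGroup.card_monoidHom_of_hasEnoughRootsOfUnity A E

theorem sum_dual_eq_zero [Fintype (A →* Eˣ)] (hA : (Nat.card A : E) ≠ 0) {a : A} (ha : a ≠ 1) :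
    ∑ χ : A →* Eˣ, (χ a : E) = 0 := by
  have := hasEnoughRootsOfUnity_exponent hA
  obtain ⟨χ₀, h0⟩ := CommGroup.exists_apply_ne_one_of_hasEnoughRootsOfUnity A E ha
  have h1 : ∑ χ : A →* Eˣ, (χ a : E) = (χ₀ a : E) * ∑ χ : A →* Eˣ, (χ a : E) := by
    rw [Finset.mul_sum, ← Equiv.sum_comp (Equiv.mulLeft χ₀)]
    simp
  have h2 : ((χ₀ a : E) - 1) * ∑ χ : A →* Eˣ, (χ a : E) = 0 := by
    rw [sub_mul, ← h1, one_mul, sub_self]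
  refine (mul_eq_zero.1 h2).resolve_left fun h3 => h0 ?_
  rw [sub_eq_zero] at h3
  exact Units.ext h3

theorem eq_sum_single {F A : Type*} [Field F] [Fintype A] (x : MonoidAlgebra F A) :
    x = ∑ a, MonoidAlgebra.single a (x.coeff a) := by
  conv_lhs => rw [← MonoidAlgebra.sum_coeff_single x]
  rw [Finsupp.sum_fintype]
  simp

/-- An element of the group algebra is determined by its evaluations. -/
theorem eq_zero_of_ev_eq_zero (hA : (Nat.card A : E) ≠ 0) {x : MonoidAlgebra F A}
    (hx : ∀ χ : A →* Eˣ, ev F χ x = 0) : x = 0 := by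
  classical
  have := Fintype.ofFinite A
  have := Fintype.ofFinite (A →* Eˣ)
  have key : ∀ a, algebraMap F E (x.coeff a) = 0 := by
    intro a
    -- Fourier inversion: by orthogonality this sum is `|A|` times the coefficient of `x` at `a`,
    -- and `|A|` is invertible in `E`.
    have h1 : ∑ χ : A →* Eˣ, ev F χ x * ((χ a : Eˣ) : E)⁻¹ = 0 :=
      Finset.sum_eq_zero fun χ _ => by rw [hx, zero_mul]
    conv_lhs at h1 => rw [eq_sum_single x]
    simp only [map_sum, ev_single, Finset.sum_mul] at h1
    rw [Finset.sum_comm, Finset.sum_eq_single a] at h1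
    · have h2 : ∀ χ : A →* Eˣ, algebraMap F E (x.coeff a) * (χ a : E) * ((χ a : Eˣ) : E)⁻¹ =
          algebraMap F E (x.coeff a) := fun χ => by
        rw [mul_assoc, mul_inv_cancel₀ (Units.ne_zero _), mul_one]
      simp only [h2, Finset.sum_const, Finset.card_univ, nsmul_eq_mul] at h1
      rw [← Nat.card_eq_fintype_card, natCard_dual_group hA] at h1
      exact (mul_eq_zero.1 h1).resolve_left hA
    · intro b _ hb
      have h2 : ∀ χ : A →* Eˣ, algebraMap F E (x.coeff b) * (χ b : E) * ((χ a : Eˣ) : E)⁻¹ =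
          algebraMap F E (x.coeff b) * (χ (b * a⁻¹) : E) := fun χ => by
        rw [map_mul, map_inv, Units.val_mul, Units.val_inv_eq_inv_val, mul_assoc]
      simp only [h2]
      rw [← Finset.mul_sum, sum_dual_eq_zero hA (by rwa [ne_eq, mul_inv_eq_one]), mul_zero]
    · simp
  rw [eq_sum_single x]
  refine Finset.sum_eq_zero fun a _ => ?_
  rw [(map_eq_zero (algebraMap F E)).1 (key a), MonoidAlgebra.single_zero]

/-- Two elements of the group algebra with the same evaluations are equal. -/
theorem ev_ext (hA : (Nat.card A : E) ≠ 0) {x y : MonoidAlgebra F A}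
    (hxy : ∀ χ : A →* Eˣ, ev F χ x = ev F χ y) : x = y :=
  sub_eq_zero.1 (eq_zero_of_ev_eq_zero hA fun χ => by rw [map_sub, hxy, sub_self])

open scoped Classical in
/-- The element of the group algebra that evaluates to the indicator function of a set of
characters stable under the square of the twist. -/
theorem exists_indicator {F E A : Type*} [Field F] [Field E] [Algebra F E] [CommGroup A]
    [Finite A] {q : ℕ} [Finite F] (hq : IsPrimePow q) (hF : Nat.card F = q ^ 2)
    (hA : (Nat.card A : E) ≠ 0) (T : Set (A →* Eˣ))
    (hT : ∀ χ, twist q (twist q χ) ∈ T ↔ χ ∈ T) :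
    ∃ e : MonoidAlgebra F A, ∀ χ : A →* Eˣ, ev F χ e = if χ ∈ T then 1 else 0 := by
  have := Fintype.ofFinite A
  have := Fintype.ofFinite (A →* Eˣ)
  obtain ⟨τE, hτE⟩ := exists_frobenius hq hF E
  have hτ2 : ∀ z, z ^ (q ^ 2) = τE (τE z) := fun z => by rw [hτE, hτE, ← pow_mul, ← sq]
  have hbij : Function.Bijective (fun χ : A →* Eˣ => twist q (twist q χ)) := by
    rw [Finite.injective_iff_bijective.symm]
    exact (twist_injective hq hF (F := F)).comp (twist_injective hq hF (F := F))
  -- The inversion formula gives coefficients in `E`. The `q^2`-power map permutes their summands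
  -- because `T` is stable under two twists, so they lie in `F`.
  have hc : ∀ a : A, ∃ c : F, algebraMap F E c =
      (Nat.card A : E)⁻¹ * ∑ χ : A →* Eˣ with χ ∈ T, ((χ a : Eˣ) : E)⁻¹ := by
    intro a
    apply mem_range_algebraMap hq hF
    rw [hτ2, map_mul, map_mul, map_inv₀, map_inv₀, map_natCast, map_natCast]
    congr 1
    rw [map_sum, map_sum]
    refine Finset.sum_bij (fun χ _ => twist q (twist q χ)) ?_ ?_ ?_ ?_
    · intro χ hχ
      simp only [mem_filter, mem_univ, true_and] at hχ ⊢
      exact (hT χ).2 hχ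
    · intro χ _ χ' _ h
      exact hbij.1 h
    · intro χ hχ
      obtain ⟨χ', rfl⟩ := hbij.2 χ
      simp only [mem_filter, mem_univ, true_and] at hχ
      exact ⟨χ', by simpa using (hT χ').1 hχ, rfl⟩
    · intro χ _
      rw [twist_apply, twist_apply, hτE, hτE]
      simp
  choose c hc using hc
  refine ⟨∑ a, MonoidAlgebra.single a (c a), fun χ => ?_⟩
  simp only [map_sum, ev_single, hc]
  have h1 : ∀ a, (Nat.card A : E)⁻¹ * (∑ χ' : A →* Eˣ with χ' ∈ T, ((χ' a : Eˣ) : E)⁻¹) * (χ a : E)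
      = ∑ χ' : A →* Eˣ with χ' ∈ T, (Nat.card A : E)⁻¹ *
        ((Units.coeHom E).comp (χ * χ'⁻¹)) a := by
    intro a
    rw [mul_assoc, Finset.sum_mul, Finset.mul_sum]
    refine Finset.sum_congr rfl fun χ' _ => ?_
    simp [mul_comm]
  simp only [h1]
  rw [Finset.sum_comm]
  simp only [← Finset.mul_sum]
  have h2 : ∀ χ' : A →* Eˣ, ∑ a, ((Units.coeHom E).comp (χ * χ'⁻¹)) a =
      if χ' = χ then (Nat.card A : E) else 0 := by
    intro χ'
    by_cases h : χ' = χ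
    · subst h
      simp [Nat.card_eq_fintype_card]
    · rw [if_neg h]
      refine sum_hom_units_eq_zero _ fun h3 => h ?_
      ext a
      have := DFunLike.congr_fun h3 a
      simp only [MonoidHom.comp_apply, MonoidHom.mul_apply, MonoidHom.inv_apply,
        Units.coeHom_apply, MonoidHom.one_apply, Units.val_eq_one, mul_inv_eq_one] at this
      rw [this]
  simp only [h2]
  rw [Finset.sum_ite_eq']
  by_cases h : χ ∈ T
  · simp only [mem_filter, mem_univ, true_and, h, if_true]
    exact inv_mul_cancel₀ hA
  · simp [h]

/-- The idempotent of the group algebra that belongs to a set of characters stable under the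
square of the twist. -/
structure IsIndicator (F : Type*) {E A : Type*} [Field F] [Field E] [Algebra F E] [CommGroup A]
    (T : Set (A →* Eˣ)) (e : MonoidAlgebra F A) : Prop where
  one : ∀ χ ∈ T, ev F χ e = 1
  zero : ∀ χ ∉ T, ev F χ e = 0

theorem exists_isIndicator {F E A : Type*} [Field F] [Field E] [Algebra F E] [CommGroup A]
    [Finite A] {q : ℕ} [Finite F] (hq : IsPrimePow q) (hF : Nat.card F = q ^ 2)
    (hA : (Nat.card A : E) ≠ 0) (T : Set (A →* Eˣ))
    (hT : ∀ χ, twist q (twist q χ) ∈ T ↔ χ ∈ T) : ∃ e : MonoidAlgebra F A, IsIndicator F T e := by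
  classical
  obtain ⟨e, he⟩ := exists_indicator hq hF hA T hT
  exact ⟨e, fun χ hχ => by rw [he, if_pos hχ], fun χ hχ => by rw [he, if_neg hχ]⟩

theorem IsIndicator.idem (hA : (Nat.card A : E) ≠ 0) {T : Set (A →* Eˣ)} {e : MonoidAlgebra F A}
    (he : IsIndicator F T e) : e * e = e := by
  refine ev_ext hA fun χ => ?_
  rw [map_mul]
  by_cases h : χ ∈ T
  · rw [he.one χ h, one_mul]
  · rw [he.zero χ h, zero_mul]

theorem IsIndicator.mul_eq_zero (hA : (Nat.card A : E) ≠ 0) {T : Set (A →* Eˣ)}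
    {e : MonoidAlgebra F A} (he : IsIndicator F T e) {x : MonoidAlgebra F A}
    (hx : ∀ χ ∈ T, ev F χ x = 0) : e * x = 0 := by
  refine eq_zero_of_ev_eq_zero hA fun χ => ?_
  rw [map_mul]
  by_cases h : χ ∈ T
  · rw [hx χ h, mul_zero]
  · rw [he.zero χ h, zero_mul]

/-- If `T` is a Galois orbit and `e * r ≠ 0`, then `r` is nonzero at every character of `T`. Two
powers of `r` coincide by finiteness, so some positive power of `r` evaluates to `1` on `T`, and the
preceding power is the inverse. -/
theorem IsIndicator.isPrimitive [Finite F] (hq : IsPrimePow q) (hF : Nat.card F = q ^ 2)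
    (hA : (Nat.card A : E) ≠ 0) {T : Set (A →* Eˣ)}
    {e : MonoidAlgebra F A} (he : IsIndicator F T e)
    (hT : ∀ χ ∈ T, ∀ χ' ∈ T, ∃ k, (twist q)^[2 * k] χ = χ') : IsPrimitive e where
  idem := he.idem hA
  inv r hr := by
    obtain ⟨τ, hτ⟩ := exists_frobenius hq hF F
    have h1 : ∀ χ ∈ T, ev F χ r ≠ 0 := by
      intro χ hχ h0
      refine hr (he.mul_eq_zero hA fun χ' hχ' => ?_)
      obtain ⟨k, rfl⟩ := hT χ hχ χ' hχ'
      rw [ev_iterate_twist_even hq hF hτ, h0, zero_pow (pow_ne_zero _ hq.ne_zero)]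
    have : Finite (MonoidAlgebra F A) := finite_monoidAlgebra
    obtain ⟨i, j, hij, hr'⟩ := Finite.exists_ne_map_eq_of_infinite (fun i : ℕ => r ^ i)
    wlog hlt : i < j generalizing i j
    · exact this j i hij.symm hr'.symm (lt_of_le_of_ne (not_lt.1 hlt) hij.symm)
    refine ⟨r ^ (j - i - 1), ?_⟩
    have h2 : e * r * r ^ (j - i - 1) = e * r ^ (j - i) := by
      rw [mul_assoc, ← pow_succ']
      congr 2
      omega
    rw [h2, ← sub_eq_zero, ← mul_sub_one]
    refine he.mul_eq_zero hA fun χ hχ => ?_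
    rw [map_sub, map_pow, map_one, sub_eq_zero]
    have h3 := congrArg (ev F χ) hr'
    simp only [map_pow] at h3
    apply mul_left_cancel₀ (pow_ne_zero i (h1 χ hχ))
    rw [← pow_add, mul_one, h3]
    congr 1
    omega

end Fourier

/-! ### Cycles of a permutation of a finite set -/

section Orbits

variable {α : Type*} [Finite α] {f : α → α} (hf : Function.Injective f)

/-- The equivalence relation whose classes are the cycles of a permutation. -/
def cycleSetoid : Setoid α where
  r x y := ∃ k, f^[k] x = y
  iseqv :=
    { refl := fun x => ⟨0, rfl⟩
      symm := by
        rintro x _ ⟨k, rfl⟩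
        have hx : 0 < Function.minimalPeriod f x :=
          Function.minimalPeriod_pos_of_mem_periodicPts (hf.mem_periodicPts x)
        set m := Function.minimalPeriod f x
        -- A multiple of the period `m` not smaller than `k`, so that the subtraction does not
        -- truncate.
        refine ⟨(k + 1) * m - k, ?_⟩
        have h1 : k ≤ (k + 1) * m := by nlinarith
        rw [← Function.iterate_add_apply, Nat.sub_add_cancel h1, mul_comm]
        exact (Function.isPeriodicPt_minimalPeriod f x).mul_const (k + 1)
      trans := by
        rintro x _ _ ⟨k, rfl⟩ ⟨l, rfl⟩
        exact ⟨l + k, Function.iterate_add_apply _ _ _ _⟩ }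

/-- The cycles of a permutation. -/
def Cycles : Type _ := Quotient (cycleSetoid hf)

/-- The cycle of an element. -/
def cycleOf (x : α) : Cycles hf := Quotient.mk (cycleSetoid hf) x

instance : Finite (Cycles hf) := inferInstanceAs (Finite (Quotient (cycleSetoid hf)))

/-- The length of a cycle. -/
noncomputable def cycleLen (o : Cycles hf) : ℕ := {x | cycleOf hf x = o}.ncard

theorem cycleOf_surjective : Function.Surjective (cycleOf hf) := Quotient.mk_surjective

theorem cycleOf_eq_iff {x y : α} : cycleOf hf x = cycleOf hf y ↔ ∃ k, f^[k] x = y :=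
  Quotient.eq (r := cycleSetoid hf)

theorem cycleOf_apply (x : α) : cycleOf hf (f x) = cycleOf hf x :=
  ((cycleOf_eq_iff hf).2 ⟨1, rfl⟩).symm

theorem minimalPeriod_pos (hf : Function.Injective f) (x : α) :
    0 < Function.minimalPeriod f x :=
  Function.minimalPeriod_pos_of_mem_periodicPts (hf.mem_periodicPts x)

theorem cycleLen_cycleOf (x : α) : cycleLen hf (cycleOf hf x) = Function.minimalPeriod f x := by
  have h1 : {y | cycleOf hf y = cycleOf hf x} =
      (fun k => f^[k] x) '' Set.Iio (Function.minimalPeriod f x) := by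
    ext y
    simp only [Set.mem_ofPred_eq, Set.mem_image, Set.mem_Iio]
    rw [eq_comm, cycleOf_eq_iff]
    constructor
    · rintro ⟨k, rfl⟩
      exact ⟨k % Function.minimalPeriod f x, Nat.mod_lt _ (minimalPeriod_pos hf x),
        Function.iterate_mod_minimalPeriod_eq⟩
    · rintro ⟨k, -, rfl⟩
      exact ⟨k, rfl⟩
  rw [cycleLen, h1, Function.iterate_injOn_Iio_minimalPeriod.ncard_image,
    ← Nat.card_coe_set_eq]
  simp

theorem cycleLen_pos (o : Cycles hf) : 0 < cycleLen hf o := by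
  obtain ⟨x, rfl⟩ := cycleOf_surjective hf o
  rw [cycleLen_cycleOf]
  exact minimalPeriod_pos hf x

/-- A point is fixed by the `k`th iterate exactly if the length of its cycle divides `k`; the fixed
points are counted cycle by cycle. -/
theorem sum_cycleLen_dvd [Fintype (Cycles hf)] (k : ℕ) :
    ∑ o : Cycles hf with cycleLen hf o ∣ k, cycleLen hf o = Nat.card {x // f^[k] x = x} := by
  classical
  have := Fintype.ofFinite α
  rw [Nat.card_eq_fintype_card, Fintype.card_subtype,
    Finset.card_eq_sum_card_fiberwise (f := cycleOf hf)
      (t := univ.filter fun o => cycleLen hf o ∣ k)]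
  · refine Finset.sum_congr rfl fun o ho => ?_
    rw [cycleLen, Set.ncard_eq_toFinset_card']
    congr 1
    ext x
    simp only [Set.mem_toFinset, Set.mem_ofPred_eq, mem_filter, mem_univ, true_and]
    refine ⟨fun h => ⟨?_, h⟩, fun h => h.2⟩
    rw [← h, mem_filter, cycleLen_cycleOf] at ho
    exact Function.isPeriodicPt_iff_minimalPeriod_dvd.2 ho.2
  · intro x hx
    simp only [coe_filter, mem_univ, true_and, Set.mem_ofPred_eq] at hx ⊢
    rw [cycleLen_cycleOf]
    exact Function.isPeriodicPt_iff_minimalPeriod_dvd.1 hx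

end Orbits

/-! ### Dimensions of the components -/

section Dimension

variable {F E A : Type*} [Field F] [Finite F] [Field E] [Algebra F E] [CommGroup A] [Finite A]
  {q : ℕ} [IsAlgClosed E]

theorem finrank_monoidAlgebra {F A : Type*} [Field F] [Finite F] [Finite A] :
    Module.finrank F (MonoidAlgebra F A) = Nat.card A := by
  have : Finite (MonoidAlgebra F A) := finite_monoidAlgebra
  have h1 : Nat.card (MonoidAlgebra F A) = Nat.card F ^ Nat.card A := by
    have := Fintype.ofFinite A
    rw [Nat.card_congr (MonoidAlgebra.coeffEquiv.trans Finsupp.equivFunOnFinite), Nat.card_fun,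
      Nat.card_eq_fintype_card (α := A)]
  rw [Module.natCard_eq_pow_finrank (K := F)] at h1
  exact Nat.pow_right_injective Finite.one_lt_card h1

/-- Distinct algebra homomorphisms are linearly independent. A relation among those in `T` that
holds on `eR` holds on all of `R`, because they do not change when the argument is multiplied by
`e`. -/
theorem IsIndicator.ncard_le_finrank {T : Set (A →* Eˣ)} {e : MonoidAlgebra F A}
    (he : IsIndicator F T e) (hA : (Nat.card A : E) ≠ 0) :
    T.ncard ≤ Module.finrank F (part (MonoidAlgebra F A) e) := by
  have : Finite (MonoidAlgebra F A) := finite_monoidAlgebra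
  have := Fintype.ofFinite T
  have hlin : LinearIndependent E (fun χ : T =>
      ((ev F χ.1).toLinearMap ∘ₗ ((part (MonoidAlgebra F A) e).restrictScalars F).subtype)) := by
    have h1 := (linearIndependent_algHom_toLinearMap F (MonoidAlgebra F A) E).comp
      (fun χ : T => ev F χ.1) (fun χ χ' h => Subtype.ext (ev_injective h))
    rw [Fintype.linearIndependent_iff] at h1 ⊢
    intro g hg
    apply h1 g
    refine LinearMap.ext fun x => ?_
    have h2 := LinearMap.congr_fun hg ⟨e * x, smul_mem_part (he.idem hA) x⟩
    simp only [LinearMap.sum_apply, LinearMap.smul_apply, LinearMap.zero_apply] at h2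
    simp only [LinearMap.sum_apply, LinearMap.smul_apply, LinearMap.zero_apply]
    rw [← h2]
    refine Finset.sum_congr rfl fun χ _ => ?_
    have h3 : ev F χ.1 (e * x) = ev F χ.1 x := by rw [map_mul, he.one χ χ.2, one_mul]
    exact congrArg (g χ • ·) h3.symm
  have h2 := hlin.fintype_card_le_finrank
  rw [Module.finrank_linearMap_self] at h2
  rw [← Nat.card_coe_set_eq, Nat.card_eq_fintype_card]
  exact h2

/-- The lower bounds for `T` and its complement add up to `|A|`, the dimension of the whole algebra,
so both are equalities. -/
theorem IsIndicator.finrank_eq {T : Set (A →* Eˣ)} {e : MonoidAlgebra F A}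
    (he : IsIndicator F T e) (hA : (Nat.card A : E) ≠ 0) :
    Module.finrank F (part (MonoidAlgebra F A) e) = T.ncard := by
  have : Finite (MonoidAlgebra F A) := finite_monoidAlgebra
  have hc : IsIndicator F Tᶜ (1 - e) :=
    ⟨fun χ hχ => by rw [map_sub, map_one, he.zero χ hχ, sub_zero],
      fun χ hχ => by rw [map_sub, map_one, he.one χ (not_not.1 hχ), sub_self]⟩
  have h1 := he.ncard_le_finrank hA
  have h2 := hc.ncard_le_finrank hA
  have h3 := Set.ncard_add_ncard_compl T
  rw [natCard_dual_group hA, ← finrank_monoidAlgebra (F := F)] at h3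
  have hcompl : IsCompl ((part (MonoidAlgebra F A) e).restrictScalars F)
      ((part (MonoidAlgebra F A) (1 - e)).restrictScalars F) := by
    constructor
    · rw [Submodule.disjoint_def]
      intro x hx hx'
      have : x ∈ part (MonoidAlgebra F A) e ⊓ part (MonoidAlgebra F A) (1 - e) := ⟨hx, hx'⟩
      rwa [part_inf_part_one_sub, Submodule.mem_bot] at this
    · rw [codisjoint_iff, eq_top_iff]
      intro x _
      refine Submodule.mem_sup.2 ⟨e * x, smul_mem_part (he.idem hA) x, (1 - e) * x,
        smul_mem_part (one_sub_idem (he.idem hA)) x, by ring⟩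
  have h4 := Submodule.finrank_add_eq_of_isCompl hcompl
  have h5 : Module.finrank F ((part (MonoidAlgebra F A) e).restrictScalars F) =
    Module.finrank F (part (MonoidAlgebra F A) e) := rfl
  have h6 : Module.finrank F ((part (MonoidAlgebra F A) (1 - e)).restrictScalars F) =
    Module.finrank F (part (MonoidAlgebra F A) (1 - e)) := rfl
  omega

end Dimension

/-! ### Cycles of the twist and components of the group algebra -/

section Decomposition

variable {F E A : Type*} [Field F] [Finite F] [Field E] [Algebra F E] [CommGroup A] [Finite A]
  {q : ℕ} [IsAlgClosed E]

theorem IsIndicator.conj {F E A : Type*} [Field F] [Finite F] [Field E] [Algebra F E]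
    [CommGroup A] [Finite A] {q : ℕ} (hq : IsPrimePow q) (hF : Nat.card F = q ^ 2) {τ : F →+* F}
    (hτ : ∀ a, τ a = a ^ q) {T T' : Set (A →* Eˣ)} (hT : ∀ χ, twist q χ ∈ T' ↔ χ ∈ T)
    {e : MonoidAlgebra F A} (he : IsIndicator F T e) : IsIndicator F T' (conj τ e) := by
  have hsurj : Function.Surjective (twist q : (A →* Eˣ) → A →* Eˣ) :=
    Finite.surjective_of_injective (twist_injective hq hF (F := F))
  constructor
  · intro χ hχ
    obtain ⟨χ, rfl⟩ := hsurj χ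
    rw [ev_twist_conj hq hF hτ, he.one χ ((hT χ).1 hχ), one_pow]
  · intro χ hχ
    obtain ⟨χ, rfl⟩ := hsurj χ
    rw [ev_twist_conj hq hF hτ, he.zero χ (fun h => hχ ((hT χ).2 h)), zero_pow hq.ne_zero]

theorem IsIndicator.unique {F E A : Type*} [Field F] [Field E] [Algebra F E] [CommGroup A]
    [Finite A] [IsAlgClosed E] (hA : (Nat.card A : E) ≠ 0) {T : Set (A →* Eˣ)}
    {e e' : MonoidAlgebra F A} (he : IsIndicator F T e) (he' : IsIndicator F T e') : e = e' := by
  refine ev_ext hA fun χ => ?_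
  by_cases h : χ ∈ T
  · rw [he.one χ h, he'.one χ h]
  · rw [he.zero χ h, he'.zero χ h]

/-- The idempotents of the group algebra that belong to the cycles of the twist. -/
theorem isDecomposition_of_isIndicator (hq : IsPrimePow q) (hF : Nat.card F = q ^ 2) {τ : F →+* F}
    (hτ : ∀ a, τ a = a ^ q) (hA : (Nat.card A : E) ≠ 0)
    (hf : Function.Injective (twist q : (A →* Eˣ) → A →* Eˣ)) [Fintype (Cycles hf)]
    {e : Cycles hf → MonoidAlgebra F A} (he : ∀ o, IsIndicator F {χ | cycleOf hf χ = o} (e o)) :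
    IsDecomposition (conj τ) e (fun o => (-1) ^ (cycleLen hf o + 1)) where
  orth o o' hne := (he o).mul_eq_zero hA fun χ hχ => (he o').zero χ fun h => hne (by
    rw [Set.mem_ofPred_eq] at h hχ
    rw [← h, ← hχ])
  sum := by
    classical
    refine ev_ext (E := E) hA fun χ => ?_
    rw [map_sum, Finset.sum_eq_single_of_mem (cycleOf hf χ) (mem_univ _), (he _).one χ rfl, map_one]
    intro o _ ho
    exact (he o).zero χ fun h => ho h.symm
  fixed o := by
    refine ((he o).conj hq hF hτ fun χ => ?_).unique hA (he o)
    simp only [Set.mem_ofPred_eq, cycleOf_apply]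
  kind o := by
    have hinv := isInvolution_conj (A := A) hq hF hτ
    obtain ⟨χ₀, rfl⟩ := cycleOf_surjective hf o
    have hper := Function.isPeriodicPt_minimalPeriod (twist q : (A →* Eˣ) → A →* Eˣ) χ₀
    -- A cycle of even length splits into two Galois orbits exchanged by the twist; a cycle of odd
    -- length is a single Galois orbit.
    rcases Nat.even_or_odd (cycleLen hf (cycleOf hf χ₀)) with hev | hodd
    · right
      refine ⟨hev.add_one.neg_one_pow, ?_⟩
      rw [cycleLen_cycleOf] at hev
      set T : Set (A →* Eˣ) := {χ | ∃ k, (twist q)^[2 * k] χ₀ = χ} with hT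
      obtain ⟨m, hm⟩ := hev
      have hmpos := minimalPeriod_pos hf χ₀
      have hback : ∀ k, (twist q)^[2 * k + 1] χ₀ ∉ T := by
        rintro k ⟨l, hl⟩
        -- Applying `2l(2m - 1)` further twists to the `2l`th iterate gives a multiple of the period
        -- `2m`. Reached from an odd iterate, this makes an odd number divisible by the even period.
        have h1 : (twist q)^[(2 * k + 1) + (2 * l) * (2 * m - 1)] χ₀ = χ₀ := by
          rw [add_comm, Function.iterate_add_apply, ← hl, ← Function.iterate_add_apply]
          have h2 : 2 * l * (2 * m - 1) + 2 * l = (m + m) * (2 * l) := by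
            obtain ⟨m', rfl⟩ : ∃ m', m = m' + 1 := ⟨m - 1, by omega⟩
            have : 2 * (m' + 1) - 1 = 2 * m' + 1 := by omega
            rw [this]
            ring
          rw [h2, ← hm]
          exact hper.mul_const _
        have h2 := Function.isPeriodicPt_iff_minimalPeriod_dvd.1 h1
        rw [hm] at h2
        have h3 : 2 ∣ (2 * k + 1) + (2 * l) * (2 * m - 1) := (Dvd.intro m (by ring)).trans h2
        rw [mul_assoc] at h3
        omega
      have hstep : ∀ χ, twist q (twist q χ) ∈ T ↔ χ ∈ T := by
        intro χ
        constructor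
        · rintro ⟨k, hk⟩
          refine ⟨k + (m - 1), hf (hf ?_)⟩
          rw [← hk, ← Function.iterate_succ_apply' (twist q), ← Function.iterate_succ_apply' (twist q)]
          have h2 : (2 * (k + (m - 1))).succ.succ = 2 * k + (m + m) := by omega
          rw [h2, Function.iterate_add_apply, ← hm, hper.eq]
        · rintro ⟨k, rfl⟩
          refine ⟨k + 1, ?_⟩
          rw [← Function.iterate_succ_apply' (twist q), ← Function.iterate_succ_apply' (twist q)]
          rfl
      obtain ⟨f, hfT⟩ := exists_isIndicator (F := F) hq hF hA T hstep
      -- The other half of the cycle. Its idempotent is the conjugate of that of `T`, so the two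
      -- primitive idempotents are orthogonal and add up to that of the cycle.
      set T' : Set (A →* Eˣ) := {χ | twist q χ ∈ T} with hT'
      have hfT' : IsIndicator F T' (conj τ f) := hfT.conj hq hF hτ fun χ => hstep χ
      have hdisj : ∀ χ ∈ T, χ ∉ T' := by
        rintro _ ⟨k, rfl⟩ h
        refine hback k ?_
        rw [hT', Set.mem_ofPred_eq, ← Function.iterate_succ_apply' (twist q)] at h
        exact h
      refine ⟨f, hfT.isPrimitive hq hF hA ?_, hfT.mul_eq_zero hA fun χ hχ =>
        hfT'.zero χ (hdisj χ hχ), ?_⟩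
      · rintro _ ⟨k, rfl⟩ _ ⟨l, rfl⟩
        refine ⟨l + k * (2 * m - 1), ?_⟩
        rw [← Function.iterate_add_apply]
        have h2 : 2 * (l + k * (2 * m - 1)) + 2 * k = 2 * l + (m + m) * (2 * k) := by
          obtain ⟨m', rfl⟩ : ∃ m', m = m' + 1 := ⟨m - 1, by omega⟩
          have : 2 * (m' + 1) - 1 = 2 * m' + 1 := by omega
          rw [this]
          ring
        rw [h2, Function.iterate_add_apply, ← hm, (hper.mul_const _).eq]
      · refine ev_ext hA fun χ => ?_
        rw [map_add]
        by_cases hχ : cycleOf hf χ = cycleOf hf χ₀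
        · rw [(he _).one χ hχ]
          rw [eq_comm, cycleOf_eq_iff] at hχ
          obtain ⟨k, rfl⟩ := hχ
          obtain ⟨l, rfl | rfl⟩ := Nat.even_or_odd' k
          · have h1 : (twist q)^[2 * l] χ₀ ∈ T := ⟨l, rfl⟩
            rw [hfT.one _ h1, hfT'.zero _ (hdisj _ h1), add_zero]
          · have h1 : (twist q)^[2 * l + 1] χ₀ ∈ T' := by
              rw [hT', Set.mem_ofPred_eq, ← Function.iterate_succ_apply' (twist q)]
              exact ⟨l + 1, by congr 1⟩
            rw [hfT.zero _ (hback l), hfT'.one _ h1, zero_add]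
        · rw [(he _).zero χ hχ, hfT.zero, hfT'.zero, add_zero]
          · rintro ⟨k, hk⟩
            apply hχ
            rw [← cycleOf_apply, ← hk]
            exact ((cycleOf_eq_iff hf).2 ⟨_, rfl⟩).symm
          · rintro ⟨k, rfl⟩
            exact hχ ((cycleOf_eq_iff hf).2 ⟨_, rfl⟩).symm
    · left
      refine ⟨hodd.add_one.neg_one_pow, (he _).isPrimitive hq hF hA ?_⟩
      rw [cycleLen_cycleOf] at hodd
      intro χ hχ χ' hχ'
      have hχ'' : cycleOf hf χ = cycleOf hf χ' := by
        rw [Set.mem_ofPred_eq] at hχ hχ'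
        rw [hχ, hχ']
      have hd : Function.minimalPeriod (twist q) χ = Function.minimalPeriod (twist q) χ₀ := by
        rw [← cycleLen_cycleOf hf, ← cycleLen_cycleOf hf, hχ]
      have hper := Function.isPeriodicPt_minimalPeriod (twist q : (A →* Eˣ) → A →* Eˣ) χ
      obtain ⟨k, rfl⟩ := (cycleOf_eq_iff hf).1 hχ''
      obtain ⟨l, rfl | rfl⟩ := Nat.even_or_odd' k
      · exact ⟨l, rfl⟩
      · obtain ⟨m, hm⟩ := hodd
        -- An odd number of steps becomes even when the odd period `2m + 1` is added.
        refine ⟨l + m + 1, ?_⟩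
        have h2 : 2 * (l + m + 1) = (2 * l + 1) + (2 * m + 1) := by ring
        rw [h2, Function.iterate_add_apply, ← hm, ← hd, hper.eq]

end Decomposition

/-! ### Symmetric elements of the group algebra are norms -/

section Norms

variable {F E A : Type*} [Field F] [Finite F] [Field E] [Algebra F E] [CommGroup A] [Finite A]
  {q : ℕ} [IsAlgClosed E]

/-- For an odd cycle of length `d`, evaluation at `χ₀` identifies `eR` with the field of order
`q^(2d)`, on which the involution is the `q^d`-power map. The norm of the quadratic extension of
fields of orders `q^(2d)` and `q^d` is surjective. -/
theorem exists_norm_of_odd (hq : IsPrimePow q) (hF : Nat.card F = q ^ 2) {τ : F →+* F}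
    (hτ : ∀ a, τ a = a ^ q) (hA : (Nat.card A : E) ≠ 0)
    (hf : Function.Injective (twist q : (A →* Eˣ) → A →* Eˣ)) {χ₀ : A →* Eˣ}
    (hodd : Odd (cycleLen hf (cycleOf hf χ₀))) {e : MonoidAlgebra F A}
    (he : IsIndicator F {χ | cycleOf hf χ = cycleOf hf χ₀} e) (hprim : IsPrimitive e)
    {u : MonoidAlgebra F A} (hu : conj τ u = u) :
    ∃ v, e * (v * conj τ v) = e * u := by
  have : Finite (MonoidAlgebra F A) := finite_monoidAlgebra
  have hinv := isInvolution_conj (A := A) hq hF hτ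
  set d := cycleLen hf (cycleOf hf χ₀) with hd
  have hconj : ∀ x, ev F χ₀ (conj τ x) = ev F χ₀ x ^ (q ^ d) := by
    intro x
    rw [← ev_iterate_twist_conj hq hF hτ d]
    have h1 : (twist q)^[d] χ₀ = χ₀ := by
      rw [hd, cycleLen_cycleOf]
      exact Function.isPeriodicPt_minimalPeriod _ _
    rw [h1]
    obtain ⟨k, hk⟩ := hodd
    have h2 : (conj τ : MonoidAlgebra F A →+* _)^[2] = id := funext hinv.invol
    rw [hk, Function.iterate_add_apply, Function.iterate_one, Function.iterate_mul, h2,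
      Function.iterate_id, id]
  have hz : ∀ x, ev F χ₀ x = 0 → e * x = 0 := by
    intro x hx
    by_contra h0
    obtain ⟨s, hs⟩ := hprim.inv x h0
    have h1 := congrArg (ev F χ₀) hs
    rw [map_mul, map_mul, hx, he.one χ₀ rfl, mul_zero, zero_mul] at h1
    exact zero_ne_one h1
  have hQ : 1 < q ^ d := one_lt_pow₀ hq.one_lt (cycleLen_pos hf _).ne'
  obtain ⟨t, ht, ht'⟩ := exists_norm_eq (by omega : 0 < q ^ d)
    (w := ev F χ₀ u) (by rw [← hconj, hu])
  -- The image of `eR` has `(q^2)^d` elements, so it contains every solution of `t^(q^d * q^d) = t`.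
  have hmem : t ∈ ev F χ₀ '' (part (MonoidAlgebra F A) e) := by
    refine mem_of_pow_eq_self (Q := q ^ d * q ^ d) (by nlinarith) ?_ ?_ ht'
    · rintro _ ⟨x, -, rfl⟩
      rw [pow_mul, ← hconj, ← hconj, hinv.invol]
    · rw [Set.InjOn.ncard_image]
      · have h1 := Module.natCard_eq_pow_finrank (K := F) (V := part (MonoidAlgebra F A) e)
        rw [he.finrank_eq hA, hF] at h1
        change _ ≤ Nat.card (part (MonoidAlgebra F A) e)
        rw [h1]
        refine le_of_eq ?_
        change _ = (q ^ 2) ^ d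
        ring
      · intro x hx y hy hxy
        have h1 := hz (x - y) (by rw [map_sub, hxy, sub_self])
        rw [SetLike.mem_coe, mem_part, smul_eq_mul] at hx hy
        rw [mul_sub, hx, hy] at h1
        exact sub_eq_zero.1 h1
  obtain ⟨v, -, rfl⟩ := hmem
  refine ⟨v, ?_⟩
  rw [← sub_eq_zero, ← mul_sub]
  refine hz _ ?_
  rw [map_sub, map_mul, hconj, ht, sub_self]

/-- The symmetric elements of the group algebra are norms. -/
theorem exists_norm_groupAlgebra (hq : IsPrimePow q) (hF : Nat.card F = q ^ 2) {τ : F →+* F}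
    (hτ : ∀ a, τ a = a ^ q) (hA : (Nat.card A : E) ≠ 0)
    (hf : Function.Injective (twist q : (A →* Eˣ) → A →* Eˣ)) [Fintype (Cycles hf)]
    {e : Cycles hf → MonoidAlgebra F A} (he : ∀ o, IsIndicator F {χ | cycleOf hf χ = o} (e o))
    {u : MonoidAlgebra F A} (hu : conj τ u = u) : ∃ v, v * conj τ v = u := by
  classical
  have hd := isDecomposition_of_isIndicator hq hF hτ hA hf he
  have hinv := isInvolution_conj (A := A) hq hF hτ
  have hcomp : ∀ o, ∃ v, e o * (v * conj τ v) = e o * u := by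
    intro o
    obtain ⟨χ₀, rfl⟩ := cycleOf_surjective hf o
    rcases hd.kind (cycleOf hf χ₀) with ⟨hs, hp⟩ | ⟨-, f, hfp, hff, hfe⟩
    · refine exists_norm_of_odd hq hF hτ hA hf ?_ (he _) hp hu
      by_contra hev
      rw [Nat.not_odd_iff_even] at hev
      rw [hev.add_one.neg_one_pow] at hs
      exact absurd hs (by decide)
    -- On a hyperbolic pair the involution exchanges two factors, and `u` on one factor with `1` on
    -- the other has norm `u`.
    · refine ⟨f * u + conj τ f, ?_⟩
      have h1 := congrArg (conj τ) hfp.idem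
      rw [map_mul] at h1
      rw [← hfe, map_add, map_mul, hu, hinv.invol]
      have h2 := hfp.idem
      generalize conj τ f = g at *
      linear_combination ((f + g) * (u ^ 2 + 1) + 2 * u) * hff + ((f + g) * u + u) * h2 +
        ((f + g) * u + u) * h1
  choose v hv using hcomp
  refine ⟨∑ o, e o * v o, ?_⟩
  rw [map_sum, Finset.sum_mul]
  have h1 : ∀ o, e o * v o * ∑ o', conj τ (e o' * v o') = e o * u := by
    intro o
    rw [Finset.mul_sum, Finset.sum_eq_single_of_mem o (mem_univ o), map_mul, hd.fixed, ← hv o]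
    · linear_combination (v o * conj τ (v o)) * hd.idem o
    · intro o' _ ho
      rw [map_mul, hd.fixed]
      linear_combination (v o * conj τ (v o')) * hd.orth o o' ho.symm
  simp only [h1]
  rw [← Finset.sum_mul, hd.sum, one_mul]

theorem IsIndicator.ne_zero {F E A : Type*} [Field F] [Field E] [Algebra F E] [CommGroup A]
    {T : Set (A →* Eˣ)} {e : MonoidAlgebra F A} (he : IsIndicator F T e) {χ : A →* Eˣ}
    (hχ : χ ∈ T) : e ≠ 0 := by
  rintro rfl
  have := he.one χ hχ
  rw [map_zero] at this
  exact zero_ne_one this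

end Norms

/-! ### A Hermitian form on the group algebra -/

section TraceForm

variable {F A : Type*} [Field F] [CommGroup A]

/-- The form on a group algebra given by the coefficient of the identity in `x * conj y`. -/
noncomputable def traceForm (τ : F →+* F) (x y : MonoidAlgebra F A) : F :=
  (x * conj τ y).coeff 1

theorem coeff_conj (τ : F →+* F) (x : MonoidAlgebra F A) :
    (conj τ x).coeff 1 = τ (x.coeff 1) := by
  classical
  induction x using MonoidAlgebra.induction_linear with
  | zero => simp
  | add f g hf hg => simp [hf, hg]
  | single a c =>
    rw [conj_single, MonoidAlgebra.coeff_single, MonoidAlgebra.coeff_single,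
      Finsupp.single_apply, Finsupp.single_apply, inv_eq_one]
    split_ifs <;> simp

theorem isHermitian_traceForm [Finite F] {q : ℕ} (hq : IsPrimePow q) (hF : Nat.card F = q ^ 2)
    {τ : F →+* F} (hτ : ∀ a, τ a = a ^ q) :
    IsHermitian (R := MonoidAlgebra F A) τ (conj τ)
      (traceForm τ : MonoidAlgebra F A → MonoidAlgebra F A → F) where
  add_left x y z := by simp [traceForm, add_mul]
  smul_left a x y := by simp [traceForm]
  symm x y := by
    rw [traceForm, traceForm, ← coeff_conj, map_mul, (isInvolution_conj hq hF hτ).invol, mul_comm]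
  adj r x y := by
    rw [traceForm, traceForm, smul_eq_mul, smul_eq_mul, map_mul,
      (isInvolution_conj hq hF hτ).invol]
    congr 2
    ring
  nondeg x hx := by
    ext a
    have h1 := hx (MonoidAlgebra.single a 1)
    rw [traceForm, conj_single, map_one τ] at h1
    have h2 := MonoidAlgebra.coeff_mul_single_apply x (1 : F) a⁻¹ 1
    rw [h1] at h2
    simpa using h2.symm

/-- This provides a Hermitian module for every set of components: a summand cut out by a symmetric
idempotent is an orthogonal summand, so the trace form stays nondegenerate on it. -/
theorem isHermitian_traceForm_part [Finite F] {q : ℕ} (hq : IsPrimePow q)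
    (hF : Nat.card F = q ^ 2) {τ : F →+* F} (hτ : ∀ a, τ a = a ^ q) {e : MonoidAlgebra F A}
    (he : e * e = e) (hσ : conj τ e = e) :
    IsHermitian (R := MonoidAlgebra F A) τ (conj τ)
      (fun x y : part (MonoidAlgebra F A) e => traceForm τ x.1 y.1) := by
  have hh := isHermitian_traceForm (A := A) hq hF hτ
  refine hh.restrict _ (fun _ _ => rfl) fun x hx h0 => hh.nondeg x fun y => ?_
  rw [mem_part] at hx
  rw [← hx, hh.adj, hσ]
  exact h0 _ (smul_mem_part he y)

end TraceForm

/-! ### Orthonormal bases and classification of Hermitian spaces -/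

section Orthonormal

variable {F V V' : Type*} [Field F] [AddCommGroup V] [Module F V] [AddCommGroup V']
  [Module F V'] {τ : F →+* F} {h : V → V → F} {h' : V' → V' → F}

theorem IsHermitian.sum_left {R : Type*} [CommRing R] [Algebra F R] [Module R V] {σ : R →+* R}
    (hh : IsHermitian τ σ h) {ι : Type*} (s : Finset ι) (f : ι → V) (y : V) :
    h (∑ i ∈ s, f i) y = ∑ i ∈ s, h (f i) y :=
  map_sum ({ toFun := fun x => h x y, map_zero' := hh.zero_left y,
             map_add' := fun a b => hh.add_left a b y } : V →+ F) f s

theorem IsHermitian.sum_right {R : Type*} [CommRing R] [Algebra F R] [Module R V] {σ : R →+* R}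
    (hh : IsHermitian τ σ h) {ι : Type*} (s : Finset ι) (f : ι → V) (y : V) :
    h y (∑ i ∈ s, f i) = ∑ i ∈ s, h y (f i) := by
  rw [hh.symm, hh.sum_left, map_sum]
  exact Finset.sum_congr rfl fun i _ => (hh.symm _ _).symm

/-- A family of vectors of length one that are pairwise orthogonal. -/
def IsOrthonormal {ι : Type*} [DecidableEq ι] (h : V → V → F) (b : ι → V) : Prop :=
  ∀ i j, h (b i) (b j) = if i = j then 1 else 0

theorem IsOrthonormal.apply_sum (hh : IsHermitian τ τ h) {ι : Type*} [Fintype ι] [DecidableEq ι]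
    {b : ι → V} (hb : IsOrthonormal h b) (a : ι → F) (j : ι) : h (∑ i, a i • b i) (b j) = a j := by
  rw [hh.sum_left]
  simp [hh.smul_left, hb _ _]

theorem IsOrthonormal.linearIndependent (hh : IsHermitian τ τ h) {ι : Type*} [Fintype ι]
    [DecidableEq ι] {b : ι → V} (hb : IsOrthonormal h b) : LinearIndependent F b := by
  rw [Fintype.linearIndependent_iff]
  intro g hg i
  rw [← hb.apply_sum hh g i, hg, hh.zero_left]

/-- If all vectors of `K` were isotropic, then so would be `(l / h x y) x + y`, but its length is `l
+ τ l = 1`. A vector of nonzero length is rescaled, its length being a norm. -/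
theorem exists_apply_self_eq_one (hh : IsHermitian τ τ h) (htr : ∃ l, l + τ l = 1)
    (hN : ∀ w, τ w = w → ∃ t, t * τ t = w) (K : Submodule F V)
    (hK : ∃ x ∈ K, ∃ y ∈ K, h x y ≠ 0) : ∃ v ∈ K, h v v = 1 := by
  have h1 : ∃ v ∈ K, h v v ≠ 0 := by
    by_contra! h0
    obtain ⟨x, hx, y, hy, hxy⟩ := hK
    obtain ⟨l, hl⟩ := htr
    have h2 := h0 _ (K.add_mem (K.smul_mem (l / h x y) hx) hy)
    rw [hh.add_left, hh.add_right, hh.add_right, h0 _ (K.smul_mem _ hx), h0 y hy, hh.symm _ y,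
      hh.smul_left, div_mul_cancel₀ _ hxy, zero_add, add_zero, hl] at h2
    exact one_ne_zero h2
  obtain ⟨v, hv, hv0⟩ := h1
  obtain ⟨t, ht⟩ := hN (h v v) (hh.symm v v).symm
  have ht0 : t ≠ 0 := by
    rintro rfl
    exact hv0 (by rw [← ht, zero_mul])
  refine ⟨t⁻¹ • v, K.smul_mem _ hv, ?_⟩
  rw [hh.smul_left, hh.smul_right, ← ht, map_inv₀]
  have ht1 : τ t ≠ 0 := (map_ne_zero τ).2 ht0
  field_simp

theorem exists_isOrthonormal [Module.Finite F V] (hh : IsHermitian τ τ h)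
    (htr : ∃ l, l + τ l = 1) (hN : ∀ w, τ w = w → ∃ t, t * τ t = w) {k : ℕ}
    (hk : k ≤ Module.finrank F V) : ∃ b : Fin k → V, IsOrthonormal h b := by
  induction k with
  | zero => exact ⟨Fin.elim0, fun i => i.elim0⟩
  | succ k ih =>
    obtain ⟨b, hb⟩ := ih (by omega)
    let f : V →ₗ[F] (Fin k → F) :=
      { toFun := fun x i => h x (b i)
        map_add' := fun x y => funext fun i => hh.add_left x y _
        map_smul' := fun a x => funext fun i => hh.smul_left a x _ }
    have hf : ∀ x ∈ LinearMap.ker f, ∀ i, h x (b i) = 0 := fun x hx i =>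
      congrFun (LinearMap.mem_ker.1 hx) i
    -- The common orthogonal space of the vectors found so far is nonzero for dimension reasons.
    have hker : LinearMap.ker f ≠ ⊥ := LinearMap.ker_ne_bot_of_finrank_lt (by simpa using hk)
    obtain ⟨x, hx, hx0⟩ := (Submodule.ne_bot_iff _).1 hker
    -- The form does not vanish on this space: a vector of it orthogonal to the whole space would,
    -- after subtraction of projections to the `b i`, be orthogonal to all of `V`.
    have hpair : ∃ x ∈ LinearMap.ker f, ∃ y ∈ LinearMap.ker f, h x y ≠ 0 := by
      refine ⟨x, hx, ?_⟩
      by_contra! h0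
      refine hx0 (hh.nondeg x fun y => ?_)
      have h1 := h0 (y - ∑ i, h y (b i) • b i) (LinearMap.mem_ker.2 (funext fun j => by
        change h _ _ = 0
        rw [hh.sub_left, hb.apply_sum hh, sub_self]))
      rw [hh.sub_right, hh.sum_right, Finset.sum_eq_zero, sub_zero] at h1
      · exact h1
      · intro i _
        rw [hh.smul_right, hf x hx, mul_zero]
    obtain ⟨v, hv, hv1⟩ := exists_apply_self_eq_one hh htr hN _ hpair
    refine ⟨Fin.cons v b, fun i j => ?_⟩
    refine Fin.cases ?_ (fun i => ?_) i <;> refine Fin.cases ?_ (fun j => ?_) j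
    · simpa using hv1
    · simpa [(Fin.succ_ne_zero j).symm] using hf v hv j
    · simpa using hh.eq_zero_symm (hf v hv i)
    · simpa using hb i j

/-- Hermitian spaces of the same dimension are isometric. -/
theorem exists_isometry_of_finrank_eq [Module.Finite F V] [Module.Finite F V']
    (hh : IsHermitian τ τ h) (hh' : IsHermitian τ τ h')
    (htr : ∃ l, l + τ l = 1) (hN : ∀ w, τ w = w → ∃ t, t * τ t = w)
    (hdim : Module.finrank F V = Module.finrank F V') :
    ∃ φ : V ≃ₗ[F] V', ∀ x y, h' (φ x) (φ y) = h x y := by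
  obtain ⟨b, hb⟩ := exists_isOrthonormal hh htr hN le_rfl
  obtain ⟨b', hb'⟩ := exists_isOrthonormal hh' htr hN hdim.le
  let B := basisOfLinearIndependentOfCardEqFinrank' b (hb.linearIndependent hh) (by simp)
  let B' := basisOfLinearIndependentOfCardEqFinrank' b' (hb'.linearIndependent hh') (by simp [hdim])
  refine ⟨B.equiv B' (Equiv.refl _), fun x y => ?_⟩
  have hB : ∀ i, B i = b i := fun i => by simp [B]
  have hB' : ∀ i, B' i = b' i := fun i => by simp [B']
  have hφ : ∀ z : V, B.equiv B' (Equiv.refl _) z = ∑ i, B.repr z i • b' i := by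
    intro z
    conv_lhs => rw [← B.sum_repr z, map_sum]
    exact Finset.sum_congr rfl fun i _ => by
      rw [map_smul, Module.Basis.equiv_apply, Equiv.refl_apply, hB']
  have hz : ∀ z : V, z = ∑ i, B.repr z i • b i := by
    intro z
    conv_lhs => rw [← B.sum_repr z]
    simp [hB]
  rw [hφ y, hh'.sum_right]
  conv_rhs => rw [hz y, hh.sum_right]
  refine Finset.sum_congr rfl fun i _ => ?_
  rw [hh.smul_right, hh'.smul_right, hφ x, hb'.apply_sum hh']
  conv_rhs => rw [hz x, hb.apply_sum hh]

end Orthonormal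

/-! ### The standard form is Hermitian -/

section StandardForm

variable {F : Type*} [Field F] {q : ℕ}

theorem isHermitian_form [Finite F] (hq : IsPrimePow q) (hF : Nat.card F = q ^ 2) {τ : F →+* F}
    (hτ : ∀ a, τ a = a ^ q) {n : ℕ} {c : F} (hc : c ^ (q - 1) = (-1) ^ (n + 1)) :
    IsHermitian τ τ (form q c : (Fin n → F) → (Fin n → F) → F) where
  add_left x y z := by
    simp only [form, Pi.add_apply, mul_add, add_mul, Finset.sum_add_distrib]
  smul_left a x y := by
    simp only [form, Pi.smul_apply, smul_eq_mul, Finset.mul_sum]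
    exact Finset.sum_congr rfl fun i _ => by ring
  symm x y := by
    -- This sign compensates the one by which `(-1)^i` changes under reversal of the coordinates.
    have hcq : τ c = c * (-1) ^ (n + 1) := by
      rw [hτ, ← hc, ← pow_succ', Nat.sub_add_cancel hq.pos]
    rw [form, form, map_mul, map_sum, hcq, mul_assoc, Finset.mul_sum, Finset.mul_sum,
      Finset.mul_sum, ← Equiv.sum_comp Fin.revPerm]
    refine Finset.sum_congr rfl fun i _ => ?_
    have h1 : τ (τ (y (Fin.rev i))) = y (Fin.rev i) := by
      rw [hτ, hτ, ← pow_mul, ← sq, pow_sq_eq hF]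
    rw [Fin.revPerm_apply, Fin.rev_rev, map_mul, map_mul, map_pow, map_neg, map_one,
      ← hτ, ← hτ, h1, Fin.val_rev]
    have h2 : (-1 : F) ^ (n - (↑i + 1)) = (-1) ^ (n + 1) * (-1) ^ (i : ℕ) := by
      obtain ⟨k, hk⟩ : ∃ k, n = k + ((i : ℕ) + 1) := ⟨n - (i + 1), by omega⟩
      have h3 : n - (↑i + 1) = k := by omega
      rw [h3, ← pow_add, show n + 1 + (i : ℕ) = k + 2 * (i + 1) by omega, pow_add, pow_mul]
      simp
    rw [h2]
    ring
  adj r x y := by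
    have h1 : ∀ a : F, τ (τ a) = a := fun a => by rw [hτ, hτ, ← pow_mul, ← sq, pow_sq_eq hF]
    simp only [form, Pi.smul_apply, smul_eq_mul, ← hτ, map_mul, h1]
    congr 1
    exact Finset.sum_congr rfl fun i _ => by ring
  nondeg x hx := by
    have hc0 : c ≠ 0 := by
      rintro rfl
      have hq1 := hq.one_lt
      rw [zero_pow (by omega)] at hc
      exact pow_ne_zero _ (neg_ne_zero.2 one_ne_zero) hc.symm
    funext i
    have h1 := hx (Pi.single (Fin.rev i) 1)
    rw [form, Finset.sum_eq_single_of_mem i (mem_univ i)] at h1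
    · simpa [hc0] using h1
    · intro j _ hj
      rw [Pi.single_eq_of_ne (fun h => hj (Fin.rev_injective h)), zero_pow hq.ne_zero, mul_zero]

end StandardForm

/-! ### Actions on the standard space as modules over the group algebra -/

section RepSpace

variable {F A : Type*} [Field F] [CommGroup A] {q n : ℕ} {c : F}

/-- The space `Fⁿ` as a module over the group algebra of a group acting by isometries. -/
def RepSpace (_ρ : A →* GU q n c) : Type _ := Fin n → F

instance (ρ : A →* GU q n c) : AddCommGroup (RepSpace ρ) :=
  inferInstanceAs (AddCommGroup (Fin n → F))

instance (ρ : A →* GU q n c) : Module F (RepSpace ρ) :=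
  inferInstanceAs (Module F (Fin n → F))

instance [Finite F] (ρ : A →* GU q n c) : Finite (RepSpace ρ) :=
  inferInstanceAs (Finite (Fin n → F))

/-- The action of the group algebra by endomorphisms. -/
noncomputable def repHom (ρ : A →* GU q n c) :
    MonoidAlgebra F A →ₐ[F] Module.End F (RepSpace ρ) :=
  MonoidAlgebra.lift F (Module.End F (Fin n → F)) A
    (LinearEquiv.automorphismGroup.toLinearMapMonoidHom.comp ((GU q n c).subtype.comp ρ))

noncomputable instance (ρ : A →* GU q n c) : Module (MonoidAlgebra F A) (RepSpace ρ) :=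
  Module.compHom (RepSpace ρ) (repHom ρ : MonoidAlgebra F A →+* Module.End F (RepSpace ρ))

theorem repSpace_smul_def (ρ : A →* GU q n c) (r : MonoidAlgebra F A) (x : RepSpace ρ) :
    r • x = repHom ρ r x := rfl

/-- The action of a group element. -/
def repAct (ρ : A →* GU q n c) (a : A) (x : RepSpace ρ) : RepSpace ρ := (ρ a).1 x

theorem single_smul (ρ : A →* GU q n c) (a : A) (t : F) (x : RepSpace ρ) :
    MonoidAlgebra.single a t • x = t • repAct ρ a x := by
  exact LinearMap.congr_fun (MonoidAlgebra.lift_single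
    (LinearEquiv.automorphismGroup.toLinearMapMonoidHom.comp ((GU q n c).subtype.comp ρ)) a t) x

instance (ρ : A →* GU q n c) : IsScalarTower F (MonoidAlgebra F A) (RepSpace ρ) :=
  ⟨fun t r x => by rw [repSpace_smul_def, map_smul]; rfl⟩

/-- The form on the space `Fⁿ` with a group action. -/
def repForm (ρ : A →* GU q n c) : RepSpace ρ → RepSpace ρ → F :=
  fun x y => form q c (n := n) x y

theorem repForm_repAct (ρ : A →* GU q n c) (a : A) (x y : RepSpace ρ) :
    repForm ρ (repAct ρ a x) (repAct ρ a y) = repForm ρ x y := (ρ a).2 x y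

theorem repAct_mul (ρ : A →* GU q n c) (a b : A) (x : RepSpace ρ) :
    repAct ρ (a * b) x = repAct ρ a (repAct ρ b x) := by
  simp only [repAct, map_mul]
  rfl

theorem repAct_one (ρ : A →* GU q n c) (x : RepSpace ρ) : repAct ρ 1 x = x := by
  simp only [repAct, map_one]
  rfl

/-- The adjoint of an isometry is its inverse, so the inversion of group elements built into `conj`
is exactly what adjointness requires. -/
theorem isHermitian_repForm [Finite F] (hq : IsPrimePow q) (hF : Nat.card F = q ^ 2)
    {τ : F →+* F} (hτ : ∀ a, τ a = a ^ q) (hc : c ^ (q - 1) = (-1) ^ (n + 1))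
    (ρ : A →* GU q n c) : IsHermitian (R := MonoidAlgebra F A) τ (conj τ) (repForm ρ) where
  add_left := (isHermitian_form hq hF hτ hc).add_left
  smul_left := (isHermitian_form hq hF hτ hc).smul_left
  symm := (isHermitian_form hq hF hτ hc).symm
  nondeg := (isHermitian_form hq hF hτ hc).nondeg
  adj r x y := by
    have hh := isHermitian_form hq hF hτ hc
    induction r using MonoidAlgebra.induction_linear with
    | zero =>
      rw [map_zero, zero_smul, zero_smul]
      exact (hh.zero_left y).trans (hh.zero_right x).symm
    | add f g hf hg =>
      rw [map_add, add_smul, add_smul]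
      exact (hh.add_left _ _ _).trans ((congrArg₂ (· + ·) hf hg).trans (hh.add_right _ _ _).symm)
    | single a t =>
      rw [conj_single, single_smul, single_smul]
      refine (hh.smul_left _ _ _).trans (Eq.trans ?_ (hh.smul_right _ _ _).symm)
      rw [hτ, hτ, ← pow_mul, ← sq, pow_sq_eq hF]
      congr 1
      have := repForm_repAct ρ a x (repAct ρ a⁻¹ y)
      rw [← repAct_mul, mul_inv_cancel, repAct_one] at this
      exact this

/-- An element of the unitary group as a map between the spaces of two actions. -/
def repMap (ρ ρ' : A →* GU q n c) (g : GU q n c) : RepSpace ρ ≃ₗ[F] RepSpace ρ' := g.1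

theorem repMap_smul {ρ ρ' : A →* GU q n c} {g : GU q n c} (hg : ∀ a, g * ρ a = ρ' a * g)
    (r : MonoidAlgebra F A) (x : RepSpace ρ) : repMap ρ ρ' g (r • x) = r • repMap ρ ρ' g x := by
  induction r using MonoidAlgebra.induction_linear with
  | zero => rw [zero_smul, zero_smul, map_zero]
  | add f h hf hh => rw [add_smul, add_smul, map_add, hf, hh]
  | single a t =>
    rw [single_smul, single_smul, map_smul]
    exact congrArg (t • ·) (congrArg (fun g : GU q n c => g.1 x) (hg a))

theorem apply_repAct {ρ ρ' : A →* GU q n c}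
    (φ : RepSpace ρ ≃ₗ[MonoidAlgebra F A] RepSpace ρ') (a : A) (x : RepSpace ρ) :
    φ (repAct ρ a x) = repAct ρ' a (φ x) := by
  have h1 := φ.map_smul (MonoidAlgebra.single a 1) x
  rwa [single_smul, single_smul, one_smul, one_smul] at h1

/-- The elements of the unitary group that intertwine two actions are the isometries between the
two modules. -/
noncomputable def intertwinerEquiv (ρ ρ' : A →* GU q n c) :
    {g : GU q n c // ∀ a, g * ρ a = ρ' a * g} ≃
      {φ : RepSpace ρ ≃ₗ[MonoidAlgebra F A] RepSpace ρ' //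
        ∀ x y, repForm ρ' (φ x) (φ y) = repForm ρ x y} where
  toFun g := ⟨
    { repMap ρ ρ' g.1 with
      map_smul' := repMap_smul g.2 }, fun x y => g.1.2 x y⟩
  invFun φ := ⟨⟨φ.1.restrictScalars F, fun x y => φ.2 x y⟩,
    fun a => Subtype.ext (LinearEquiv.ext fun x => apply_repAct φ.1 a x)⟩
  left_inv _ := rfl
  right_inv _ := rfl

theorem intertwinerEquiv_mem (ρ : A →* GU q n c)
    (g : {g : GU q n c // ∀ a, g * ρ a = ρ a * g}) :
    (intertwinerEquiv ρ ρ g).1 ∈ isomGroup (MonoidAlgebra F A) (repForm ρ) :=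
  (intertwinerEquiv ρ ρ g).2

theorem map_eq_of_closure {ρ : A →* GU q n c} {r : ℕ} {gen : Fin r → A}
    (hgen : Subgroup.closure (Set.range gen) = ⊤) {U : Submodule F (Fin n → F)}
    (hU : ∀ i, U.map ((ρ (gen i)).1 : (Fin n → F) →ₗ[F] (Fin n → F)) = U) (a : A) :
    U.map ((ρ a).1 : (Fin n → F) →ₗ[F] (Fin n → F)) = U := by
  have ha : a ∈ Subgroup.closure (Set.range gen) := hgen ▸ Subgroup.mem_top a
  induction ha using Subgroup.closure_induction with
  | mem x hx =>
    obtain ⟨i, rfl⟩ := hx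
    exact hU i
  | one =>
    rw [map_one]
    exact Submodule.map_id U
  | mul x y _ _ hx hy =>
    rw [map_mul]
    conv_rhs => rw [← hx, ← hy]
    exact Submodule.map_comp _ _ _
  | inv x _ hx =>
    conv_lhs => rw [← hx]
    refine (Submodule.map_comp _ _ _).symm.trans ?_
    have h1 : (((ρ x⁻¹).1 : (Fin n → F) →ₗ[F] (Fin n → F)) ∘ₗ ((ρ x).1 : _ →ₗ[F] _)) =
        LinearMap.id := by
      refine LinearMap.ext fun u => ?_
      have h2 := congrArg (fun g : GU q n c => g.1 u)
        (show ρ x⁻¹ * ρ x = 1 by rw [← map_mul, inv_mul_cancel, map_one])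
      exact h2
    rw [h1, Submodule.map_id]

/-- A subspace stable under the group, as a submodule over the group algebra. -/
def repSubmodule (ρ : A →* GU q n c) (U : Submodule F (Fin n → F))
    (hU : ∀ a, U.map ((ρ a).1 : (Fin n → F) →ₗ[F] (Fin n → F)) = U) :
    Submodule (MonoidAlgebra F A) (RepSpace ρ) where
  carrier := {x : RepSpace ρ | (show Fin n → F from x) ∈ U}
  add_mem' := fun ha hb => U.add_mem ha hb
  zero_mem' := U.zero_mem
  smul_mem' := fun r x hx => by
    induction r using MonoidAlgebra.induction_linear with
    | zero => rw [zero_smul]; exact U.zero_mem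
    | add f g hf hg => rw [add_smul]; exact U.add_mem hf hg
    | single a t =>
      rw [single_smul]
      refine U.smul_mem t ?_
      rw [← hU a]
      exact Submodule.mem_map_of_mem hx

/-- A submodule over the group algebra as a subspace of `Fⁿ`. -/
def repSubspace {ρ : A →* GU q n c} (U : Submodule (MonoidAlgebra F A) (RepSpace ρ)) :
    Submodule F (Fin n → F) where
  carrier := {x | (show RepSpace ρ from x) ∈ U}
  add_mem' := fun ha hb => U.add_mem ha hb
  zero_mem' := U.zero_mem
  smul_mem' := fun t _ hx => (U.restrictScalars F).smul_mem t hx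

theorem repAct_mem {ρ : A →* GU q n c} {U : Submodule (MonoidAlgebra F A) (RepSpace ρ)} (a : A)
    {x : RepSpace ρ} (hx : x ∈ U) : repAct ρ a x ∈ U := by
  have := U.smul_mem (MonoidAlgebra.single a 1) hx
  rwa [single_smul, one_smul] at this

theorem map_repSubspace {ρ : A →* GU q n c} (U : Submodule (MonoidAlgebra F A) (RepSpace ρ))
    (a : A) : (repSubspace U).map ((ρ a).1 : (Fin n → F) →ₗ[F] (Fin n → F)) = repSubspace U := by
  apply le_antisymm
  · rintro _ ⟨x, hx, rfl⟩
    exact repAct_mem (U := U) a hx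
  · intro x hx
    refine ⟨repAct ρ a⁻¹ x, repAct_mem (U := U) a⁻¹ hx, ?_⟩
    refine Eq.trans (repAct_mul ρ a a⁻¹ x).symm ?_
    rw [mul_inv_cancel]
    exact repAct_one ρ x

theorem repSubmodule_mem_invSet {ρ : A →* GU q n c} {U : Submodule F (Fin n → F)}
    (hU : ∀ a, U.map ((ρ a).1 : (Fin n → F) →ₗ[F] (Fin n → F)) = U)
    (g : {g : GU q n c // ∀ a, g * ρ a = ρ a * g})
    (hg : U.map (g.1.1 : (Fin n → F) →ₗ[F] (Fin n → F)) = U) :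
    repSubmodule ρ U hU ∈ invSet (intertwinerEquiv ρ ρ g).1 :=
  SetLike.coe_injective (congrArg (fun W : Submodule F (Fin n → F) => (W : Set (Fin n → F))) hg)

theorem map_repSubspace_of_mem_invSet {ρ : A →* GU q n c}
    {U : Submodule (MonoidAlgebra F A) (RepSpace ρ)}
    (g : {g : GU q n c // ∀ a, g * ρ a = ρ a * g})
    (hg : U ∈ invSet (intertwinerEquiv ρ ρ g).1) :
    (repSubspace U).map (g.1.1 : (Fin n → F) →ₗ[F] (Fin n → F)) = repSubspace U :=
  SetLike.coe_injective (congrArg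
    (fun W : Submodule (MonoidAlgebra F A) (RepSpace ρ) => (W : Set (RepSpace ρ)))
    (mem_invSet.1 hg))

theorem repSubmodule_ne_bot {ρ : A →* GU q n c} {U : Submodule F (Fin n → F)}
    (hU : ∀ a, U.map ((ρ a).1 : (Fin n → F) →ₗ[F] (Fin n → F)) = U) (h0 : U ≠ ⊥) :
    repSubmodule ρ U hU ≠ ⊥ := by
  obtain ⟨x, hx, hx0⟩ := (Submodule.ne_bot_iff _).1 h0
  exact (Submodule.ne_bot_iff _).2 ⟨x, hx, hx0⟩

theorem repSubspace_ne_bot {ρ : A →* GU q n c}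
    {U : Submodule (MonoidAlgebra F A) (RepSpace ρ)} (h0 : U ≠ ⊥) : repSubspace U ≠ ⊥ := by
  obtain ⟨x, hx, hx0⟩ := (Submodule.ne_bot_iff _).1 h0
  exact (Submodule.ne_bot_iff _).2 ⟨x, hx, hx0⟩

theorem repSubspace_ne_top (hnt : ¬ ∀ u v : Fin n → F, form q c u v = 0) {ρ : A →* GU q n c}
    {U : Submodule (MonoidAlgebra F A) (RepSpace ρ)} (hU : Isotropic (repForm ρ) U) :
    repSubspace U ≠ ⊤ := fun h0 => hnt fun u v => by
  have h1 : ∀ w, w ∈ repSubspace U := fun w => h0 ▸ Submodule.mem_top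
  exact hU u (h1 u) v (h1 v)

/-- The totally isotropic subspaces fixed by a tuple, as submodules over the group algebra. -/
def fixedPosetEquiv {ρ : A →* GU q n c} {r : ℕ} {gen : Fin r → A}
    (hgen : Subgroup.closure (Set.range gen) = ⊤)
    (hnt : ¬ ∀ u v : Fin n → F, form q c u v = 0)
    (g : {g : GU q n c // ∀ a, g * ρ a = ρ a * g}) {X : Fin (r + 1) → GU q n c}
    (hX0 : X 0 = g.1) (hX : ∀ i : Fin r, X i.succ = ρ (gen i)) :
    FixedPoset X ≃o {U : Submodule (MonoidAlgebra F A) (RepSpace ρ) //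
      U ∈ {U | U ∈ invSet (intertwinerEquiv ρ ρ g).1 ∧ Isotropic (repForm ρ) U} ∧ U ≠ ⊥} where
  toFun U :=
    have hU := map_eq_of_closure hgen fun i => (hX i ▸ U.2 i.succ :
      U.1.1.map ((ρ (gen i)).1 : (Fin n → F) →ₗ[F] (Fin n → F)) = U.1.1)
    ⟨repSubmodule ρ U.1.1 hU,
      ⟨repSubmodule_mem_invSet hU g (hX0 ▸ U.2 0), U.1.2.2.2⟩, repSubmodule_ne_bot hU U.1.2.1⟩
  invFun U := ⟨⟨repSubspace U.1, repSubspace_ne_bot U.2.2, repSubspace_ne_top hnt U.2.1.2,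
    U.2.1.2⟩, Fin.cases (hX0.symm ▸ map_repSubspace_of_mem_invSet g U.2.1.1)
      fun i => (hX i).symm ▸ map_repSubspace U.1 (gen i)⟩
  left_inv _ := rfl
  right_inv _ := rfl
  map_rel_iff' := Iff.rfl

/-- Isotropic invariant submodules are closed downwards among the invariant ones, so the Möbius
function of the full lattice of invariant submodules may be used. The exclusion of the whole space
costs nothing, since it is not isotropic when the form is nonzero. -/
theorem reducedEulerChar_fixedPoset [Finite F] {ρ : A →* GU q n c}
    [Fintype (Submodule (MonoidAlgebra F A) (RepSpace ρ))] {r : ℕ} {gen : Fin r → A}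
    (hgen : Subgroup.closure (Set.range gen) = ⊤)
    (hnt : ¬ ∀ u v : Fin n → F, form q c u v = 0)
    (g : {g : GU q n c // ∀ a, g * ρ a = ρ a * g}) {X : Fin (r + 1) → GU q n c}
    (hX0 : X 0 = g.1) (hX : ∀ i : Fin r, X i.succ = ρ (gen i)) :
    reducedEulerChar (FixedPoset X) =
      -mobSum (invSet (intertwinerEquiv ρ ρ g).1) (Isotropic (repForm ρ)) ⊤ := by
  classical
  rw [reducedEulerChar_eq_neg_sum_mob (invSet (intertwinerEquiv ρ ρ g).1)
    {U | U ∈ invSet (intertwinerEquiv ρ ρ g).1 ∧ Isotropic (repForm ρ) U} (fun U hU => hU.1)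
    ⟨bot_mem_invSet _, ?_⟩ (fun U hU U' hU' hle => ⟨hU', fun u hu v hv => ?_⟩)
    (fixedPosetEquiv hgen hnt g hX0 hX), mobSum]
  · congr 1
    refine Finset.sum_congr ?_ fun _ _ => rfl
    ext U
    simp
  · intro u hu v hv
    rw [(Submodule.mem_bot _).1 hu]
    change form q c (0 : Fin n → F) _ = 0
    simp [form]
  · exact hU.2 u (hle hu) v (hle hv)

end RepSpace

instance finite_GU {F : Type*} [Field F] [Finite F] {q n : ℕ} {c : F} : Finite (GU q n c) :=
  have : Finite ((Fin n → F) ≃ₗ[F] (Fin n → F)) := Finite.of_injective _ DFunLike.coe_injective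
  inferInstance

/-! ### Tuples as homomorphisms with centralizing elements -/

section Tuples

variable {A : Type*} [CommGroup A] {p r : ℕ}

/-- The generators of a group form a universal commuting tuple of elements of `p`-power order
in the finite group `G`. -/
structure IsUniversalTuple (p : ℕ) {A : Type*} [CommGroup A] {r : ℕ} (gen : Fin r → A)
    (G : Type*) [Group G] : Prop where
  closure : Subgroup.closure (Set.range gen) = ⊤
  order : ∀ (ρ : A →* G) i, ∃ k, orderOf (ρ (gen i)) = p ^ k
  lift : ∀ Y : Fin r → G, (∀ i j, Commute (Y i) (Y j)) → (∀ i, ∃ k, orderOf (Y i) = p ^ k) →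
    ∃ ρ : A →* G, ∀ i, ρ (gen i) = Y i

theorem IsUniversalTuple.commute {gen : Fin r → A} {G : Type*} [Group G]
    (hgen : IsUniversalTuple p gen G) {ρ : A →* G} {g : G} (hg : ∀ i, Commute g (ρ (gen i)))
    (a : A) : Commute g (ρ a) := by
  have ha : a ∈ Subgroup.closure (Set.range gen) := hgen.closure ▸ Subgroup.mem_top a
  induction ha using Subgroup.closure_induction with
  | mem x hx =>
    obtain ⟨i, rfl⟩ := hx
    exact hg i
  | one => rw [map_one]; exact Commute.one_right g
  | mul x y _ _ hx hy => rw [map_mul]; exact hx.mul_right hy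
  | inv x _ hx => rw [map_inv]; exact hx.inv_right

/-- The tuple defined by a homomorphism and an element of the centralizer of its image. -/
def tupleOf {G : Type*} [Group G] (gen : Fin r → A)
    (x : Σ ρ : A →* G, {g : G // ∀ a, g * ρ a = ρ a * g}) : Fin (r + 1) → G :=
  Fin.cons x.2.1 fun i => x.1 (gen i)

theorem tupleOf_mem {gen : Fin r → A} {G : Type*} [Group G] (hgen : IsUniversalTuple p gen G)
    (x : Σ ρ : A →* G, {g : G // ∀ a, g * ρ a = ρ a * g}) :
    tupleOf gen x ∈ primaryTuples p (r + 1) G := by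
  refine ⟨fun i j => ?_, fun i => ?_⟩
  · refine Fin.cases ?_ (fun i => ?_) i <;> refine Fin.cases ?_ (fun j => ?_) j
    · exact Commute.refl _
    · exact x.2.2 _
    · exact (x.2.2 _).symm
    · exact (Commute.all (gen i) (gen j)).map x.1
  · refine Fin.cases (fun h => absurd rfl h) (fun i _ => ?_) i
    exact hgen.order _ _

/-- The entries after the first amount to a homomorphism from `A`; commuting with the images of the
generators is commuting with the whole image. -/
theorem tupleOf_bijective {gen : Fin r → A} {G : Type*} [Group G]
    (hgen : IsUniversalTuple p gen G) :
    Function.Bijective fun x => (⟨tupleOf gen x, tupleOf_mem hgen x⟩ :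
      primaryTuples p (r + 1) G) := by
  constructor
  · rintro ⟨ρ, g, hg⟩ ⟨ρ', g', hg'⟩ h
    have h1 := congrArg Subtype.val h
    have h0 : g = g' := congrFun h1 0
    have h2 : ρ = ρ' := by
      refine MonoidHom.eq_of_eqOn_dense hgen.closure ?_
      rintro _ ⟨i, rfl⟩
      exact congrFun h1 i.succ
    subst h0 h2
    rfl
  · rintro ⟨X, hX1, hX2⟩
    obtain ⟨ρ, hρ⟩ := hgen.lift (fun i => X i.succ) (fun i j => hX1 _ _)
      fun i => hX2 _ (by simp)
    refine ⟨⟨ρ, X 0, hgen.commute fun i => ?_⟩, Subtype.ext (funext fun i => ?_)⟩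
    · rw [hρ]
      exact hX1 _ _
    · refine Fin.cases rfl (fun i => ?_) i
      exact hρ i

open scoped Classical in
-- The sum over tuples is taken first over homomorphisms `ρ` and then over centralizing elements,
-- which are the isometries of the module defined by `ρ`.
theorem finsum_primaryTuples {F : Type*} [Field F] [Finite F] {q n : ℕ} {c : F} [Finite A]
    [Fintype (A →* GU q n c)]
    [∀ ρ : A →* GU q n c, Fintype (Submodule (MonoidAlgebra F A) (RepSpace ρ))]
    [∀ ρ : A →* GU q n c, Fintype (RepSpace ρ ≃ₗ[MonoidAlgebra F A] RepSpace ρ)]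
    (hnt : ¬ ∀ u v : Fin n → F, form q c u v = 0) {gen : Fin r → A}
    (hgen : IsUniversalTuple p gen (GU q n c)) :
    ∑ᶠ X : primaryTuples p (r + 1) (GU q n c), (reducedEulerChar (FixedPoset X.1) : ℚ) =
      -((∑ ρ : A →* GU q n c, ∑ X with X ∈ isomGroup (MonoidAlgebra F A) (repForm ρ),
        mobSum (invSet X) (Isotropic (repForm ρ)) ⊤ : ℤ) : ℚ) := by
  have := Fintype.ofFinite (GU q n c)
  have : ∀ ρ : A →* GU q n c, Fintype {g : GU q n c // ∀ a, g * ρ a = ρ a * g} := fun _ =>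
    Fintype.ofFinite _
  rw [← finsum_eq_of_bijective _ (tupleOf_bijective hgen) fun x => rfl,
    finsum_eq_sum_of_fintype, Fintype.sum_sigma, Int.cast_sum, ← Finset.sum_neg_distrib]
  refine Finset.sum_congr rfl fun ρ _ => ?_
  rw [Int.cast_sum, ← Finset.sum_neg_distrib,
    Finset.sum_subtype (p := fun X => X ∈ isomGroup (MonoidAlgebra F A) (repForm ρ)) _ (by simp)]
  refine Fintype.sum_equiv (intertwinerEquiv ρ ρ) _ _ fun g => ?_
  rw [← Int.cast_neg, ← reducedEulerChar_fixedPoset (X := tupleOf gen ⟨ρ, g⟩)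
    hgen.closure hnt g rfl fun i => rfl]

end Tuples

/-! ### Conjugacy classes of multiplicity free actions -/

section Classes

variable {F A O : Type*} [Field F] [CommGroup A] {q n : ℕ} {c : F}

/-- A Hermitian module isometric to `Fⁿ` over the base field comes from an action on `Fⁿ`. -/
theorem exists_rep_of_isometry {L : Type*} [AddCommGroup L] [Module F L]
    [Module (MonoidAlgebra F A) L] [IsScalarTower F (MonoidAlgebra F A) L] {h : L → L → F}
    (hh : ∀ (a : A) x y, h (MonoidAlgebra.single a (1 : F) • x)
      (MonoidAlgebra.single a (1 : F) • y) = h x y)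
    (ψ : L ≃ₗ[F] (Fin n → F)) (hψ : ∀ x y, form q c (ψ x) (ψ y) = h x y) :
    ∃ ρ : A →* GU q n c, Nonempty (L ≃ₗ[MonoidAlgebra F A] RepSpace ρ) := by
  have hmul : ∀ (a b : A) (x : L), MonoidAlgebra.single a (1 : F) •
      MonoidAlgebra.single b (1 : F) • x = MonoidAlgebra.single (a * b) (1 : F) • x := by
    intro a b x
    rw [← mul_smul, MonoidAlgebra.single_mul_single, one_mul]
  have hone : ∀ x : L, MonoidAlgebra.single (1 : A) (1 : F) • x = x := fun x => by
    rw [← MonoidAlgebra.one_def, one_smul]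
  let act : A → (Fin n → F) ≃ₗ[F] (Fin n → F) := fun a =>
    { toFun := fun x => ψ (MonoidAlgebra.single a (1 : F) • ψ.symm x)
      map_add' := fun x y => by rw [map_add, smul_add, map_add]
      map_smul' := fun t x => by rw [map_smul ψ.symm, smul_comm, map_smul, RingHom.id_apply]
      invFun := fun x => ψ (MonoidAlgebra.single a⁻¹ (1 : F) • ψ.symm x)
      left_inv := fun x => by
        beta_reduce
        rw [ψ.symm_apply_apply, hmul, inv_mul_cancel, hone, ψ.apply_symm_apply]
      right_inv := fun x => by
        beta_reduce
        rw [ψ.symm_apply_apply, hmul, mul_inv_cancel, hone, ψ.apply_symm_apply] }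
  have hact : ∀ a x, act a x = ψ (MonoidAlgebra.single a (1 : F) • ψ.symm x) := fun _ _ => rfl
  let ρ : A →* GU q n c :=
    { toFun := fun a => ⟨act a, fun u v => by
        rw [hact, hact, hψ, hh, ← hψ, ψ.apply_symm_apply, ψ.apply_symm_apply]⟩
      map_one' := Subtype.ext (LinearEquiv.ext fun x => by
        change act 1 x = x
        rw [hact, hone, ψ.apply_symm_apply])
      map_mul' := fun a b => Subtype.ext (LinearEquiv.ext fun x => by
        change act (a * b) x = act a (act b x)
        rw [hact, hact, hact, ψ.symm_apply_apply, hmul]) }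
  let ψ' : L ≃ₗ[F] RepSpace ρ := ψ
  have hψ' : ∀ a x, repAct ρ a (ψ' x) = ψ' (MonoidAlgebra.single a (1 : F) • x) := by
    intro a x
    change ψ (MonoidAlgebra.single a (1 : F) • ψ.symm (ψ x)) = _
    rw [ψ.symm_apply_apply]
    rfl
  refine ⟨ρ, ⟨{ ψ' with map_smul' := fun s x => ?_ }⟩⟩
  change ψ' (s • x) = s • ψ' x
  induction s using MonoidAlgebra.induction_linear with
  | zero => rw [zero_smul, zero_smul, map_zero]
  | add f g hf hg => rw [add_smul, add_smul, map_add, hf, hg]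
  | single a t =>
    have h1 : (MonoidAlgebra.single a t : MonoidAlgebra F A) = t • MonoidAlgebra.single a 1 := by
      rw [MonoidAlgebra.smul_single, smul_eq_mul, mul_one]
    rw [single_smul, hψ', h1, smul_assoc, map_smul]

theorem IsCyclicOn.map {O R V V' : Type*} [CommRing R] [AddCommGroup V] [Module R V]
    [AddCommGroup V'] [Module R V'] {e : O → R} {S : Finset O} {v : V} (hv : IsCyclicOn e S v)
    (φ : V ≃ₗ[R] V') : IsCyclicOn e S (φ v) where
  gen x := by
    obtain ⟨r, hr⟩ := hv.gen (φ.symm x)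
    exact ⟨r, by rw [← map_smul, hr, φ.apply_symm_apply]⟩
  ann r := by rw [← map_smul, map_eq_zero_iff φ φ.injective, hv.ann]

variable [Fintype O] {e : O → MonoidAlgebra F A}

theorem isCyclicOn_part {R : Type*} [CommRing R] {σ : R →+* R} {e : O → R} {s : O → ℤ}
    (hd : IsDecomposition σ e s) (S : Finset O) :
    IsCyclicOn e S (⟨∑ o ∈ S, e o, hd.sum_idem S⟩ : part R (∑ o ∈ S, e o)) where
  gen x := ⟨x, Subtype.ext (by
    have := x.2
    rw [mem_part, smul_eq_mul, mul_comm] at this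
    exact this)⟩
  ann r := by
    rw [← Subtype.coe_inj]
    rfl

/-- The homomorphisms to the unitary group that make `Fⁿ` a cyclic module with support `S`. -/
def CyclicRep (q n : ℕ) (c : F) (e : O → MonoidAlgebra F A) (S : Finset O) :
    Set (A →* GU q n c) := {ρ | ∃ v : RepSpace ρ, IsCyclicOn e S v}

theorem finrank_eq_of_mem_cyclicRep {σ : MonoidAlgebra F A →+* MonoidAlgebra F A} {s : O → ℤ}
    (hd : IsDecomposition σ e s) {S : Finset O} {ρ : A →* GU q n c}
    (hρ : ρ ∈ CyclicRep q n c e S) :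
    Module.finrank F (part (MonoidAlgebra F A) (∑ o ∈ S, e o)) = n := by
  obtain ⟨v, hv⟩ := hρ
  have hv' := isCyclicOn_part hd S
  obtain ⟨φ⟩ := nonempty_linearEquiv_of_cyclic hv'.gen hv.gen fun r => by
    rw [hv.ann, hv'.ann]
  rw [LinearEquiv.finrank_eq (φ.restrictScalars F)]
  exact Module.finrank_fin_fun F

variable [Finite F]

/-- The sum of the components in `S`, with the trace form, has dimension `n` and is therefore
isometric over `F` to the standard space, to which its group action is transported. -/
theorem cyclicRep_nonempty (hq : IsPrimePow q) (hF : Nat.card F = q ^ 2) {τ : F →+* F}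
    (hτ : ∀ a, τ a = a ^ q) (hc : c ^ (q - 1) = (-1) ^ (n + 1)) [Finite A] {s : O → ℤ}
    (hd : IsDecomposition (conj τ) e s) {S : Finset O}
    (hS : Module.finrank F (part (MonoidAlgebra F A) (∑ o ∈ S, e o)) = n) :
    (CyclicRep q n c e S).Nonempty := by
  have hσ := isInvolution_conj (A := A) hq hF hτ
  have hfix : conj τ (∑ o ∈ S, e o) = ∑ o ∈ S, e o := by
    rw [map_sum]
    exact Finset.sum_congr rfl fun o _ => hd.fixed o
  have hh := isHermitian_traceForm_part hq hF hτ (hd.sum_idem S) hfix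
  have : Finite (MonoidAlgebra F A) := finite_monoidAlgebra
  have hh' : IsHermitian τ τ
      (fun x y : part (MonoidAlgebra F A) (∑ o ∈ S, e o) => traceForm τ x.1 y.1) :=
    { add_left := hh.add_left
      smul_left := hh.smul_left
      symm := hh.symm
      adj := fun t x y => by
        rw [hh.smul_left, hh.smul_right, hσ.base_invol]
      nondeg := hh.nondeg }
  obtain ⟨ψ, hψ⟩ := exists_isometry_of_finrank_eq hh' (isHermitian_form hq hF hτ hc) hσ.trace_one
    (fun w hw => by
      rw [hτ] at hw
      obtain ⟨t, ht⟩ := exists_norm_eq_of_card hq hF hw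
      exact ⟨t, by rw [hτ, ht]⟩) (by rw [hS, Module.finrank_fin_fun])
  obtain ⟨ρ, ⟨φ⟩⟩ := exists_rep_of_isometry (fun a x y => by
    rw [hh.adj, ← mul_smul, conj_single, MonoidAlgebra.single_mul_single, inv_mul_cancel,
      map_one, one_mul, ← MonoidAlgebra.one_def, one_smul]) ψ hψ
  exact ⟨ρ, _, (isCyclicOn_part hd S).map φ⟩

open scoped Classical in
/-- The cyclic modules with given support form one conjugacy class. -/
theorem sum_card_centralizer {F A O : Type*} [Field F] [Finite F] [CommGroup A] {q n : ℕ} {c : F}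
    {e : O → MonoidAlgebra F A} (hq : IsPrimePow q) (hF : Nat.card F = q ^ 2) {τ : F →+* F}
    (hτ : ∀ a, τ a = a ^ q) (hc : c ^ (q - 1) = (-1) ^ (n + 1)) [Finite A]
    [Fintype (A →* GU q n c)]
    (hN : ∀ u : MonoidAlgebra F A, conj τ u = u → ∃ v, v * conj τ v = u) {S : Finset O}
    (hne : (CyclicRep q n c e S).Nonempty) :
    ∑ ρ with ρ ∈ CyclicRep q n c e S, Nat.card {g : GU q n c // ∀ a, g * ρ a = ρ a * g} =
      Nat.card (GU q n c) := by
  have hσ := isInvolution_conj (A := A) hq hF hτ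
  obtain ⟨ρ₀, v₀, hv₀⟩ := hne
  have := Fintype.ofFinite (GU q n c)
  rw [Nat.card_eq_fintype_card (α := GU q n c), ← Finset.card_univ,
    Finset.card_eq_sum_card_fiberwise (f := fun g => (MulAut.conj g).toMonoidHom.comp ρ₀)
      (t := univ.filter fun ρ => ρ ∈ CyclicRep q n c e S)]
  · refine Finset.sum_congr rfl fun ρ hρ => ?_
    obtain ⟨v, hv⟩ := (mem_filter.1 hρ).2
    obtain ⟨φ, hφ⟩ := exists_isometry_of_cyclic hσ hN
      (isHermitian_repForm hq hF hτ hc ρ₀) (isHermitian_repForm hq hF hτ hc ρ) hv₀.gen hv.gen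
      fun r => by rw [hv.ann, hv₀.ann]
    -- Uniqueness of the form makes `ρ` conjugate to `ρ₀` by `g₁`. The elements conjugating `ρ₀` to
    -- `ρ` are then the centralizer of `ρ` multiplied by `g₁` on the right.
    obtain ⟨g₁, hg₁⟩ := (intertwinerEquiv ρ₀ ρ).symm ⟨φ, hφ⟩
    rw [← Fintype.card_subtype, ← Nat.card_eq_fintype_card]
    refine Nat.card_congr ((Equiv.mulRight g₁).subtypeEquiv fun g => ?_)
    rw [MonoidHom.ext_iff]
    refine forall_congr' fun a => ?_
    change _ ↔ g * g₁ * ρ₀ a * (g * g₁)⁻¹ = ρ a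
    rw [mul_inv_eq_iff_eq_mul, mul_assoc, hg₁, ← mul_assoc, ← mul_assoc, mul_left_inj]
  · intro g _
    simp only [coe_filter, mem_univ, true_and, Set.mem_ofPred_eq]
    refine ⟨_, hv₀.map
      (intertwinerEquiv ρ₀ ((MulAut.conj g).toMonoidHom.comp ρ₀) ⟨g, fun a => ?_⟩).1⟩
    simp

open scoped Classical in
-- Only cyclic modules survive the averaging. Each contributes the order of its centralizer times
-- the product of the signs of its support, and the centralizer orders over one conjugacy class add
-- up to the order of the group.
theorem sum_mobSum_eq_sum_prod (hq : IsPrimePow q) (hF : Nat.card F = q ^ 2) {τ : F →+* F}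
    (hτ : ∀ a, τ a = a ^ q) (hc : c ^ (q - 1) = (-1) ^ (n + 1)) [Finite A]
    [IsSemisimpleRing (MonoidAlgebra F A)] [Fintype (A →* GU q n c)]
    [∀ ρ : A →* GU q n c, Fintype (Submodule (MonoidAlgebra F A) (RepSpace ρ))]
    [∀ ρ : A →* GU q n c, Fintype (RepSpace ρ ≃ₗ[MonoidAlgebra F A] RepSpace ρ)]
    (hN : ∀ u : MonoidAlgebra F A, conj τ u = u → ∃ v, v * conj τ v = u) {s : O → ℤ}
    (hd : IsDecomposition (conj τ) e s) (h0 : ∀ o, e o ≠ 0) :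
    ∑ ρ : A →* GU q n c, ∑ X with X ∈ isomGroup (MonoidAlgebra F A) (repForm ρ),
        mobSum (invSet X) (Isotropic (repForm ρ)) ⊤ =
      Nat.card (GU q n c) *
        ∑ S : Finset O with Module.finrank F (part (MonoidAlgebra F A) (∑ o ∈ S, e o)) = n,
          ∏ o ∈ S, s o := by
  have hσ := isInvolution_conj (A := A) hq hF hτ
  have hρ : ∀ ρ : A →* GU q n c, ∑ X with X ∈ isomGroup (MonoidAlgebra F A) (repForm ρ),
      mobSum (invSet X) (Isotropic (repForm ρ)) ⊤ = ∑ S : Finset O,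
        if ρ ∈ CyclicRep q n c e S then
          (Nat.card {g : GU q n c // ∀ a, g * ρ a = ρ a * g} : ℤ) * ∏ o ∈ S, s o else 0 := by
    intro ρ
    have hh := isHermitian_repForm hq hF hτ hc ρ
    by_cases hcyc : ∃ S, ρ ∈ CyclicRep q n c e S
    · obtain ⟨S, v, hv⟩ := hcyc
      rw [Finset.sum_eq_single_of_mem S (mem_univ S), if_pos ⟨v, hv⟩,
        Finset.sum_congr rfl fun X hX => hv.mobSum_eq hσ hh hd h0 (mem_filter.1 hX).2,
        Finset.sum_const, nsmul_eq_mul, ← Fintype.card_subtype, ← Nat.card_eq_fintype_card]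
      · congr 2
        exact Nat.card_congr (intertwinerEquiv ρ ρ).symm
      · intro S' _ hS'
        rw [if_neg]
        rintro ⟨v', hv'⟩
        -- The support is read off from which idempotents kill a generator, and this is independent
        -- of the generator.
        refine hS' (Finset.ext fun o => ?_)
        rw [← not_iff_not, ← hv.smul_eq_zero_iff hd h0, ← hv'.smul_eq_zero_iff hd h0]
        constructor
        · intro h1
          obtain ⟨t, rfl⟩ := hv'.gen v
          rw [smul_comm, h1, smul_zero]
        · intro h1
          obtain ⟨t, rfl⟩ := hv.gen v'
          rw [smul_comm, h1, smul_zero]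
    · rw [Finset.sum_eq_zero (s := (univ : Finset (Finset O)))]
      · by_contra hW
        obtain ⟨S, v, hv⟩ := exists_isCyclicOn hσ hN hh hd hW
        exact hcyc ⟨S, v, hv⟩
      · intro S _
        rw [if_neg fun h => hcyc ⟨S, h⟩]
  simp only [hρ]
  rw [Finset.sum_comm, Finset.mul_sum, Finset.sum_filter]
  refine Finset.sum_congr rfl fun S _ => ?_
  rw [← Finset.sum_filter, ← Finset.sum_mul]
  split_ifs with hS
  · rw [← sum_card_centralizer hq hF hτ hc hN (cyclicRep_nonempty hq hF hτ hc hd hS), Nat.cast_sum]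
  · rw [Finset.filter_false_of_mem fun ρ _ h => hS (finrank_eq_of_mem_cyclicRep hd h),
      Finset.sum_empty, zero_mul]

end Classes

/-! ### Universal commuting tuples -/

section UniversalTuple

theorem exists_hom_zmod {G : Type*} [Group G] {M : ℕ} {g : G} (hg : g ^ M = 1) :
    ∃ f : Multiplicative (ZMod M) →* G, f (Multiplicative.ofAdd 1) = g ∧
      ∀ x, ∃ k : ℤ, f x = g ^ k := by
  have h0 : zmultiplesHom (Additive G) (Additive.ofMul g) (M : ℤ) = 0 := by
    rw [zmultiplesHom_apply, natCast_zsmul, ← ofMul_pow, hg, ofMul_one]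
  have key : ∀ k : ℤ, AddMonoidHom.toMultiplicativeLeft (ZMod.lift M ⟨_, h0⟩)
      (Multiplicative.ofAdd (k : ZMod M)) = g ^ k := by
    intro k
    rw [AddMonoidHom.coe_toMultiplicativeLeft, Function.comp_apply, Function.comp_apply,
      toAdd_ofAdd, ZMod.lift_coe, zmultiplesHom_apply, toMul_zsmul, toMul_ofMul]
  refine ⟨AddMonoidHom.toMultiplicativeLeft (ZMod.lift M ⟨_, h0⟩), ?_, fun x => ?_⟩
  · simpa using key 1
  · obtain ⟨k, hk⟩ := ZMod.intCast_surjective (Multiplicative.toAdd x)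
    exact ⟨k, by rw [← key k, hk, ofAdd_toAdd]⟩

/-- The free module of rank `r` over `ℤ / M`, written multiplicatively. -/
abbrev ZPow (M r : ℕ) : Type := Fin r → Multiplicative (ZMod M)

/-- The standard generators. -/
def zpowGen (M r : ℕ) (i : Fin r) : ZPow M r := Pi.mulSingle i (Multiplicative.ofAdd 1)

theorem closure_zpowGen (M r : ℕ) : Subgroup.closure (Set.range (zpowGen M r)) = ⊤ := by
  rw [eq_top_iff]
  intro a _
  rw [← Finset.univ_prod_mulSingle a]
  refine Subgroup.prod_mem _ fun i _ => ?_
  obtain ⟨k, hk⟩ := ZMod.intCast_surjective (Multiplicative.toAdd (a i))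
  have h1 : a i = Multiplicative.ofAdd 1 ^ k := by
    rw [← ofAdd_zsmul, zsmul_one, hk, ofAdd_toAdd]
  have h2 : Pi.mulSingle i (a i) = zpowGen M r i ^ k := by
    rw [h1]
    exact map_zpow (MonoidHom.mulSingle (fun _ : Fin r => Multiplicative (ZMod M)) i) _ k
  rw [h2]
  exact Subgroup.zpow_mem _ (Subgroup.subset_closure (Set.mem_range_self i)) k

theorem zpowGen_pow (M r : ℕ) (i : Fin r) : zpowGen M r i ^ M = 1 := by
  rw [zpowGen, ← Pi.mulSingle_pow, ← ofAdd_nsmul]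
  simp

/-- Once `p^N` annihilates all elements of `p`-power order in `G`, commuting tuples of such elements
are homomorphisms from the finite group `(ℤ/p^N)^r`. -/
theorem isUniversalTuple_zpowGen {p : ℕ} (hp : p.Prime) {N r : ℕ} {G : Type*} [Group G]
    (hN : ∀ g : G, (∃ k, orderOf g = p ^ k) → g ^ (p ^ N) = 1) :
    IsUniversalTuple p (zpowGen (p ^ N) r) G where
  closure := closure_zpowGen _ _
  order ρ i := by
    have h1 : ρ (zpowGen (p ^ N) r i) ^ (p ^ N) = 1 := by rw [← map_pow, zpowGen_pow, map_one]
    obtain ⟨k, -, hk⟩ := (Nat.dvd_prime_pow hp).1 (orderOf_dvd_of_pow_eq_one h1)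
    exact ⟨k, hk⟩
  lift Y hY hord := by
    choose f hf1 hf2 using fun i => exists_hom_zmod (hN (Y i) (hord i))
    have hcomm : Pairwise fun i j => ∀ x y, Commute (f i x) (f j y) := by
      intro i j _ x y
      obtain ⟨k, hk⟩ := hf2 i x
      obtain ⟨l, hl⟩ := hf2 j y
      rw [hk, hl]
      exact ((hY i j).zpow_left k).zpow_right l
    refine ⟨MonoidHom.noncommPiCoprod f hcomm, fun i => ?_⟩
    rw [zpowGen, MonoidHom.noncommPiCoprod_mulSingle, hf1]

end UniversalTuple

/-! ### Fixed points of iterated twists -/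

section FixedPoints

/-- In a cyclic group of order `p^N` the solutions of `z^m = 1` number `gcd(p^N, m)`, which is the
whole `p`-part of `m` if `N` is large enough. -/
theorem natCard_pow_eq_one_zmod {p : ℕ} (hp : p.Prime) {N m : ℕ} (hm : m ≠ 0)
    (hN : padicValNat p m ≤ N) :
    Nat.card {z : Multiplicative (ZMod (p ^ N)) // z ^ m = 1} = p ^ padicValNat p m := by
  have : Fact p.Prime := ⟨hp⟩
  have : NeZero (p ^ N) := ⟨pow_ne_zero _ hp.ne_zero⟩
  have : Finite (Multiplicative (ZMod (p ^ N))) := inferInstanceAs (Finite (ZMod (p ^ N)))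
  have hcard : Nat.card (Multiplicative (ZMod (p ^ N))) = p ^ N := by
    rw [Nat.card_congr Multiplicative.toAdd, Nat.card_zmod]
  have hg : (p ^ N).gcd m = p ^ padicValNat p m := by
    apply Nat.dvd_antisymm
    · obtain ⟨j, -, hj⟩ := (Nat.dvd_prime_pow hp).1 (Nat.gcd_dvd_left (p ^ N) m)
      rw [hj]
      refine pow_dvd_pow p ?_
      rw [← padicValNat_dvd_iff_le hm, ← hj]
      exact Nat.gcd_dvd_right _ _
    · exact Nat.dvd_gcd (pow_dvd_pow p hN) pow_padicValNat_dvd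
  have h1 := IsCyclic.card_powMonoidHom_ker (Multiplicative (ZMod (p ^ N))) m
  rw [hcard, hg] at h1
  exact h1

theorem natCard_pow_eq_one {p : ℕ} (hp : p.Prime) {N m r : ℕ} (hm : m ≠ 0)
    (hN : padicValNat p m ≤ N) :
    Nat.card {a : ZPow (p ^ N) r // a ^ m = 1} = (p ^ padicValNat p m) ^ r := by
  have h1 : Nat.card {a : ZPow (p ^ N) r // a ^ m = 1} =
      Nat.card (∀ _ : Fin r, {z : Multiplicative (ZMod (p ^ N)) // z ^ m = 1}) := by
    refine Nat.card_congr ((Equiv.subtypeEquivRight fun a => ?_).trans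
      (Equiv.subtypePiEquivPi (p := fun (_ : Fin r) z => z ^ m = 1)))
    rw [funext_iff]
    rfl
  rw [h1, Nat.card_pi, Finset.prod_congr rfl fun i _ => natCard_pow_eq_one_zmod hp hm hN,
    Finset.prod_const, Finset.card_univ, Fintype.card_fin]

theorem iterate_twist_apply {E A : Type*} [Field E] [CommGroup A] (q k : ℕ) (χ : A →* Eˣ)
    (a : A) : (twist q)^[k] χ a = χ a ^ ((-(q : ℤ)) ^ k) := by
  induction k with
  | zero => rw [Function.iterate_zero_apply, pow_zero, zpow_one]
  | succ k ih =>
    rw [Function.iterate_succ_apply', twist, MonoidHom.inv_apply, MonoidHom.pow_apply, ih,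
      ← zpow_natCast, ← zpow_mul, ← zpow_neg, pow_succ, mul_neg]

theorem sub_neg_one_pow_ne_zero {q k : ℕ} (hq : 1 < q) (hk : k ≠ 0) :
    (q : ℤ) ^ k - (-1) ^ k ≠ 0 := by
  intro h
  rw [sub_eq_zero] at h
  have h1 := congrArg Int.natAbs h
  rw [Int.natAbs_pow, Int.natAbs_pow, Int.natAbs_natCast, Int.natAbs_neg, Int.natAbs_one,
    one_pow] at h1
  exact (one_lt_pow₀ hq hk).ne' h1

/-- The `k`th iterate raises characters to the power `(-q)^k`, so its fixed points are the
characters killed by `(-q)^k - 1`, which is `q^k - (-1)^k` up to sign. They are counted in `A`, to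
which its dual group is isomorphic. -/
theorem natCard_fixed_twist {E : Type*} [Field E] [IsAlgClosed E] {p q N r k : ℕ} (hp : p.Prime)
    (hq : 1 < q) (hk : k ≠ 0) (hA : (Nat.card (ZPow (p ^ N) r) : E) ≠ 0)
    (hN : padicValInt p ((q : ℤ) ^ k - (-1) ^ k) ≤ N) :
    Nat.card {χ : ZPow (p ^ N) r →* Eˣ // (twist q)^[k] χ = χ} =
      pPart p ((q : ℤ) ^ k - (-1) ^ k) ^ r := by
  have : NeZero (p ^ N) := ⟨pow_ne_zero _ hp.ne_zero⟩
  have : Finite (Multiplicative (ZMod (p ^ N))) := inferInstanceAs (Finite (ZMod (p ^ N)))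
  have := hasEnoughRootsOfUnity_exponent hA
  obtain ⟨φ⟩ := CommGroup.monoidHom_mulEquiv_of_hasEnoughRootsOfUnity (ZPow (p ^ N) r) E
  set m := ((q : ℤ) ^ k - (-1) ^ k).natAbs with hm
  have hm0 : m ≠ 0 := Int.natAbs_ne_zero.2 (sub_neg_one_pow_ne_zero hq hk)
  have hm' : ((-(q : ℤ)) ^ k - 1).natAbs = m := by
    rw [hm, ← mul_one ((q : ℤ) ^ k - (-1) ^ k).natAbs,
      show (1 : ℕ) = (((-1 : ℤ)) ^ k).natAbs by rw [Int.natAbs_pow]; simp, ← Int.natAbs_mul]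
    congr 1
    rw [sub_mul, ← mul_pow, ← mul_pow]
    simp
  rw [pPart, padicValInt, ← natCard_pow_eq_one hp hm0 hN]
  refine Nat.card_congr (φ.toEquiv.subtypeEquiv fun χ => ?_)
  change _ ↔ φ χ ^ _ = 1
  rw [← map_pow, map_eq_one_iff φ φ.injective, MonoidHom.ext_iff, MonoidHom.ext_iff]
  refine forall_congr' fun a => ?_
  rw [iterate_twist_apply, MonoidHom.pow_apply, MonoidHom.one_apply, ← hm', ← zpow_natCast,
    Int.natCast_natAbs, zpow_abs_eq_one, zpow_sub, zpow_one, mul_inv_eq_one]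

end FixedPoints

/-! ### Dimensions of sums of components -/

section Support

variable {F E A : Type*} [Field F] [Finite F] [Field E] [Algebra F E] [CommGroup A] [Finite A]
  [IsAlgClosed E]

theorem finrank_part_sum (hA : (Nat.card A : E) ≠ 0) {f : (A →* Eˣ) → A →* Eˣ}
    (hf : Function.Injective f) {e : Cycles hf → MonoidAlgebra F A}
    (he : ∀ o, IsIndicator F {χ | cycleOf hf χ = o} (e o)) (S : Finset (Cycles hf)) :
    Module.finrank F (part (MonoidAlgebra F A) (∑ o ∈ S, e o)) = ∑ o ∈ S, cycleLen hf o := by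
  classical
  have h1 : IsIndicator F {χ | cycleOf hf χ ∈ S} (∑ o ∈ S, e o) := by
    constructor
    · intro χ hχ
      rw [map_sum, Finset.sum_eq_single_of_mem _ hχ, (he _).one χ rfl]
      intro o _ ho
      exact (he o).zero χ fun h => ho h.symm
    · intro χ hχ
      rw [map_sum]
      refine Finset.sum_eq_zero fun o ho => (he o).zero χ fun h => hχ ?_
      rw [Set.mem_ofPred_eq] at h ⊢
      rwa [h]
  have := Fintype.ofFinite (A →* Eˣ)
  rw [h1.finrank_eq hA, Set.ncard_eq_toFinset_card',
    Finset.card_eq_sum_card_fiberwise (f := cycleOf hf) (t := S)]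
  · refine Finset.sum_congr rfl fun o ho => ?_
    rw [cycleLen, Set.ncard_eq_toFinset_card']
    congr 1
    ext χ
    simp only [Set.mem_toFinset, Set.mem_ofPred_eq, mem_filter]
    exact ⟨fun h => h.2, fun h => ⟨h ▸ ho, h⟩⟩
  · intro χ hχ
    simpa using hχ

end Support

/-! ### Products over cycles and logarithmic derivatives -/

section GeneratingFunction

open PowerSeries

theorem coeff_X_mul_derivative (P : PowerSeries ℚ) (k : ℕ) :
    coeff k (X * derivative ℚ P) = k * coeff k P := by
  cases k with
  | zero => simp
  | succ k => rw [coeff_succ_X_mul, coeff_derivative, Nat.cast_succ, mul_comm]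

/-- The first coefficients of a power series are determined by those of its logarithmic
derivative. -/
theorem coeff_eq_of_logDeriv {P Q L M : PowerSeries ℚ} (hP : X * derivative ℚ P = P * L)
    (hQ : X * derivative ℚ Q = Q * M) (h0 : coeff 0 P = coeff 0 Q) {n : ℕ}
    (hLM : ∀ k ≤ n, coeff k L = coeff k M) (hL : coeff 0 L = 0) {k : ℕ} (hk : k ≤ n) :
    coeff k P = coeff k Q := by
  induction k using Nat.strong_induction_on with
  | _ k ih =>
  rcases Nat.eq_zero_or_pos k with rfl | hpos
  · exact h0
  have h1 := congrArg (coeff k) hP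
  have h2 := congrArg (coeff k) hQ
  rw [coeff_X_mul_derivative, coeff_mul] at h1 h2
  -- Coefficient `k` of the unknown series occurs on the right only with the constant term of `L`,
  -- which is zero; all other terms involve earlier coefficients.
  have h3 : ∑ x ∈ antidiagonal k, coeff x.1 P * coeff x.2 L =
      ∑ x ∈ antidiagonal k, coeff x.1 Q * coeff x.2 M := by
    refine Finset.sum_congr rfl fun x hx => ?_
    rw [HasAntidiagonal.mem_antidiagonal] at hx
    rcases Nat.eq_zero_or_pos x.2 with hx0 | hx0
    · rw [hx0, ← hLM 0 (Nat.zero_le n), hL, mul_zero, mul_zero]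
    · rw [ih x.1 (by omega) (by omega), hLM x.2 (by omega)]
  have hk0 : (k : ℚ) ≠ 0 := Nat.cast_ne_zero.2 hpos.ne'
  exact mul_left_cancel₀ hk0 (h1.trans (h3.trans h2.symm))

/-- The logarithmic derivative of `1 - (-X) ^ d`. -/
def cycleSeries (d : ℕ) : PowerSeries ℚ :=
  PowerSeries.mk fun k => if k ≠ 0 ∧ d ∣ k then (-1) ^ (k + 1) * (d : ℚ) else 0

theorem logDeriv_cycle {d : ℕ} (hd : 0 < d) :
    X * derivative ℚ (1 + C ((-1 : ℚ) ^ (d + 1)) * X ^ d) =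
      (1 + C ((-1 : ℚ) ^ (d + 1)) * X ^ d) * cycleSeries d := by
  ext k
  rw [coeff_X_mul_derivative, add_mul, one_mul, map_add, map_add, mul_assoc, coeff_C_mul,
    coeff_C_mul, coeff_X_pow_mul', coeff_X_pow, coeff_one, cycleSeries, coeff_mk, coeff_mk]
  rcases Nat.eq_zero_or_pos k with rfl | hk
  · simp [hd.ne']
  rw [if_neg hk.ne', zero_add]
  by_cases hdk : d ∣ k
  · obtain ⟨m, rfl⟩ := hdk
    obtain ⟨m, rfl⟩ : ∃ m', m = m' + 1 := ⟨m - 1, by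
      rcases m with _ | m
      · simp at hk
      · simp⟩
    have h1 : d * (m + 1) - d = d * m := by rw [mul_add, mul_one, Nat.add_sub_cancel]
    have h2 : d ≤ d * (m + 1) := Nat.le_mul_of_pos_right d (Nat.succ_pos m)
    have h5 : d * (m + 1) ≠ 0 ∧ d ∣ d * (m + 1) := ⟨hk.ne', dvd_mul_right d _⟩
    rw [if_pos h2, h1, if_pos h5]
    rcases Nat.eq_zero_or_pos m with rfl | hm
    · simp [mul_comm]
    · have h3 : d * (m + 1) ≠ d := by
        have : 0 < d * m := Nat.mul_pos hd hm
        rw [mul_add]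
        omega
      have h6 : d * m ≠ 0 ∧ d ∣ d * m := ⟨(Nat.mul_pos hd hm).ne', dvd_mul_right d _⟩
      rw [if_neg h3, if_pos h6, mul_zero, mul_zero,
        ← mul_assoc, ← pow_add]
      have h4 : d + 1 + (d * m + 1) = d * (m + 1) + 1 + 1 := by ring
      rw [h4, pow_succ _ (d * (m + 1) + 1)]
      ring
  · have h3 : k ≠ d := fun h => hdk (h ▸ dvd_rfl)
    rw [if_neg h3, if_neg fun h => hdk h.2]
    split_ifs with h4 h5
    · exact absurd ((Nat.dvd_sub_iff_left h4 dvd_rfl).1 h5.2) hdk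
    · simp
    · simp

theorem logDeriv_prod {ι : Type*} (s : Finset ι) (f L : ι → PowerSeries ℚ)
    (h : ∀ i ∈ s, X * derivative ℚ (f i) = f i * L i) :
    X * derivative ℚ (∏ i ∈ s, f i) = (∏ i ∈ s, f i) * ∑ i ∈ s, L i := by
  classical
  induction s using Finset.induction_on with
  | empty => simp
  | insert i s hi ih =>
    have h1 := h i (mem_insert_self i s)
    have h2 := ih fun j hj => h j (mem_insert_of_mem hj)
    rw [Finset.prod_insert hi, Finset.sum_insert hi, Derivation.leibniz, smul_eq_mul, smul_eq_mul]
    linear_combination (∏ i ∈ s, f i) * h1 + f i * h2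

theorem coeff_prod_cycles {R ι : Type*} [CommRing R] [Fintype ι] (d : ι → ℕ) (s : ι → R) (n : ℕ) :
    coeff n (∏ i, (1 + C (s i) * X ^ d i)) =
      ∑ S : Finset ι with ∑ i ∈ S, d i = n, ∏ i ∈ S, s i := by
  classical
  rw [Finset.prod_one_add, map_sum, Finset.powerset_univ, Finset.sum_filter]
  refine Finset.sum_congr rfl fun S _ => ?_
  rw [Finset.prod_mul_distrib, ← map_prod, Finset.prod_pow_eq_pow_sum, coeff_C_mul, coeff_X_pow]
  simp only [eq_comm (a := n), mul_ite, mul_one, mul_zero]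

theorem hasSubst_exponentSeries (p r q : ℕ) : HasSubst (exponentSeries p r q) :=
  HasSubst.of_constantCoeff_zero' (by
    rw [← coeff_zero_eq_constantCoeff_apply, exponentSeries, coeff_mk, if_pos rfl])

theorem logDeriv_expSeries (p r q : ℕ) :
    X * derivative ℚ (expSeries (exponentSeries p r q)) =
      expSeries (exponentSeries p r q) * (X * derivative ℚ (exponentSeries p r q)) := by
  rw [expSeries, derivative_subst (hasSubst_exponentSeries p r q), derivative_exp]
  ring

theorem coeff_zero_expSeries (p r q : ℕ) : coeff 0 (expSeries (exponentSeries p r q)) = 1 := by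
  have hs := hasSubst_exponentSeries p r q
  -- Substituting a series without constant term into `exp - 1`, which has none either, leaves
  -- constant term zero.
  have h1 : (exp ℚ) = 1 + (exp ℚ - 1) := by ring
  have h0 : constantCoeff (exponentSeries p r q) = 0 := by
    rw [← coeff_zero_eq_constantCoeff_apply, exponentSeries, coeff_mk, if_pos rfl]
  have h2 : constantCoeff ((exp ℚ - 1).subst (exponentSeries p r q)) = 0 :=
    constantCoeff_subst_eq_zero h0 _ (by simp)
  rw [expSeries, h1, subst_add hs, map_add, coeff_zero_eq_constantCoeff_apply,
    coeff_zero_eq_constantCoeff_apply, h2, add_zero]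
  have h3 : (1 : PowerSeries ℚ).subst (exponentSeries p r q) = 1 := by
    rw [← coe_substAlgHom hs, map_one]
  rw [h3, map_one]

theorem coeff_X_mul_derivative_exponentSeries (p r q : ℕ) {k : ℕ} (hk : k ≠ 0) :
    coeff k (X * derivative ℚ (exponentSeries p r q)) =
      (-1) ^ (k + 1) * (pPart p ((q : ℤ) ^ k - (-1) ^ k) : ℚ) ^ r := by
  rw [coeff_X_mul_derivative, exponentSeries, coeff_mk, if_neg hk,
    mul_div_cancel₀ _ (Nat.cast_ne_zero.2 hk)]

/-- The product of `1 - (-X) ^ d` over the cycle lengths `d` of a permutation agrees up to degree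
`n` with the exponential series if the iterates have the right numbers of fixed points. -/
theorem coeff_prod_eq_coeff_expSeries {α : Type*} [Finite α] {f : α → α}
    (hf : Function.Injective f) [Fintype (Cycles hf)] {p q r n : ℕ}
    (hfix : ∀ k ≠ 0, k ≤ n →
      Nat.card {x // f^[k] x = x} = pPart p ((q : ℤ) ^ k - (-1) ^ k) ^ r) :
    coeff n (∏ o : Cycles hf, (1 + C ((-1 : ℚ) ^ (cycleLen hf o + 1)) * X ^ cycleLen hf o)) =
      coeff n (expSeries (exponentSeries p r q)) := by
  -- The cycles whose length divides `k` contribute their lengths, which together count the fixed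
  -- points of the `k`th iterate.
  have hL : ∀ k, coeff k (∑ o : Cycles hf, cycleSeries (cycleLen hf o)) =
      if k = 0 then 0 else (-1) ^ (k + 1) * (Nat.card {x // f^[k] x = x} : ℚ) := by
    intro k
    rw [map_sum]
    simp only [cycleSeries, coeff_mk]
    split_ifs with hk
    · simp [hk]
    · rw [← sum_cycleLen_dvd hf, Nat.cast_sum, Finset.mul_sum, Finset.sum_filter]
      simp [hk]
  refine coeff_eq_of_logDeriv (logDeriv_prod univ _ _ fun o _ => logDeriv_cycle (cycleLen_pos hf o))
    (logDeriv_expSeries p r q) ?_ (n := n) ?_ ?_ le_rfl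
  · rw [coeff_zero_expSeries, coeff_zero_eq_constantCoeff_apply, map_prod]
    refine Finset.prod_eq_one fun o _ => ?_
    simp [(cycleLen_pos hf o).ne']
  · intro k hk
    rw [hL]
    split_ifs with hk0
    · rw [hk0, coeff_zero_X_mul]
    · rw [coeff_X_mul_derivative_exponentSeries p r q hk0, hfix k hk0 hk, Nat.cast_pow]
  · rw [hL, if_pos rfl]

end GeneratingFunction

/-! ### The case that `p` does not divide `q` -/

section Coprime

open PowerSeries

variable {F : Type*} [Field F] [Finite F]

theorem not_forall_form_eq_zero {q n : ℕ} {c : F} (hq : IsPrimePow q) (hF : Nat.card F = q ^ 2)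
    (hn : 1 ≤ n) (hc : c ^ (q - 1) = (-1) ^ (n + 1)) :
    ¬ ∀ u v : Fin n → F, form q c u v = 0 := by
  obtain ⟨τ, hτ⟩ := exists_frobenius hq hF F
  intro h
  have h1 := (isHermitian_form hq hF hτ hc).nondeg (Pi.single ⟨0, hn⟩ 1) (h _)
  have h2 := congrFun h1 ⟨0, hn⟩
  simp at h2

/-- The coefficients of the generating function if `p` does not divide `q`. -/
theorem exists_int_eq_of_not_dvd {p q r n : ℕ} (hp : p.Prime) (hq : IsPrimePow q)
    (hF : Nat.card F = q ^ 2) (hpq : ¬ p ∣ q) (hn : 1 ≤ n) {c : F}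
    (hc : c ^ (q - 1) = (-1) ^ (n + 1)) :
    ∃ z : ℤ, (z : ℚ) = -primaryEulerChar p (r + 1) q n c ∧
      (z : ℚ) = coeff n (expSeries (exponentSeries p r q)) := by
  classical
  obtain ⟨τ, hτ⟩ := exists_frobenius hq hF F
  obtain ⟨l, i, hl, hqi, hchar⟩ := exists_char hq hF
  let E := AlgebraicClosure F
  -- The first summand ensures that `p^N` kills the elements of `p`-power order of the group, the
  -- second that the `p`-parts of `q^k - (-1)^k` for `1 ≤ k ≤ n` divide `p^N`. The term `k = 0` has
  -- valuation `0` by convention.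
  let N := Nat.card (GU q n c) + ∑ k ∈ range (n + 1), padicValInt p ((q : ℤ) ^ k - (-1) ^ k)
  let A := ZPow (p ^ N) r
  have : NeZero (p ^ N) := ⟨pow_ne_zero _ hp.ne_zero⟩
  have : Finite (Multiplicative (ZMod (p ^ N))) := inferInstanceAs (Finite (ZMod (p ^ N)))
  have hcardA : Nat.card A = (p ^ N) ^ r := by
    rw [Nat.card_pi, Finset.prod_const, Nat.card_congr Multiplicative.toAdd, Nat.card_zmod,
      Finset.card_univ, Fintype.card_fin]
  have hpF : (p : F) ≠ 0 := by
    rw [ne_eq, CharP.cast_eq_zero_iff F l]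
    intro h
    rw [Nat.prime_dvd_prime_iff_eq hl hp] at h
    have hi : i ≠ 0 := by
      rintro rfl
      rw [pow_zero] at hqi
      exact hq.one_lt.ne' hqi
    exact hpq (by rw [hqi, ← h]; exact dvd_pow_self l hi)
  have hAF : (Nat.card A : F) ≠ 0 := by
    rw [hcardA, Nat.cast_pow, Nat.cast_pow]
    exact pow_ne_zero _ (pow_ne_zero _ hpF)
  have hA : (Nat.card A : E) ≠ 0 := by
    rw [← map_natCast (algebraMap F E)]
    exact (map_ne_zero _).2 hAF
  have : NeZero (Nat.card A : F) := ⟨hAF⟩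
  have : IsSemisimpleRing (MonoidAlgebra F A) :=
    inferInstanceAs (IsSemisimpleModule (MonoidAlgebra F A) (MonoidAlgebra F A))
  have hf : Function.Injective (twist q : (A →* Eˣ) → A →* Eˣ) := twist_injective hq hF (F := F)
  have := Fintype.ofFinite (Cycles hf)
  choose e he using fun o : Cycles hf => exists_isIndicator (F := F) (E := E) hq hF hA
    {χ | cycleOf hf χ = o} fun χ => by
      simp only [Set.mem_ofPred_eq, cycleOf_apply]
  have hd := isDecomposition_of_isIndicator hq hF hτ hA hf he
  have h0 : ∀ o, e o ≠ 0 := fun o => by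
    obtain ⟨χ, hχ⟩ := cycleOf_surjective hf o
    exact (he o).ne_zero hχ
  have hgen : IsUniversalTuple p (zpowGen (p ^ N) r) (GU q n c) := by
    refine isUniversalTuple_zpowGen hp fun g ⟨k, hk⟩ => ?_
    rw [← orderOf_dvd_iff_pow_eq_one, hk]
    refine pow_dvd_pow p ?_
    have h1 : p ^ k ≤ Nat.card (GU q n c) := hk ▸ orderOf_le_card
    have h2 := Nat.lt_pow_self hp.one_lt (n := k)
    omega
  have : Finite (A →* GU q n c) := Finite.of_injective _ DFunLike.coe_injective
  have := Fintype.ofFinite (A →* GU q n c)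
  have : ∀ ρ : A →* GU q n c, Fintype (Submodule (MonoidAlgebra F A) (RepSpace ρ)) := fun ρ =>
    Fintype.ofFinite _
  have : ∀ ρ : A →* GU q n c, Fintype (RepSpace ρ ≃ₗ[MonoidAlgebra F A] RepSpace ρ) := fun ρ =>
    have : Finite (RepSpace ρ ≃ₗ[MonoidAlgebra F A] RepSpace ρ) :=
      Finite.of_injective _ DFunLike.coe_injective
    Fintype.ofFinite _
  refine ⟨∑ S : Finset (Cycles hf) with ∑ o ∈ S, cycleLen hf o = n,
    ∏ o ∈ S, (-1) ^ (cycleLen hf o + 1), ?_, ?_⟩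
  · rw [primaryEulerChar, finsum_primaryTuples (not_forall_form_eq_zero hq hF hn hc) hgen,
      sum_mobSum_eq_sum_prod hq hF hτ hc
        (fun u hu => exists_norm_groupAlgebra hq hF hτ hA hf he hu) hd h0]
    simp only [finrank_part_sum hA hf he]
    have hG : (Nat.card (GU q n c) : ℚ) ≠ 0 := Nat.cast_ne_zero.2 Nat.card_pos.ne'
    rw [Int.cast_mul, Int.cast_natCast, neg_div, neg_neg, mul_div_cancel_left₀ _ hG]
  · rw [← coeff_prod_eq_coeff_expSeries hf (n := n), coeff_prod_cycles]
    · push_cast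
      rfl
    · intro k hk hkn
      refine natCard_fixed_twist hp hq.one_lt hk hA ?_
      have h1 : padicValInt p ((q : ℤ) ^ k - (-1) ^ k) ≤
          ∑ k ∈ range (n + 1), padicValInt p ((q : ℤ) ^ k - (-1) ^ k) :=
        Finset.single_le_sum (f := fun k => padicValInt p ((q : ℤ) ^ k - (-1) ^ k))
          (fun _ _ => Nat.zero_le _) (mem_range.2 (by omega))
      exact h1.trans (Nat.le_add_left _ _)

end Coprime

/-! ### Weisner's theorem and vanishing of Möbius sums -/

section Weisner

variable {α : Type*} [Lattice α] [BoundedOrder α] [Fintype α]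

open scoped Classical in
/-- Weisner's theorem. -/
theorem sum_mob_sup_eq {S : Set α} (hsup : ∀ x ∈ S, ∀ y ∈ S, x ⊔ y ∈ S) {Z : α} (hZ : Z ∈ S)
    (hZ0 : Z ≠ ⊥) {W : α} (hW : W ∈ S) (hZW : Z ≤ W) :
    ∑ x with x ∈ S ∧ x ⊔ Z = W, mob S x = 0 := by
  induction W using WellFoundedLT.induction with
  | _ W ih =>
  -- The vanishing total is grouped by the value of `x ⊔ Z`; the groups with value below `W` vanish
  -- by induction, hence so does the group of `W`.
  have h1 : ∑ y with y ≤ W ∧ y ∈ S, mob S y = 0 := by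
    rw [sum_mob S hW, if_neg]
    rintro rfl
    exact hZ0 (le_bot_iff.1 hZW)
  rw [← Finset.sum_fiberwise_of_maps_to (g := fun x => x ⊔ Z)
    (t := univ.filter fun y => Z ≤ y ∧ y ≤ W ∧ y ∈ S) (fun x hx => by
      simp only [mem_filter, mem_univ, true_and] at hx ⊢
      exact ⟨le_sup_right, sup_le hx.1 hZW, hsup x hx.2 Z hZ⟩),
    Finset.sum_eq_single_of_mem W (by simp [hZW, hW])] at h1
  · rw [← h1]
    refine Finset.sum_congr ?_ fun _ _ => rfl
    ext x
    simp only [mem_filter, mem_univ, true_and]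
    constructor
    · rintro ⟨hx, rfl⟩
      exact ⟨⟨le_sup_left, hx⟩, rfl⟩
    · rintro ⟨⟨-, hx⟩, h⟩
      exact ⟨hx, h⟩
  · intro y hy hne
    simp only [mem_filter, mem_univ, true_and] at hy
    rw [← ih y (lt_of_le_of_ne hy.2.1 hne) hy.2.2 hy.1]
    refine Finset.sum_congr ?_ fun _ _ => rfl
    ext x
    simp only [mem_filter, mem_univ, true_and]
    constructor
    · rintro ⟨⟨-, hx⟩, h⟩
      exact ⟨hx, h⟩
    · rintro ⟨hx, rfl⟩
      exact ⟨⟨le_sup_left.trans hy.2.1, hx⟩, rfl⟩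

open scoped Classical in
/-- If every element meets `L`, then the Möbius function lives below `L`; if in addition the
elements below `L` can be joined with `Z`, then the sum of its values vanishes. -/
theorem mobSum_eq_zero_of_sup {S : Set α} {I : α → Prop} (hinf : ∀ x ∈ S, ∀ y ∈ S, x ⊓ y ∈ S)
    (hsup : ∀ x ∈ S, ∀ y ∈ S, x ⊔ y ∈ S) {L Z : α} (hL : L ∈ S) (hZ : Z ∈ S) (hZL : Z ≤ L)
    (hZ0 : Z ≠ ⊥) (hfix : ∀ x ∈ S, x ⊓ L = ⊥ → x = ⊥) (hmono : ∀ x y, x ≤ y → I y → I x)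
    (hI : ∀ x ∈ S, x ≤ L → I x → I (x ⊔ Z)) : mobSum S I ⊤ = 0 := by
  -- The truncated function sums below `x` to the sum of `mob` below `x ⊓ L`, which is nonzero only
  -- if `x ⊓ L`, hence `x`, is the bottom. So it satisfies the equations that determine `mob`.
  have h1 : ∀ x ∈ S, mob S x = if x ≤ L then mob S x else 0 := by
    intro x hx
    refine mob_unique S (fun x => if x ≤ L then mob S x else 0) (fun x hx => ?_) hx
    have h2 := sum_mob S (hinf x hx L hL)
    rw [← Finset.sum_filter, Finset.filter_filter]
    have h3 : (x = ⊥) = (x ⊓ L = ⊥) := propext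
      ⟨fun h => by rw [h, bot_inf_eq], hfix x hx⟩
    simp only [h3]
    rw [← h2]
    refine Finset.sum_congr ?_ fun _ _ => rfl
    ext y
    simp only [mem_filter, mem_univ, true_and, le_inf_iff]
    tauto
  rw [mobSum, Finset.sum_congr rfl fun x hx => h1 x (mem_filter.1 hx).2.2.1, ← Finset.sum_filter,
    Finset.filter_filter, ← Finset.sum_fiberwise_of_maps_to (g := fun x => x ⊔ Z)
      (t := univ.filter fun y => Z ≤ y ∧ y ≤ L ∧ y ∈ S ∧ I y)]
  · refine Finset.sum_eq_zero fun y hy => ?_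
    simp only [mem_filter, mem_univ, true_and] at hy
    rw [← sum_mob_sup_eq hsup hZ hZ0 hy.2.2.1 hy.1]
    refine Finset.sum_congr ?_ fun _ _ => rfl
    ext x
    simp only [mem_filter, mem_univ, true_and]
    constructor
    · rintro ⟨⟨⟨-, hx, -⟩, -⟩, h⟩
      exact ⟨hx, h⟩
    · rintro ⟨hx, rfl⟩
      exact ⟨⟨⟨le_top, hx, hmono _ _ le_sup_left hy.2.2.2⟩, le_sup_left.trans hy.2.1⟩, rfl⟩
  · intro x hx
    simp only [mem_filter, mem_univ, true_and] at hx ⊢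
    exact ⟨le_sup_right, sup_le hx.2 hZL, hsup x hx.1.2.1 Z hZ, hI x hx.1.2.1 hx.2 hx.1.2.2⟩

end Weisner

/-! ### The case that `p` divides `q` -/

section DefiningCharacteristic

variable {F A V : Type*} [Field F] [CommGroup A] [AddCommGroup V] [Module F V]
  [Module (MonoidAlgebra F A) V]

/-- The vectors fixed by the group. -/
def fixedSubmodule (F A V : Type*) [Field F] [CommGroup A] [AddCommGroup V]
    [Module (MonoidAlgebra F A) V] : Submodule (MonoidAlgebra F A) V where
  carrier := {x | ∀ a : A, MonoidAlgebra.single a (1 : F) • x = x}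
  add_mem' := fun hx hy a => by rw [smul_add, hx, hy]
  zero_mem' := fun a => smul_zero _
  smul_mem' := fun r x hx a => by rw [smul_comm, hx]

/-- A `p`-group acting on a set of cardinality divisible by `p` and fixing `0` has a second fixed
point. -/
theorem inf_fixedSubmodule_ne_bot [Finite F] [Finite V] [IsScalarTower F (MonoidAlgebra F A) V]
    {p : ℕ} (hp : p.Prime) (hpF : p ∣ Nat.card F) (hA : IsPGroup p A)
    {U : Submodule (MonoidAlgebra F A) V} (hU : U ≠ ⊥) : U ⊓ fixedSubmodule F A V ≠ ⊥ := by
  have : Fact p.Prime := ⟨hp⟩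
  let _ : MulAction A U := MulAction.compHom U (MonoidAlgebra.of F A)
  have hsmul : ∀ (a : A) (u : U), a • u = MonoidAlgebra.single a (1 : F) • u := fun _ _ => rfl
  have hcard : p ∣ Nat.card U := by
    rw [Module.natCard_eq_pow_finrank (K := F) (V := U)]
    refine dvd_pow hpF fun h0 => hU ?_
    have h1 := Module.natCard_eq_pow_finrank (K := F) (V := U)
    rw [h0, pow_zero, Nat.card_eq_one_iff_unique] at h1
    exact (Submodule.subsingleton_iff_eq_bot).1 h1.1
  obtain ⟨b, hb, hb0⟩ := hA.exists_fixed_point_of_prime_dvd_card_of_fixed_point U hcard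
    (a := 0) fun a => by rw [hsmul, smul_zero]
  rw [Submodule.ne_bot_iff]
  refine ⟨b, ⟨b.2, fun a => ?_⟩, fun h => hb0 (Subtype.ext h.symm)⟩
  have := hb a
  rw [hsmul] at this
  exact congrArg Subtype.val this

/-- A nonzero functional vanishing on `L` is represented by a nonzero vector orthogonal to `L`. -/
theorem IsHermitian.perp_ne_bot {F R V : Type*} [Field F] [CommRing R] [Algebra F R]
    [AddCommGroup V] [Module F V] [Module R V] [IsScalarTower F R V] [Finite F] [Finite V]
    {τ : F →+* F} {σ : R →+* R} {h : V → V → F} (hσ : IsInvolution τ σ) (hh : IsHermitian τ σ h)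
    {L : Submodule R V} (hL : L ≠ ⊤) : hh.perp hσ L ≠ ⊥ := by
  obtain ⟨f, hf0, hf⟩ := Submodule.exists_le_ker_of_lt_top (L.restrictScalars F)
    (lt_top_iff_ne_top.2 fun h0 => hL ((Submodule.restrictScalars_eq_top_iff F R V).1 h0))
  obtain ⟨u, -, hu⟩ := (perfect_top hh (R := R)).exists_repr hh
    (f ∘ₗ ((⊤ : Submodule R V).restrictScalars F).subtype)
  have hu' : ∀ x, f x = h x u := fun x => hu ⟨x, trivial⟩
  rw [Submodule.ne_bot_iff]
  refine ⟨u, fun x hx => ?_, ?_⟩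
  · rw [← hu']
    exact hf hx
  · rintro rfl
    refine hf0 (LinearMap.ext fun x => ?_)
    rw [hu', hh.zero_right, LinearMap.zero_apply]

/-- The Möbius sums vanish if a `p`-group acts nontrivially in characteristic `p`. -/
theorem mobSum_eq_zero_of_isPGroup [Finite F] [Finite V] [IsScalarTower F (MonoidAlgebra F A) V]
    [Fintype (Submodule (MonoidAlgebra F A) V)] {τ : F →+* F}
    {σ : MonoidAlgebra F A →+* MonoidAlgebra F A} {h : V → V → F} (hσ : IsInvolution τ σ)
    (hh : IsHermitian τ σ h) {p : ℕ} (hp : p.Prime) (hpF : p ∣ Nat.card F) (hA : IsPGroup p A)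
    (hL : fixedSubmodule F A V ≠ ⊤) {X : V ≃ₗ[MonoidAlgebra F A] V}
    (hX : X ∈ isomGroup (MonoidAlgebra F A) h) : mobSum (invSet X) (Isotropic h) ⊤ = 0 := by
  have hLX : fixedSubmodule F A V ∈ invSet X := mem_invSet_of_le fun x hx a => by
    rw [← map_smul, hx a]
  have hPX := perp_mem_invSet hσ hh hX hLX
  -- Let `L` be the fixed space and `Z` its radical `L^⊥ ⊓ L`. As `L` is proper, `L^⊥` is a nonzero
  -- submodule and so contains nonzero fixed vectors. Being orthogonal to `L` and isotropic, `Z` can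
  -- be joined to any isotropic submodule of `L`.
  refine mobSum_eq_zero_of_sup (L := fixedSubmodule F A V)
    (Z := hh.perp hσ (fixedSubmodule F A V) ⊓ fixedSubmodule F A V)
    (fun x hx y hy => inf_mem_invSet hx hy) (fun x hx y hy => sup_mem_invSet hx hy) hLX
    (inf_mem_invSet hPX hLX) inf_le_right
    (inf_fixedSubmodule_ne_bot hp hpF hA (hh.perp_ne_bot hσ hL)) (fun x _ hx => ?_)
    (fun x y hxy hy u hu v hv => hy u (hxy hu) v (hxy hv)) fun x _ hxL hx => ?_
  · by_contra hne
    exact inf_fixedSubmodule_ne_bot hp hpF hA hne hx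
  · refine (isotropic_sup_iff hh fun a ha b hb => ?_).2 ⟨hx, fun u hu v hv => ?_⟩
    · exact hb.1 a (hxL ha)
    · exact hv.1 u hu.2

theorem fixedSubmodule_repSpace_ne_top {q n : ℕ} {c : F} {ρ : A →* GU q n c} (hρ : ρ ≠ 1) :
    fixedSubmodule F A (RepSpace ρ) ≠ ⊤ := by
  intro h0
  refine hρ (MonoidHom.ext fun a => Subtype.ext (LinearEquiv.ext fun x => ?_))
  have h1 : (show RepSpace ρ from x) ∈ fixedSubmodule F A (RepSpace ρ) := h0 ▸ Submodule.mem_top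
  have h2 := h1 a
  rw [single_smul, one_smul] at h2
  exact h2

variable [Finite F]

/-- A nontrivial later entry means that the `p`-group `A` acts nontrivially, so its fixed space is
proper and the Möbius sum vanishes. -/
theorem reducedEulerChar_fixedPoset_eq_zero {p q r n : ℕ} (hp : p.Prime) (hq : IsPrimePow q)
    (hF : Nat.card F = q ^ 2) (hpq : p ∣ q) (hn : 1 ≤ n) {c : F}
    (hc : c ^ (q - 1) = (-1) ^ (n + 1)) {X : Fin (r + 1) → GU q n c}
    (hX : X ∈ primaryTuples p (r + 1) (GU q n c)) {i : Fin r} (hi : X i.succ ≠ 1) :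
    reducedEulerChar (FixedPoset X) = 0 := by
  obtain ⟨τ, hτ⟩ := exists_frobenius hq hF F
  let N := Nat.card (GU q n c)
  have : NeZero (p ^ N) := ⟨pow_ne_zero _ hp.ne_zero⟩
  have : Finite (Multiplicative (ZMod (p ^ N))) := inferInstanceAs (Finite (ZMod (p ^ N)))
  have hgen : IsUniversalTuple p (zpowGen (p ^ N) r) (GU q n c) := by
    refine isUniversalTuple_zpowGen hp fun g ⟨k, hk⟩ => ?_
    rw [← orderOf_dvd_iff_pow_eq_one, hk]
    refine pow_dvd_pow p ?_
    have h1 : p ^ k ≤ Nat.card (GU q n c) := hk ▸ orderOf_le_card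
    exact (Nat.lt_pow_self hp.one_lt (n := k)).le.trans h1
  have hA : IsPGroup p (ZPow (p ^ N) r) := by
    refine IsPGroup.of_card (n := N * r) ?_
    rw [Nat.card_pi, Finset.prod_const, Nat.card_congr Multiplicative.toAdd, Nat.card_zmod,
      Finset.card_univ, Fintype.card_fin, pow_mul]
  obtain ⟨⟨ρ, g⟩, hρ⟩ := (tupleOf_bijective hgen).2 ⟨X, hX⟩
  obtain rfl : tupleOf (zpowGen (p ^ N) r) ⟨ρ, g⟩ = X := congrArg Subtype.val hρ
  have hρ1 : ρ ≠ 1 := by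
    rintro rfl
    exact hi rfl
  have := Fintype.ofFinite (Submodule (MonoidAlgebra F (ZPow (p ^ N) r)) (RepSpace ρ))
  rw [reducedEulerChar_fixedPoset hgen.closure (not_forall_form_eq_zero hq hF hn hc) g rfl
    fun i => rfl, mobSum_eq_zero_of_isPGroup (isInvolution_conj hq hF hτ)
      (isHermitian_repForm hq hF hτ hc ρ) hp (by rw [hF]; exact dvd_pow hpq two_ne_zero) hA
      (fixedSubmodule_repSpace_ne_top hρ1) (intertwinerEquiv_mem ρ g), neg_zero]

theorem reducedEulerChar_subtype_congr {P : Type*} [PartialOrder P] [Finite P] {s t : P → Prop}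
    (h : s = t) : reducedEulerChar {x // s x} = reducedEulerChar {x // t x} := by
  subst h
  rfl

/-- In the defining characteristic only the first entry of a tuple matters. -/
theorem primaryEulerChar_of_dvd {p q r n : ℕ} (hp : p.Prime) (hq : IsPrimePow q)
    (hF : Nat.card F = q ^ 2) (hpq : p ∣ q) (hn : 1 ≤ n) {c : F}
    (hc : c ^ (q - 1) = (-1) ^ (n + 1)) (l : ℕ) :
    primaryEulerChar p (r + 1) q n c = primaryEulerChar l 1 q n c := by
  have := Fintype.ofFinite (primaryTuples p (r + 1) (GU q n c))
  have := Fintype.ofFinite (primaryTuples l 1 (GU q n c))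
  rw [primaryEulerChar, primaryEulerChar, finsum_eq_sum_of_fintype, finsum_eq_sum_of_fintype]
  congr 1
  have hmem : ∀ g : GU q n c,
      (Fin.cons g 1 : Fin (r + 1) → GU q n c) ∈ primaryTuples p (r + 1) (GU q n c) := by
    intro g
    refine ⟨fun i j => ?_, fun i => ?_⟩
    · refine Fin.cases ?_ (fun i => ?_) i <;> refine Fin.cases ?_ (fun j => ?_) j
      · exact Commute.refl g
      · exact Commute.one_right g
      · exact Commute.one_left g
      · exact Commute.refl 1
    · refine Fin.cases (fun h => absurd rfl h) (fun i _ => ?_) i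
      exact ⟨0, by rw [pow_zero]; exact orderOf_one⟩
  -- One-element tuples are extended by trivial entries, which impose no condition on subspaces; all
  -- other tuples contribute zero. No order condition involving `l` applies to a tuple of length
  -- one.
  refine (Fintype.sum_of_injective (fun Y => ⟨Fin.cons (Y.1 0) 1, hmem (Y.1 0)⟩) ?_ _ _ ?_ ?_).symm
  · intro Y Y' h
    have h1 := congrFun (congrArg Subtype.val h) 0
    refine Subtype.ext (funext fun i => ?_)
    rw [Subsingleton.elim i 0]
    exact h1
  · intro X hX
    have h1 : ∃ i : Fin r, X.1 i.succ ≠ 1 := by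
      by_contra! h1
      refine hX ⟨⟨fun _ => X.1 0, fun _ _ => Commute.refl _, fun i hi => absurd (by simp) hi⟩,
        Subtype.ext (funext fun i => ?_)⟩
      refine Fin.cases rfl (fun i => ?_) i
      exact (h1 i).symm
    obtain ⟨i, hi⟩ := h1
    rw [reducedEulerChar_fixedPoset_eq_zero hp hq hF hpq hn hc X.2 hi, Int.cast_zero]
  · intro Y
    congr 1
    refine reducedEulerChar_subtype_congr (funext fun U => propext ⟨fun h => ?_, fun h i => ?_⟩)
    · exact Fin.cases (h 0) fun i => Submodule.map_id U.1
    · rw [Subsingleton.elim i 0]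
      exact h 0

/-- If `p` divides `q`, it is prime to `q^k - (-1)^k`, so all `p`-parts are `1` and neither the
exponent `r` nor the prime matters. -/
theorem exponentSeries_of_dvd {p q : ℕ} (hp : p.Prime) (hpq : p ∣ q) (r l : ℕ) :
    exponentSeries p r q = exponentSeries l 0 q := by
  have : Fact p.Prime := ⟨hp⟩
  ext k
  rw [exponentSeries, exponentSeries, PowerSeries.coeff_mk, PowerSeries.coeff_mk]
  split_ifs with hk
  · rfl
  have h1 : pPart p ((q : ℤ) ^ k - (-1) ^ k) = 1 := by
    rw [pPart, padicValInt.eq_zero_of_not_dvd, pow_zero]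
    intro h
    have h2 : (p : ℤ) ∣ (q : ℤ) ^ k := dvd_pow (Int.natCast_dvd_natCast.2 hpq) hk
    have h3 : (p : ℤ) ∣ (-1) ^ k := by
      have := dvd_sub h2 h
      rwa [sub_sub_cancel] at this
    have h4 := Int.natAbs_dvd_natAbs.2 h3
    rw [Int.natAbs_pow, Int.natAbs_natCast, Int.natAbs_neg, Int.natAbs_one, one_pow,
      Nat.dvd_one] at h4
    exact hp.one_lt.ne' h4
  rw [h1, Nat.cast_one, one_pow, pow_zero]

end DefiningCharacteristic

/-! ### Conclusion -/

/-- The coefficients of the generating function are integers and agree with the coefficients of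
the exponential series. -/
theorem exists_int_eq {F : Type*} [Field F] [Finite F] {p q r n : ℕ} (hp : p.Prime)
    (hq : IsPrimePow q) (hF : Nat.card F = q ^ 2) (hn : 1 ≤ n) {c : F}
    (hc : c ^ (q - 1) = (-1) ^ (n + 1)) :
    ∃ z : ℤ, (z : ℚ) = -primaryEulerChar p (r + 1) q n c ∧
      (z : ℚ) = PowerSeries.coeff n (expSeries (exponentSeries p r q)) := by
  by_cases hpq : p ∣ q
  -- Both sides have become independent of the prime; one larger than `q` cannot divide `q`, so the
  -- coprime case with `r = 0` applies.
  · obtain ⟨l, hql, hl⟩ := Nat.exists_infinite_primes (q + 1)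
    rw [primaryEulerChar_of_dvd hp hq hF hpq hn hc l, exponentSeries_of_dvd hp hpq r l]
    exact exists_int_eq_of_not_dvd hl hq hF (Nat.not_dvd_of_pos_of_lt hq.pos hql) hn hc
  · exact exists_int_eq_of_not_dvd hp hq hF hpq hn hc

end UnitaryBuilding

theorem mainTheorem2 {F : Type*} [Field F] [Finite F] (p q r : ℕ) (hp : p.Prime)
    (hq : IsPrimePow q) (hF : Nat.card F = q ^ 2)
    (c : ℕ → F) (hc : ∀ n, 1 ≤ n → c n ^ (q - 1) = (-1) ^ (n + 1)) :
    (∃ f : PowerSeries ℤ, f.map (Int.castRingHom ℚ) =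
      UnitaryBuilding.primaryGenFun p (r + 1) q c) ∧
    UnitaryBuilding.primaryGenFun p (r + 1) q c =
      UnitaryBuilding.expSeries (UnitaryBuilding.exponentSeries p r q) := by
  have key : ∀ n, ∃ z : ℤ,
      (z : ℚ) = PowerSeries.coeff n (UnitaryBuilding.primaryGenFun p (r + 1) q c) ∧
      (z : ℚ) = PowerSeries.coeff n
        (UnitaryBuilding.expSeries (UnitaryBuilding.exponentSeries p r q)) := by
    intro n
    rw [UnitaryBuilding.primaryGenFun, PowerSeries.coeff_mk]
    rcases Nat.eq_zero_or_pos n with rfl | hn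
    · exact ⟨1, by simp, by rw [UnitaryBuilding.coeff_zero_expSeries, Int.cast_one]⟩
    · rw [if_neg hn.ne']
      exact UnitaryBuilding.exists_int_eq hp hq hF hn (hc n hn)
  choose z hz1 hz2 using key
  refine ⟨⟨PowerSeries.mk z, ?_⟩, ?_⟩
  · ext n
    rw [PowerSeries.coeff_map, PowerSeries.coeff_mk, ← hz1]
    rfl
  · ext n
    rw [← hz1, hz2]
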